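/- Let $G$ be a group with a finite generating set $X=X^{-1}$. A word is a finite sequence of letters of $X$; $|w|$ is its length, and $|g|_G$ is the minimal length of a word representing $g\in G$ (for a word $w$, $|w|_G$ is the length of the element it represents). There is a constant $K$, depending only on $G$ and $X$, such that the following holds for every real $\delta\ge 1$ for which the Cayley graph of $G$ with respect to $X$ (with edges of length $1$) is $\delta$-hyperbolic, i.e. all geodesic triangles are $\delta$-thin: whenever two geodesic sides $\alpha,\beta$ of a triangle with corners $x,y,z$ start at the corner $z$ and end at $x$ and $y$ respectively, $d(\alpha(t),\beta(t))\le\delta$ for all $0\le t\le (x,y)_z=\frac12\bigl(d(x,z)+d(y,z)-d(x,y)\bigr)$. Put $L:=34\delta+2$. There is an algorithm \textsc{ShortenWords} which, given a list $A=(a_1,\ldots,a_m)$ of words, either - returns a word $c$ such that, for all $1\le i\le m$, $$|c^{-1}a_ia_{i+1}\cdots a_mc|_G\le 3^{m-i}\left(7L+\delta+\tfrac12\right),$$ or - returns integers $j$ and $k$ such that $1\le j\le k\le m$ and $a_ja_{j+1}\cdots a_k$ represents an element of infinite order in $G$. The algorithm runs in time $O(m^3\mu)$, where $\mu$ is the maximum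 of $1$ and the lengths of the words in $A$. Precisely, it is carried out by a multi-tape Turing machine (with finitely many stacks, a tape being a pair of stacks) that on input $A$ (the words written one after another, each followed by a separator) halts with its output (a tag followed by the word $c$, or by $j$ and $k$ in unary) after at most $K(m^3\mu+1)$ steps. -/

import Mathlib

namespace WordHyp

noncomputable section

/-! ### Words and word length -/

/-- A word over a finite ordered family of generators: a finite sequence of (indices of) letters. -/
abbrev Word (n : ℕ) : Type := List (Fin n)

/-- The element of `G` represented by a word. -/
def eval {G : Type*} [Group G] {n : ℕ} (X : Fin n → G) (w : Word n) : G :=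
  (w.map X).prod

/-- `|g|_G`: the minimum length of a word that represents `g`
(every `g` is represented by some word when `X` generates `G` and is closed under inverses). -/
def wordLength {G : Type*} [Group G] {n : ℕ} (X : Fin n → G) (g : G) : ℕ :=
  sInf {k : ℕ | ∃ w : Word n, w.length = k ∧ eval X w = g}

/-- The word metric on the vertices of the Cayley graph. -/
def wordDist {G : Type*} [Group G] {n : ℕ} (X : Fin n → G) (g h : G) : ℕ :=
  wordLength X (g⁻¹ * h)

/-! ### The Cayley graph as a metric space -/

/-- A point of the Cayley graph with edges of length `1`: the point at distance `pos` from `src` on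
the edge from `src` to `tgt`, where `tgt = src * X i` for some letter. A vertex may also be given by
the degenerate edge `tgt = src` of length `0`. A point has several such descriptions
(an edge can be traversed in both directions, a vertex lies on several edges);
two descriptions of the same point are at distance `0` from each other. -/
structure CayleyPoint {G : Type*} [Group G] {n : ℕ} (X : Fin n → G) where
  src : G
  tgt : G
  pos : ℝ
  edge : tgt = src ∨ ∃ i, tgt = src * X i
  pos_nonneg : 0 ≤ pos
  pos_le : pos ≤ wordDist X src tgt

namespace CayleyPoint

variable {G : Type*} [Group G] {n : ℕ} {X : Fin n → G}

/-- Distance from the point to the end `tgt` of its edge, along that edge. -/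
def copos (p : CayleyPoint X) : ℝ := wordDist X p.src p.tgt - p.pos

open Classical in
/-- The path metric of the Cayley graph: two points on a common edge are joined along that edge,
and otherwise a shortest path leaves the first edge through one of its ends and
enters the second edge through one of its ends. -/
def dist (p q : CayleyPoint X) : ℝ :=
  if p.src = q.src ∧ p.tgt = q.tgt then |p.pos - q.pos|
  else if p.src = q.tgt ∧ p.tgt = q.src then |p.pos - q.copos|
  else
    min
      (min (p.pos + wordDist X p.src q.src + q.pos) (p.pos + wordDist X p.src q.tgt + q.copos))
      (min (p.copos + wordDist X p.tgt q.src + q.pos) (p.copos + wordDist X p.tgt q.tgt + q.copos))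

end CayleyPoint

/-- `α : [0, l] → Γ` is a geodesic path from `x` to `y` in the Cayley graph. -/
structure IsGeodesic {G : Type*} [Group G] {n : ℕ} {X : Fin n → G}
    (α : ℝ → CayleyPoint X) (l : ℝ) (x y : CayleyPoint X) : Prop where
  length_nonneg : 0 ≤ l
  start : α 0 = x
  finish : α l = y
  dist_eq : ∀ s ∈ Set.Icc 0 l, ∀ t ∈ Set.Icc 0 l, (α s).dist (α t) = |s - t|

/-- The Gromov inner product `(x, y)_z`. -/
def gromovProduct {G : Type*} [Group G] {n : ℕ} {X : Fin n → G} (x y z : CayleyPoint X) : ℝ :=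
  (x.dist z + y.dist z - x.dist y) / 2

/-- The Cayley graph is `δ`-hyperbolic: all geodesic triangles are `δ`-thin, that is, corresponding
points on two sides are at distance at most `δ`. The condition is written at the corner `z`;
as all labellings of the corners and all orientations of the sides are quantified over, it covers
the other two corners as well. -/
def IsHyperbolic {G : Type*} [Group G] {n : ℕ} (X : Fin n → G) (δ : ℝ) : Prop :=
  ∀ (x y z : CayleyPoint X) (α β γ : ℝ → CayleyPoint X) (a b c : ℝ),
    IsGeodesic α a z x → IsGeodesic β b z y → IsGeodesic γ c x y →
    ∀ t : ℝ, 0 ≤ t → t ≤ gromovProduct x y z → (α t).dist (β t) ≤ δ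

/-! ### Input and output of the algorithm -/

/-- `a_j a_{j+1} ⋯ a_k` as an element of `G`, for `1 ≤ j ≤ k ≤ m` (the list is indexed from `1`). -/
def segmentProd {G : Type*} [Group G] {n : ℕ} (X : Fin n → G) (A : List (Word n)) (j k : ℕ) : G :=
  (((A.take k).drop (j - 1)).map (eval X)).prod

/-- The maximum length `μ` of the words in a list (`0` for the empty list). -/
def maxLength {n : ℕ} (A : List (Word n)) : ℕ :=
  (A.map List.length).foldr max 0

/-- What the algorithm may return: a word, or a pair of indices. -/
inductive Output (n : ℕ) : Type
  | conjugator (c : Word n)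
  | indices (j k : ℕ)

/-- The input as a string over the letters and a separator: each word is followed by `none`. -/
def encodeInput {n : ℕ} (A : List (Word n)) : List (Option (Fin n)) :=
  A.flatMap fun w => w.map some ++ [none]

/-- The output as a string: a tag that tells the two kinds of output apart, followed by the letters
of the word, or by the two indices in unary notation (with different digits). -/
def encodeOutput {n : ℕ} : Output n → List (Fin n ⊕ Bool)
  | .conjugator c => Sum.inr false :: c.map Sum.inl
  | .indices j k =>
      Sum.inr true :: (List.replicate j (Sum.inr false) ++ List.replicate k (Sum.inr true))

/-- The constant `L = 34 δ + 2`. -/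
def constL (δ : ℝ) : ℝ := 34 * δ + 2

/-- The output is correct for the input list `A = (a_1, …, a_m)`: it is either a word `c` with
`|c⁻¹ a_i ⋯ a_m c|_G ≤ 3 ^ (m - i) * (7 L + δ + 1 / 2)` for all `1 ≤ i ≤ m`, or a pair of indices
`1 ≤ j ≤ k ≤ m` such that `a_j ⋯ a_k` has infinite order. -/
def IsCorrectOutput {G : Type*} [Group G] {n : ℕ} (X : Fin n → G) (δ : ℝ) (A : List (Word n)) :
    Output n → Prop
  | .conjugator c =>
      ∀ i : ℕ, 1 ≤ i → i ≤ A.length →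
        (wordLength X ((eval X c)⁻¹ * segmentProd X A i A.length * eval X c) : ℝ)
          ≤ 3 ^ (A.length - i) * (7 * constL δ + δ + 1 / 2)
  | .indices j k =>
      1 ≤ j ∧ j ≤ k ∧ k ≤ A.length ∧ ¬ IsOfFinOrder (segmentProd X A j k)

/-! ### Running time -/

/-- Started on the encoding of `A`, the multi-stack Turing machine `M` halts after at most `T` steps
with the encoding of `out` as its output. (A machine has finitely many stacks, labels and internal
states; a step executes the fixed finite statement of the current label, so it amounts to a bounded
number of elementary operations, and only finitely many stack symbols ever occur. A tape with a head
is a pair of stacks.) -/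
def RunsInTime {n : ℕ} (M : Turing.TM2ComputableAux (Option (Fin n)) (Fin n ⊕ Bool))
    (A : List (Word n)) (out : Output n) (T : ℕ) : Prop :=
  Nonempty (Turing.TM2OutputsInTime M.tm ((encodeInput A).map M.inputAlphabet.symm)
    (some ((encodeOutput out).map M.outputAlphabet.symm)) T)

end

end WordHyp

/-! Let `δ₀` be the least admissible constant and `η = δ₀ + 1/2`. Thin triangles give Gromov's
four-point inequality with constant `η` on the vertices, and all later geometry uses only that. A
torsion element `f` satisfies `d(y, f²y) ≤ d(y, fy) + 2η` at every `y`, for otherwise the orbit of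
`y` would move away strictly (`IsOfFinOrder.rdist_sq_le`). Hence a torsion element `g` moves the
middle `q` of a geodesic from `1` to `g` by at most `6η`. If moreover `h` and `gh⁻¹` are torsion and
`|h| ≤ |g|`, then `h` moves `q` by at most `40η` (`IsMid.rdist_mul_le_of_isOfFinOrder`).

Suppose that all segments `a_j ⋯ a_k` have finite order. Take for `g` the longest final segment and
for `h` any other one; then `gh⁻¹` is a segment or the inverse of a segment. So conjugation by the
single element `q` makes all final segments shorter than `40η`, which is below `7L + δ + 1/2 = 239δ
+ 29/2`. The powers of `3` are not needed.

To turn this into an algorithm one needs, in linear time, a test for torsion and an approximate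
middle. Rewriting short subwords makes a word locally geodesic, and such words are uniform
quasigeodesics (`IsLocalGeod.rdist_add_le`, `IsLocalGeod.sub_le`). If `g` is torsion and `w` is such
a word for it, then `g` carries the initial part of `w` close to its final part read backwards.
Hence a prefix that grows and a prefix that shrinks can be kept in step until they meet near the
middle (`IsLocalGeod.exists_search_step`); the short word that joins the two sides lives in the
finite control. Conjugating by the prefix found and rewriting again gives a word of bounded length
whenever `g` is torsion. The orders of the finitely many short words are wired into the machine, so
this decides torsion.

If no segment of infinite order is found, every final segment has left a candidate `c` close to its
middle. It is not known which candidate belongs to the longest final segment, and the exact middle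
is `c u` for an unknown word `u` of bounded length. So every candidate is tested against all final
segments, while the set of all `u` that still work is kept in the finite control; `exists_conjShort`
shows that some pair survives. Both phases rewrite `O(m²)` words of length `O(mμ)`. The constant `K`
is computed from `δ₀` alone, hence from the group and its generators. -/

namespace WordHyp

/-! ### The word metric -/

section WordMetric

variable {G : Type*} [Group G] {n : ℕ}

/-- Every element of `G` is represented by a word, and the family of letters is closed under
inversion. -/
structure IsSymmGenerating (X : Fin n → G) : Prop where
  exists_word : ∀ g, ∃ w : Word n, eval X w = g
  exists_inv : ∀ i, ∃ j, X j = (X i)⁻¹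

@[simp] theorem eval_nil (X : Fin n → G) : eval X [] = 1 := rfl

@[simp] theorem eval_cons (X : Fin n → G) (a : Fin n) (w : Word n) :
    eval X (a :: w) = X a * eval X w := by simp [eval]

@[simp] theorem eval_append (X : Fin n → G) (u v : Word n) :
    eval X (u ++ v) = eval X u * eval X v := by simp [eval]

theorem isSymmGenerating_of_closure {X : Fin n → G}
    (hgen : Subgroup.closure (Set.range X) = ⊤) (hinv : ∀ i, ∃ j, X j = (X i)⁻¹) :
    IsSymmGenerating X := by
  refine ⟨fun g => ?_, hinv⟩
  have hg : g ∈ Subgroup.closure (Set.range X) := hgen ▸ Subgroup.mem_top g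
  induction hg using Subgroup.closure_induction'' with
  | mem x hx => obtain ⟨i, rfl⟩ := hx; exact ⟨[i], by simp⟩
  | inv_mem x hx =>
    obtain ⟨i, rfl⟩ := hx
    obtain ⟨j, hj⟩ := hinv i
    exact ⟨[j], by simp [hj]⟩
  | one => exact ⟨[], rfl⟩
  | mul x y _ _ hx hy =>
    obtain ⟨u, rfl⟩ := hx
    obtain ⟨v, rfl⟩ := hy
    exact ⟨u ++ v, by simp⟩

theorem wordLength_eval_le (X : Fin n → G) (w : Word n) : wordLength X (eval X w) ≤ w.length :=
  Nat.sInf_le ⟨w, rfl, rfl⟩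

@[simp] theorem wordLength_one (X : Fin n → G) : wordLength X 1 = 0 :=
  Nat.le_zero.1 (wordLength_eval_le X [])

namespace IsSymmGenerating

variable {X : Fin n → G} (hX : IsSymmGenerating X)
include hX

theorem exists_geodesic (g : G) : ∃ w : Word n, w.length = wordLength X g ∧ eval X w = g := by
  obtain ⟨w, hw⟩ := hX.exists_word g
  exact Nat.sInf_mem (s := {k | ∃ w : Word n, w.length = k ∧ eval X w = g}) ⟨_, w, rfl, hw⟩

theorem wordLength_mul (g h : G) : wordLength X (g * h) ≤ wordLength X g + wordLength X h := by
  obtain ⟨u, hu, rfl⟩ := hX.exists_geodesic g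
  obtain ⟨v, hv, rfl⟩ := hX.exists_geodesic h
  rw [← hu, ← hv, ← eval_append, ← List.length_append]
  exact wordLength_eval_le X _

theorem exists_inv_word (w : Word n) :
    ∃ v : Word n, v.length = w.length ∧ eval X v = (eval X w)⁻¹ := by
  induction w with
  | nil => exact ⟨[], rfl, by simp⟩
  | cons a w ih =>
    obtain ⟨v, hv, h⟩ := ih
    obtain ⟨b, hb⟩ := hX.exists_inv a
    exact ⟨v ++ [b], by simp [hv], by simp [h, hb]⟩

theorem wordLength_inv_le (g : G) : wordLength X g⁻¹ ≤ wordLength X g := by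
  obtain ⟨u, hu, rfl⟩ := hX.exists_geodesic g
  obtain ⟨v, hv, h⟩ := hX.exists_inv_word u
  rw [← h, ← hu, ← hv]
  exact wordLength_eval_le X _

theorem wordLength_inv (g : G) : wordLength X g⁻¹ = wordLength X g :=
  le_antisymm (hX.wordLength_inv_le g) (by simpa using hX.wordLength_inv_le g⁻¹)

theorem wordDist_comm (g h : G) : wordDist X g h = wordDist X h g := by
  rw [wordDist, ← hX.wordLength_inv, mul_inv_rev, inv_inv, wordDist]

theorem wordDist_triangle (g h k : G) : wordDist X g k ≤ wordDist X g h + wordDist X h k := by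
  have := hX.wordLength_mul (g⁻¹ * h) (h⁻¹ * k)
  rwa [mul_assoc, mul_inv_cancel_left] at this

end IsSymmGenerating

@[simp] theorem wordDist_self (X : Fin n → G) (g : G) : wordDist X g g = 0 := by simp [wordDist]

@[simp] theorem wordDist_mul_left (X : Fin n → G) (k g h : G) :
    wordDist X (k * g) (k * h) = wordDist X g h := by simp [wordDist, mul_assoc]

/-- A word is geodesic if its length is the length of the element it represents. -/
def IsGeod (X : Fin n → G) (w : Word n) : Prop := wordLength X (eval X w) = w.length

/-- If the middle part could be shortened, so could the whole word. -/
theorem IsGeod.of_append {X : Fin n → G} (hX : IsSymmGenerating X) {u v w : Word n}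
    (h : IsGeod X (u ++ v ++ w)) : IsGeod X v := by
  have h1 := hX.wordLength_mul (eval X u * eval X v) (eval X w)
  have h2 := hX.wordLength_mul (eval X u) (eval X v)
  have h3 := wordLength_eval_le X u
  have h4 := wordLength_eval_le X v
  have h5 := wordLength_eval_le X w
  simp only [IsGeod, eval_append, List.length_append] at h ⊢
  omega

theorem wordDist_take_take {X : Fin n → G} (w : Word n) {i j : ℕ} (h : i ≤ j) :
    (eval X (w.take i))⁻¹ * eval X (w.take j) = eval X ((w.take j).drop i) := by
  rw [inv_mul_eq_iff_eq_mul, ← eval_append]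
  conv_lhs => rw [← List.take_append_drop i (w.take j), List.take_take, min_eq_left h]

theorem IsGeod.wordDist_take {X : Fin n → G} (hX : IsSymmGenerating X) {w : Word n}
    (hw : IsGeod X w) {i j : ℕ} (hij : i ≤ j) (hj : j ≤ w.length) :
    wordDist X (eval X (w.take i)) (eval X (w.take j)) = j - i := by
  have : IsGeod X ((w.take j).drop i) := by
    apply IsGeod.of_append hX (u := w.take i) (w := w.drop j)
    have : w.take i = (w.take j).take i := by rw [List.take_take, min_eq_left hij]
    rwa [this, List.take_append_drop, List.take_append_drop]
  rw [wordDist, wordDist_take_take w hij, this]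
  simp [hj]

end WordMetric

/-! ### Geodesic paths in the Cayley graph -/

section Cayley

variable {G : Type*} [Group G] {n : ℕ} {X : Fin n → G}

/-- A vertex as a point of the Cayley graph. -/
def CayleyPoint.vertex (X : Fin n → G) (g : G) : CayleyPoint X :=
  ⟨g, g, 0, Or.inl rfl, le_rfl, by simp⟩

theorem CayleyPoint.dist_vertex (g h : G) :
    (vertex X g).dist (vertex X h) = wordDist X g h := by
  by_cases e : g = h <;> simp [vertex, CayleyPoint.dist, CayleyPoint.copos, e]

/-- Edge paths along geodesic words are shown to be geodesics of the graph by this computation: the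
distance is the difference of the parameters `a + pos`. The cases follow the order of the two edges.
A degenerate edge has length `0`, which forces its position to be `0`. -/
theorem CayleyPoint.dist_of_geodesic_vertices {v : ℕ → G} {l : ℕ}
    (hv : ∀ i ≤ l, ∀ j ≤ l, (wordDist X (v i) (v j) : ℝ) = |(i : ℝ) - j|)
    (hinj : ∀ i ≤ l, ∀ j ≤ l, v i = v j → i = j)
    {p q : CayleyPoint X} {a b a' b' : ℕ}
    (hp : p.src = v a) (hp' : p.tgt = v b) (hq : q.src = v a') (hq' : q.tgt = v b')
    (hb : b ≤ l) (hb' : b' ≤ l) (hab : b = a ∨ b = a + 1) (hab' : b' = a' ∨ b' = a' + 1) :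
    p.dist q = |(a + p.pos) - (a' + q.pos)| := by
  have ha : a ≤ l := by omega
  have ha' : a' ≤ l := by omega
  have p0 := p.pos_nonneg
  have p1 := p.pos_le
  have q0 := q.pos_nonneg
  have q1 := q.pos_le
  simp only [CayleyPoint.dist, CayleyPoint.copos]
  rw [hp, hp', hv a ha b hb] at *
  rw [hq, hq', hv a' ha' b' hb'] at *
  rw [hv a ha a' ha', hv a ha b' hb', hv b hb a' ha', hv b hb b' hb']
  generalize p.pos = r at *
  generalize q.pos = r' at *
  have inj : ∀ i ≤ l, ∀ j ≤ l, (v i = v j ↔ i = j) :=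
    fun i hi j hj => ⟨hinj i hi j hj, fun h => h ▸ rfl⟩
  rw [inj a ha a' ha', inj b hb b' hb', inj a ha b' hb', inj b hb a' ha']
  split_ifs with h1 h2
  · rw [h1.1]; congr 1; ring
  -- Both edges are traversed forwards, so they can be opposite only if all four indices agree,
  -- which is the previous case.
  · omega
  · have key : ∀ x y : ℝ, y ≤ x → |x - y| = x - y := fun x y h => abs_of_nonneg (by linarith)
    have key' : ∀ x y : ℝ, x ≤ y → |x - y| = y - x := fun x y h => by
      rw [abs_sub_comm]; exact key y x h
    have aa : b = a → r = 0 := by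
      rintro rfl; simp only [sub_self, abs_zero] at p1; linarith
    have aa' : b' = a' → r' = 0 := by
      rintro rfl; simp only [sub_self, abs_zero] at q1; linarith
    rcases hab with rfl | rfl <;> rcases hab' with rfl | rfl
    · obtain rfl := aa rfl
      obtain rfl := aa' rfl
      simp
    · obtain rfl := aa rfl
      rcases Nat.lt_or_ge a' b with h | h
      · have c : (a' : ℝ) + 1 ≤ b := by exact_mod_cast h
        push_cast at *
        rw [sub_self (b : ℝ), abs_zero]
        rw [key' a' _ (by linarith)] at *
        rw [key b a' (by linarith), key b _ (by linarith), key _ _ (by linarith)]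
        simp only [min_def]; split_ifs <;> linarith
      · have c : (b : ℝ) ≤ a' := by exact_mod_cast h
        push_cast at *
        rw [sub_self (b : ℝ), abs_zero]
        rw [key' a' _ (by linarith)] at *
        rw [key' b a' (by linarith), key' b _ (by linarith), key' _ _ (by linarith)]
        simp only [min_def]; split_ifs <;> linarith
    · obtain rfl := aa' rfl
      rcases Nat.lt_or_ge a b' with h | h
      · have c : (a : ℝ) + 1 ≤ b' := by exact_mod_cast h
        push_cast at *
        rw [sub_self (b' : ℝ), abs_zero]
        rw [key' a (a + 1) (by linarith)] at *
        rw [key' a b' (by linarith), key' _ (b' : ℝ) (by linarith), key' _ _ (by linarith)]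
        simp only [min_def]; split_ifs <;> linarith
      · have c : (b' : ℝ) ≤ a := by exact_mod_cast h
        push_cast at *
        rw [sub_self (b' : ℝ), abs_zero]
        rw [key' a (a + 1) (by linarith)] at *
        rw [key a b' (by linarith), key _ (b' : ℝ) (by linarith), key _ _ (by linarith)]
        simp only [min_def]; split_ifs <;> linarith
    · rcases Nat.lt_or_ge a a' with h | h
      · have c : (a : ℝ) + 1 ≤ a' := by exact_mod_cast h
        push_cast at *
        rw [key' a (a + 1) (by linarith)] at *
        rw [key' a' (a' + 1) (by linarith)] at *
        rw [key' a a' (by linarith), key' a _ (by linarith), key' _ (a' : ℝ) (by linarith),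
          key' _ ((a' : ℝ) + 1) (by linarith), key' (a + r) _ (by linarith)]
        simp only [min_def]; split_ifs <;> linarith
      · have c : (a' : ℝ) + 1 ≤ a := by
          have : a' + 1 ≤ a := by omega
          exact_mod_cast this
        push_cast at *
        rw [key' a (a + 1) (by linarith)] at *
        rw [key' a' (a' + 1) (by linarith)] at *
        rw [key a a' (by linarith), key a _ (by linarith), key _ (a' : ℝ) (by linarith),
          key _ ((a' : ℝ) + 1) (by linarith), key (a + r) _ (by linarith)]
        simp only [min_def]; split_ifs <;> linarith

/-- The vertex reached from `g` after `k` letters of the word `w`. -/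
def pathVertex (X : Fin n → G) (g : G) (w : Word n) (k : ℕ) : G := g * eval X (w.take k)

theorem pathVertex_succ (g : G) (w : Word n) (k : ℕ) :
    pathVertex X g w (k + 1) = pathVertex X g w k ∨
      ∃ i, pathVertex X g w (k + 1) = pathVertex X g w k * X i := by
  simp only [pathVertex, List.take_add_one]
  cases w[k]? with
  | none => left; simp
  | some i => right; exact ⟨i, by simp [mul_assoc]⟩

open Classical in
/-- The path in the Cayley graph that starts at `g` and is labelled by `w`. -/
noncomputable def edgePath (X : Fin n → G) (g : G) (w : Word n) (t : ℝ) : CayleyPoint X :=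
  -- At integers the point is a vertex. The second condition is the one that `pos_le` demands; it
  -- holds along a geodesic word, and where it fails the vertex is only a default value.
  if h : (⌊t⌋₊ : ℝ) < t ∧
      t - ⌊t⌋₊ ≤ wordDist X (pathVertex X g w ⌊t⌋₊) (pathVertex X g w (⌊t⌋₊ + 1)) then
    ⟨_, _, _, pathVertex_succ g w ⌊t⌋₊, sub_nonneg.2 h.1.le, h.2⟩
  else CayleyPoint.vertex X (pathVertex X g w ⌊t⌋₊)

theorem edgePath_natCast (g : G) (w : Word n) (k : ℕ) :
    edgePath X g w k = CayleyPoint.vertex X (pathVertex X g w k) := by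
  simp [edgePath]

theorem wordDist_pathVertex (hX : IsSymmGenerating X) (g : G) {w : Word n} (hw : IsGeod X w) :
    ∀ i ≤ w.length, ∀ j ≤ w.length,
      (wordDist X (pathVertex X g w i) (pathVertex X g w j) : ℝ) = |(i : ℝ) - j| := by
  intro i hi j hj
  rw [pathVertex, pathVertex, wordDist_mul_left]
  rcases le_total i j with h | h
  · rw [hw.wordDist_take hX h hj, abs_sub_comm, Nat.cast_sub h,
      abs_of_nonneg (sub_nonneg.2 (Nat.cast_le.2 h))]
  · rw [hX.wordDist_comm, hw.wordDist_take hX h hi, Nat.cast_sub h,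
      abs_of_nonneg (sub_nonneg.2 (Nat.cast_le.2 h))]

theorem exists_edgePath_eq (hX : IsSymmGenerating X) (g : G) {w : Word n} (hw : IsGeod X w)
    {t : ℝ} (ht : t ∈ Set.Icc (0 : ℝ) w.length) :
    ∃ a b : ℕ, (edgePath X g w t).src = pathVertex X g w a ∧
      (edgePath X g w t).tgt = pathVertex X g w b ∧ b ≤ w.length ∧ (b = a ∨ b = a + 1) ∧
      (a : ℝ) + (edgePath X g w t).pos = t := by
  have hf := Nat.floor_le ht.1
  have hl : ⌊t⌋₊ ≤ w.length := Nat.cast_le.1 (hf.trans ht.2)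
  rcases hf.lt_or_eq with h | h
  · have hl' : ⌊t⌋₊ + 1 ≤ w.length := Nat.cast_lt.1 (h.trans_le ht.2)
    have hd := wordDist_pathVertex hX g hw _ hl _ hl'
    have h2 : t - ⌊t⌋₊ ≤
        wordDist X (pathVertex X g w ⌊t⌋₊) (pathVertex X g w (⌊t⌋₊ + 1)) := by
      rw [hd]; have := Nat.lt_floor_add_one t; push_cast
      rw [abs_sub_comm, add_sub_cancel_left, abs_one]; linarith
    refine ⟨⌊t⌋₊, ⌊t⌋₊ + 1, ?_, ?_, hl', Or.inr rfl, ?_⟩ <;> rw [edgePath, dif_pos ⟨h, h2⟩]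
    ring
  · refine ⟨⌊t⌋₊, ⌊t⌋₊, ?_, ?_, hl, Or.inl rfl, ?_⟩ <;>
      rw [edgePath, dif_neg (fun h' => h'.1.ne h)] <;> simp [CayleyPoint.vertex, h]

theorem isGeodesic_edgePath (hX : IsSymmGenerating X) (g : G) {w : Word n} (hw : IsGeod X w) :
    IsGeodesic (edgePath X g w) w.length (CayleyPoint.vertex X g)
      (CayleyPoint.vertex X (g * eval X w)) := by
  refine ⟨Nat.cast_nonneg _, ?_, ?_, fun s hs t ht => ?_⟩
  · have := edgePath_natCast (X := X) g w 0
    simpa [pathVertex] using this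
  · rw [edgePath_natCast, pathVertex, List.take_length]
  · obtain ⟨a, b, h1, h2, h3, h4, h5⟩ := exists_edgePath_eq hX g hw hs
    obtain ⟨a', b', h1', h2', h3', h4', h5'⟩ := exists_edgePath_eq hX g hw ht
    have hv := wordDist_pathVertex hX g hw
    rw [CayleyPoint.dist_of_geodesic_vertices hv (fun i hi j hj e => ?_) h1 h2 h1' h2' h3 h3' h4 h4',
      h5, h5']
    have := hv i hi j hj
    rw [e, wordDist_self, Nat.cast_zero, eq_comm, abs_eq_zero, sub_eq_zero] at this
    exact_mod_cast this

/-- The Gromov product of the vertices `x` and `y` with respect to `w`. -/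
noncomputable def gp (X : Fin n → G) (w x y : G) : ℝ :=
  ((wordDist X w x : ℝ) + wordDist X w y - wordDist X x y) / 2

/-- The four-point condition on the vertices. -/
def FourPoint (X : Fin n → G) (h : ℝ) : Prop :=
  ∀ w x y z : G, min (gp X w x z) (gp X w z y) ≤ gp X w x y + h

/-- Thin triangles are used only here: for vertices as corners and integer parameters. -/
theorem IsHyperbolic.wordDist_le (hX : IsSymmGenerating X) {δ : ℝ} (hδ : IsHyperbolic X δ) (g : G)
    {u v : Word n} (hu : IsGeod X u) (hv : IsGeod X v) {t : ℕ}
    (ht : t ≤ gp X g (g * eval X u) (g * eval X v)) :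
    (wordDist X (g * eval X (u.take t)) (g * eval X (v.take t)) : ℝ) ≤ δ := by
  obtain ⟨w, hw, hw'⟩ := hX.exists_geodesic ((g * eval X u)⁻¹ * (g * eval X v))
  have hwg : IsGeod X w := by rw [IsGeod, hw', hw]
  have h3 := isGeodesic_edgePath hX (g * eval X u) hwg
  rw [hw', mul_inv_cancel_left] at h3
  have := hδ _ _ _ _ _ _ _ _ _ (isGeodesic_edgePath hX g hu) (isGeodesic_edgePath hX g hv) h3 t
    (Nat.cast_nonneg _) (by
      rw [gromovProduct, CayleyPoint.dist_vertex, CayleyPoint.dist_vertex, CayleyPoint.dist_vertex,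
        hX.wordDist_comm _ g, hX.wordDist_comm _ g]
      exact ht)
  rwa [edgePath_natCast, edgePath_natCast, CayleyPoint.dist_vertex] at this

theorem gp_nonneg (hX : IsSymmGenerating X) (w x y : G) : 0 ≤ gp X w x y := by
  have h := hX.wordDist_triangle x w y
  rw [hX.wordDist_comm x w] at h
  have h' : (wordDist X x y : ℝ) ≤ wordDist X w x + wordDist X w y := by exact_mod_cast h
  rw [gp]; linarith

theorem gp_le_left (hX : IsSymmGenerating X) (w x y : G) : gp X w x y ≤ wordDist X w x := by
  have h := hX.wordDist_triangle w x y
  have h' : (wordDist X w y : ℝ) ≤ wordDist X w x + wordDist X x y := by exact_mod_cast h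
  rw [gp]; linarith

theorem gp_comm (hX : IsSymmGenerating X) (w x y : G) : gp X w x y = gp X w y x := by
  rw [gp, gp, hX.wordDist_comm x y]; ring

theorem gp_le_right (hX : IsSymmGenerating X) (w x y : G) : gp X w x y ≤ wordDist X w y := by
  rw [gp_comm hX]; exact gp_le_left hX w y x

/-- Take geodesics from `w` to `x`, `y`, `z`. At an integer time `t` below both Gromov products on
the left, the points on the first and third are `δ`-close, and so are those on the third and second.
A path through these points bounds `d(x, y)` by `d(w, x) + d(w, y) - 2t + 2δ`, so the product of `x`
and `y` is at least `t - δ`. Rounding to an integer costs the `1/2`. -/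
theorem IsHyperbolic.fourPoint (hX : IsSymmGenerating X) {δ : ℝ} (hδ : IsHyperbolic X δ) :
    FourPoint X (δ + 1 / 2) := by
  intro w x y z
  obtain ⟨u, hu, hu'⟩ := hX.exists_geodesic (w⁻¹ * x)
  obtain ⟨v, hv, hv'⟩ := hX.exists_geodesic (w⁻¹ * y)
  obtain ⟨r, hr, hr'⟩ := hX.exists_geodesic (w⁻¹ * z)
  have gu : IsGeod X u := by rw [IsGeod, hu', hu]
  have gv : IsGeod X v := by rw [IsGeod, hv', hv]
  have gr : IsGeod X r := by rw [IsGeod, hr', hr]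
  have eu : w * eval X u = x := by rw [hu', mul_inv_cancel_left]
  have ev : w * eval X v = y := by rw [hv', mul_inv_cancel_left]
  have er : w * eval X r = z := by rw [hr', mul_inv_cancel_left]
  set m := min (gp X w x z) (gp X w z y) with hm
  have m0 : 0 ≤ m := le_min (gp_nonneg hX _ _ _) (gp_nonneg hX _ _ _)
  -- Gromov products of vertices are half-integers, so rounding down through `2 * m` loses at most
  -- `1/2` instead of `1`.
  set t := ⌊2 * m⌋₊ / 2 with htd
  have ht : (t : ℝ) ≤ m := by
    have h1 := Nat.floor_le (a := 2 * m) (by linarith)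
    have h2 : 2 * t ≤ ⌊2 * m⌋₊ := Nat.mul_div_le _ _
    have h3 : (2 * t : ℝ) ≤ ⌊2 * m⌋₊ := by exact_mod_cast h2
    linarith
  have ht' : m ≤ t + 1 / 2 := by
    have : ∃ N : ℕ, 2 * m = N := by
      obtain ⟨a, b, e⟩ : ∃ a b : G, m = gp X w a b := by
        rcases min_choice (gp X w x z) (gp X w z y) with h | h
        · exact ⟨x, z, hm.trans h⟩
        · exact ⟨z, y, hm.trans h⟩
      refine ⟨wordDist X w a + wordDist X w b - wordDist X a b, ?_⟩
      have h := hX.wordDist_triangle a w b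
      rw [hX.wordDist_comm a w] at h
      rw [e, gp, Nat.cast_sub h]; push_cast; ring
    obtain ⟨N, hN⟩ := this
    rw [hN, Nat.floor_natCast] at htd
    have h2 : N ≤ 2 * t + 1 := by omega
    have h3 : (N : ℝ) ≤ 2 * t + 1 := by exact_mod_cast h2
    linarith
  have h1 := hδ.wordDist_le hX w gu gr (t := t) (by
    rw [eu, er]; exact ht.trans (min_le_left _ _))
  have h2 := hδ.wordDist_le hX w gr gv (t := t) (by
    rw [ev, er]; exact ht.trans (min_le_right _ _))
  have hxt : (t : ℝ) ≤ wordDist X w x :=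
    ht.trans ((min_le_left _ _).trans (gp_le_left hX _ _ _))
  have hyt : (t : ℝ) ≤ wordDist X w y :=
    ht.trans ((min_le_right _ _).trans (gp_le_right hX _ _ _))
  have lu : u.length = wordDist X w x := hu
  have lv : v.length = wordDist X w y := hv
  rw [← lu] at hxt; rw [← lv] at hyt
  have h3 := wordDist_pathVertex hX w gu t (Nat.cast_le.1 hxt) u.length le_rfl
  have h4 := wordDist_pathVertex hX w gv t (Nat.cast_le.1 hyt) v.length le_rfl
  simp only [pathVertex, List.take_length] at h3 h4
  rw [abs_sub_comm, abs_of_nonneg (sub_nonneg.2 hxt), eu, lu] at h3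
  rw [abs_sub_comm, abs_of_nonneg (sub_nonneg.2 hyt), ev, lv] at h4
  have t1 := hX.wordDist_triangle x (w * eval X (u.take t)) y
  have t2 := hX.wordDist_triangle (w * eval X (u.take t)) (w * eval X (r.take t)) y
  have t3 := hX.wordDist_triangle (w * eval X (r.take t)) (w * eval X (v.take t)) y
  rw [hX.wordDist_comm x (w * eval X (u.take t))] at t1
  have t4 : (wordDist X x y : ℝ) ≤ wordDist X (w * eval X (u.take t)) x +
      (wordDist X (w * eval X (u.take t)) (w * eval X (r.take t)) +
      (wordDist X (w * eval X (r.take t)) (w * eval X (v.take t)) +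
      wordDist X (w * eval X (v.take t)) y)) := by
    exact_mod_cast (by omega)
  rw [gp]
  linarith

/-- The thinness condition is a family of weak inequalities, so it passes to the infimum. A least
constant allows one machine and one time bound to serve all `δ`. -/
theorem exists_min_isHyperbolic {δ : ℝ} (h1 : 1 ≤ δ) (hδ : IsHyperbolic X δ) :
    ∃ δ₀, 1 ≤ δ₀ ∧ IsHyperbolic X δ₀ ∧ ∀ δ, 1 ≤ δ → IsHyperbolic X δ → δ₀ ≤ δ := by
  let S := {δ : ℝ | 1 ≤ δ ∧ IsHyperbolic X δ}
  have hS : S.Nonempty := ⟨δ, h1, hδ⟩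
  refine ⟨sInf S, le_csInf hS fun _ h => h.1, ?_, fun δ h h' => csInf_le ⟨1, fun _ h => h.1⟩ ⟨h, h'⟩⟩
  intro x y z α β γ a b c ha hb hc t h0 ht
  exact le_csInf hS fun δ hδ => hδ.2 x y z α β γ a b c ha hb hc t h0 ht

end Cayley

/-! ### Consequences of the four-point condition -/

section FourPointCondition

variable {G : Type*} [Group G] {n : ℕ} {X : Fin n → G}

/-- The word metric as a real number. -/
noncomputable def rdist (X : Fin n → G) (x y : G) : ℝ := wordDist X x y

theorem rdist_self (x : G) : rdist X x x = 0 := by simp [rdist]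

theorem rdist_nonneg (x y : G) : 0 ≤ rdist X x y := Nat.cast_nonneg _

theorem rdist_mul_left (k x y : G) : rdist X (k * x) (k * y) = rdist X x y := by simp [rdist]

theorem rdist_inv_mul (k x y : G) : rdist X (k⁻¹ * x) y = rdist X x (k * y) := by
  rw [← rdist_mul_left k, mul_inv_cancel_left]

theorem rdist_comm (hX : IsSymmGenerating X) (x y : G) : rdist X x y = rdist X y x := by
  rw [rdist, hX.wordDist_comm, rdist]

theorem rdist_triangle (hX : IsSymmGenerating X) (x y z : G) :
    rdist X x z ≤ rdist X x y + rdist X y z := by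
  have := hX.wordDist_triangle x y z
  simp only [rdist]; exact_mod_cast this

theorem gp_eq (w x y : G) : gp X w x y = (rdist X w x + rdist X w y - rdist X x y) / 2 := rfl

theorem FourPoint.mono {h h' : ℝ} (H : FourPoint X h) (hh : h ≤ h') : FourPoint X h' :=
  fun w x y z => (H w x y z).trans (by linarith)

/-- The form without base point: each of the three sums of opposite distances exceeds one of the
other two by at most `2h`. -/
theorem FourPoint.rdist_le (hX : IsSymmGenerating X) {h : ℝ} (H : FourPoint X h) (x y z w : G) :
    rdist X x y + rdist X z w ≤ rdist X x z + rdist X y w + 2 * h ∨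
      rdist X x y + rdist X z w ≤ rdist X x w + rdist X y z + 2 * h := by
  have := min_le_iff.1 (H w x y z)
  simp only [gp_eq] at this
  rw [rdist_comm hX w x, rdist_comm hX w y, rdist_comm hX w z, rdist_comm hX z y] at this
  rcases this with h | h
  · left; linarith
  · right; linarith

/-- Otherwise the distances `d(y, f^m y)` increase strictly with `m`: apply the four-point
inequality to `y`, `f^m y`, `f^(m+1) y`, `f^(m+2) y`, where one alternative contradicts the previous
increase and the other is the next one. This is impossible when a positive power of `f` is `1`. -/
theorem IsOfFinOrder.rdist_sq_le (hX : IsSymmGenerating X) {h : ℝ} (h0 : 0 ≤ h)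
    (H : FourPoint X h) {f : G} (hf : IsOfFinOrder f) (y : G) :
    rdist X y (f * (f * y)) ≤ rdist X y (f * y) + 2 * h := by
  by_contra! hlt
  have key : ∀ m : ℕ, rdist X y (f ^ m * y) < rdist X y (f ^ (m + 1) * y) := by
    intro m
    induction m with
    | zero =>
      simp only [pow_zero, one_mul, zero_add, pow_one, rdist_self]
      have h1 := rdist_triangle hX y (f * y) (f * (f * y))
      rw [rdist_mul_left] at h1
      linarith
    | succ m ih =>
      have e1 : rdist X (f ^ m * y) (f ^ (m + 1) * y) = rdist X y (f * y) := by
        rw [pow_succ, mul_assoc, rdist_mul_left]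
      have e2 : rdist X (f ^ (m + 1) * y) (f ^ (m + 2) * y) = rdist X y (f * y) := by
        rw [show f ^ (m + 2) * y = f ^ (m + 1) * (f * y) by rw [pow_succ _ (m + 1), mul_assoc],
          rdist_mul_left]
      have e3 : rdist X (f ^ m * y) (f ^ (m + 2) * y) = rdist X y (f * (f * y)) := by
        rw [show f ^ (m + 2) * y = f ^ m * (f * (f * y)) by rw [pow_add, pow_two]; group,
          rdist_mul_left]
      rw [add_assoc, one_add_one_eq_two]
      rcases H.rdist_le hX (f ^ m * y) (f ^ (m + 2) * y) y (f ^ (m + 1) * y) with h1 | h1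
      · rw [rdist_comm hX (f ^ (m + 2) * y) (f ^ (m + 1) * y), e2, e3,
          rdist_comm hX _ y] at h1
        linarith
      · rw [rdist_comm hX (f ^ (m + 2) * y) y, e1, e3] at h1
        linarith
  obtain ⟨N, hN, hfN⟩ := isOfFinOrder_iff_pow_eq_one.1 hf
  have mono : StrictMono fun m : ℕ => rdist X y (f ^ m * y) := strictMono_nat_of_lt_succ key
  have := mono hN
  simp [hfN, rdist_self] at this

/-- A point in the middle of a geodesic from `1` to `g`. -/
structure IsMid (X : Fin n → G) (g q : G) : Prop where
  add_eq : rdist X 1 q + rdist X q g = rdist X 1 g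
  le : rdist X 1 q ≤ rdist X q g + 1
  ge : rdist X q g ≤ rdist X 1 q + 1

theorem exists_isMid (hX : IsSymmGenerating X) (g : G) : ∃ q, IsMid X g q := by
  obtain ⟨w, hw, rfl⟩ := hX.exists_geodesic g
  have gw : IsGeod X w := hw.symm
  have h1 := gw.wordDist_take hX (Nat.zero_le (w.length / 2)) (Nat.div_le_self _ _)
  have h2 := gw.wordDist_take hX (Nat.div_le_self w.length 2) le_rfl
  have h3 := gw.wordDist_take hX (Nat.zero_le w.length) le_rfl
  simp only [List.take_zero, eval_nil, List.take_length] at h1 h2 h3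
  refine ⟨eval X (w.take (w.length / 2)), ?_, ?_, ?_⟩ <;> simp only [rdist, h1, h2, h3] <;>
    norm_cast <;> omega

/-- Since `d(1, g²) ≤ |g| + 2h`, the geodesics from `g` to `1` and from `g` to `g²` run close
together for about half of their length. The points `p` and `g p` lie on them, both about `|g| / 2`
away from `g`. -/
theorem IsMid.rdist_mul_le (hX : IsSymmGenerating X) {h : ℝ} (h1 : 1 ≤ h) (H : FourPoint X h)
    {g p : G} (hg : IsOfFinOrder g) (hp : IsMid X g p) : rdist X p (g * p) ≤ 6 * h := by
  have hs := IsOfFinOrder.rdist_sq_le hX (by linarith) H hg 1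
  rw [mul_one] at hs
  obtain ⟨a1, a2, a3⟩ := hp
  have b1 : rdist X g (g * p) = rdist X 1 p := by
    simpa using rdist_mul_left (X := X) g 1 p
  have b2 : rdist X g (g * g) = rdist X 1 g := by
    simpa using rdist_mul_left (X := X) g 1 g
  have b3 : rdist X (g * p) (g * g) = rdist X p g := rdist_mul_left g p g
  have c1 := rdist_comm hX g 1
  have c2 := rdist_comm hX p 1
  have c3 := rdist_comm hX g p
  have c4 := rdist_comm hX (g * g) (g * p)
  have c5 := rdist_comm hX (g * p) g
  have c6 := rdist_comm hX (g * g) g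
  have c7 := rdist_comm hX (g * p) 1
  rcases H.rdist_le hX p (g * p) 1 g with k | k
  · linarith
  · rcases H.rdist_le hX 1 (g * p) (g * g) g with k' | k' <;> linarith

/-- Suppose `D = d(p, hp)` is large and put `k = gh⁻¹`, `q = kp`. Torsion of `h` and `|h| ≤ |g|`
allow `hp` and `h⁻¹p` to be only about `D / 2` farther from `1` than `p` is, so the way from `p` to
`hp` starts towards `1`. As `q = g(h⁻¹p)`, translation by `g` shows that the way from `p` to `q`
starts towards `g`. Torsion of `k` makes these two ways start together, but `p` lies between `1` and
`g`. -/
theorem IsMid.rdist_mul_le_of_isOfFinOrder (hX : IsSymmGenerating X) {η : ℝ} (h1 : 1 ≤ η)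
    (H : FourPoint X η) {g h p : G} (hg : IsOfFinOrder g) (hh : IsOfFinOrder h)
    (hk : IsOfFinOrder (g * h⁻¹)) (hp : IsMid X g p) (hle : rdist X 1 h ≤ rdist X 1 g) :
    rdist X p (h * p) ≤ 40 * η := by
  have hgp := hp.rdist_mul_le hX h1 H hg
  obtain ⟨a1, a2, a3⟩ := hp
  by_contra! hlt
  have k2 := IsOfFinOrder.rdist_sq_le hX (by linarith) H hk p
  have h2 := IsOfFinOrder.rdist_sq_le hX (by linarith) H hh (h⁻¹ * p)
  have h2' := IsOfFinOrder.rdist_sq_le hX (by linarith) H hh 1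
  rw [mul_inv_cancel_left] at h2
  have e0 : rdist X (h⁻¹ * p) p = rdist X p (h * p) := rdist_inv_mul h p p
  -- distances involving `q = g h⁻¹ p`
  set q := g * h⁻¹ * p with hq
  have e1 : rdist X (g * p) q = rdist X p (h * p) := by
    rw [hq, mul_assoc, rdist_mul_left, rdist_comm hX, e0]
  have e2 : rdist X p q ≤ 6 * η + rdist X p (h * p) := by
    have := rdist_triangle hX p (g * p) q; linarith
  have e3 : rdist X p (h * p) ≤ 6 * η + rdist X p q := by
    have := rdist_triangle hX (g * p) p q
    rw [rdist_comm hX (g * p) p] at this; linarith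
  have e4 : rdist X p (g * h⁻¹ * q) = rdist X (h * (g⁻¹ * p)) q := by
    rw [← rdist_inv_mul]; congr 1; group
  -- `g⁻¹p` is within `6η` of `p`, so `hp` may replace `h g⁻¹ p`. With the torsion bound `k2` this
  -- keeps `d(hp, q)` below `d(p, q) + 8η`.
  have e5 : rdist X (h * p) q ≤ 6 * η + rdist X p (g * h⁻¹ * q) := by
    have := rdist_triangle hX (h * p) (h * (g⁻¹ * p)) q
    rw [rdist_mul_left, rdist_comm hX p, rdist_inv_mul] at this; linarith
  -- distances to `1`
  have f1 : rdist X 1 (h⁻¹ * p) = rdist X p h := by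
    rw [rdist_comm hX, rdist_inv_mul, mul_one]
  have f2 : rdist X h (h * p) = rdist X 1 p := by simpa using rdist_mul_left (X := X) h 1 p
  have f3 : rdist X g q = rdist X 1 (h⁻¹ * p) := by
    rw [hq, mul_assoc]; simpa using rdist_mul_left (X := X) g 1 (h⁻¹ * p)
  have c1 := rdist_comm hX p 1
  have c2 := rdist_comm hX (h * p) p
  have c3 := rdist_comm hX (h * p) h
  have c4 := rdist_comm hX q p
  have c5 := rdist_comm hX (h⁻¹ * p) 1
  have c6 := rdist_comm hX (h⁻¹ * p) (h * p)
  have c7 := rdist_comm hX (h * p) 1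
  have c8 := rdist_comm hX g p
  have c9 := rdist_comm hX q g
  -- Here `|h| ≤ |g|` enters, with `|g| ≤ 2 d(1, p) + 1`.
  have hx : rdist X 1 (h * p) + rdist X 1 (h⁻¹ * p) ≤
      2 * rdist X 1 p + 1 + rdist X p (h * p) + 2 * η := by
    rcases H.rdist_le hX 1 (h * p) h p with k | k
    · rw [rdist_comm hX h p] at k; linarith
    · rw [rdist_comm hX h p] at k; linarith
  -- `h2` bounds `d(h⁻¹p, hp)`. The four-point inequality then makes the two distances in `hx`
  -- nearly equal, or makes the one in question at most `d(1, p) + 4η`.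
  have hx1 : 2 * rdist X 1 (h * p) ≤ 2 * rdist X 1 p + rdist X p (h * p) + 1 + 4 * η := by
    rcases H.rdist_le hX 1 (h * p) (h⁻¹ * p) p with k | k <;> linarith
  have hx2 : 2 * rdist X 1 (h⁻¹ * p) ≤
      2 * rdist X 1 p + rdist X p (h * p) + 1 + 4 * η := by
    rcases H.rdist_le hX 1 (h⁻¹ * p) (h * p) p with k | k <;> linarith
  -- The first alternative contradicts `hx1`. In the second, `hp` is farther from `g` than `p` by at
  -- least `D - 2η`, which is then compared with `q`.
  rcases H.rdist_le hX 1 g (h * p) p with k | k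
  · linarith
  · have c10 := rdist_comm hX g (h * p)
    rcases H.rdist_le hX (h * p) g q p with k' | k' <;> linarith

end FourPointCondition

/-! ### Locally geodesic words -/

section LocalGeodesics

variable {G : Type*} [Group G] {n : ℕ} {X : Fin n → G}

/-- All subwords of length at most `k` are geodesic. -/
def IsLocalGeod (X : Fin n → G) (k : ℕ) (w : Word n) : Prop :=
  ∀ v : Word n, v <:+: w → v.length ≤ k → IsGeod X v

/-- The element represented by the first `i` letters of `w`. -/
def pre (X : Fin n → G) (w : Word n) (i : ℕ) : G := eval X (w.take i)

theorem pre_zero (w : Word n) : pre X w 0 = 1 := by simp [pre]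

theorem pre_length (w : Word n) : pre X w w.length = eval X w := by simp [pre]

theorem rdist_pre_le (w : Word n) {i j : ℕ} (hij : i ≤ j) :
    rdist X (pre X w i) (pre X w j) ≤ j - i := by
  have h := wordLength_eval_le X ((w.take j).drop i)
  rw [← wordDist_take_take w hij, List.length_drop, List.length_take] at h
  have h2 : wordDist X (pre X w i) (pre X w j) ≤ j - i := h.trans (by omega)
  rw [rdist, ← Nat.cast_sub hij]
  exact_mod_cast h2

theorem IsLocalGeod.rdist_pre {k : ℕ} {w : Word n} (hw : IsLocalGeod X k w) {i j : ℕ}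
    (hij : i ≤ j) (hj : j ≤ w.length) (hk : j - i ≤ k) :
    rdist X (pre X w i) (pre X w j) = j - i := by
  have h1 : IsGeod X ((w.take j).drop i) :=
    hw _ ((List.drop_suffix _ _).isInfix.trans (List.take_prefix _ _).isInfix) (by simp; omega)
  have h2 : wordDist X (pre X w i) (pre X w j) = j - i := by
    rw [wordDist, pre, pre, wordDist_take_take w hij, h1]; simp [hj]
  rw [rdist, h2, Nat.cast_sub hij]

/-! ### Local geodesics are quasigeodesics. -/

section Estimates

variable (hX : IsSymmGenerating X) {h s : ℕ} (H : FourPoint X h) (hs : s = 4 * h + 1)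
  {w : Word n} (hw : IsLocalGeod X (2 * s) w)
include hX H hs hw

/-- Induction in blocks of `s` letters: the block before `b` already led away from `a`, and `w` is
geodesic from the start of this block to `b + e`. So the path cannot turn back at `b`. -/
theorem IsLocalGeod.rdist_add_short (a : ℕ) (b : ℕ) : ∀ e, a ≤ b → e ≤ s → b + e ≤ w.length →
    rdist X (pre X w a) (pre X w b) + e ≤ rdist X (pre X w a) (pre X w (b + e)) + 2 * h := by
  have hsr : (s : ℝ) = 4 * h + 1 := by rw [hs]; push_cast; ring
  have h0 : (0 : ℝ) ≤ h := Nat.cast_nonneg h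
  induction b using Nat.strong_induction_on with
  | _ b ih =>
    intro e hab he hbe
    rcases Nat.lt_or_ge (b - a) s with hba | hba
    · rw [hw.rdist_pre hab (by omega) (by omega), hw.rdist_pre (by omega : a ≤ b + e) hbe (by omega)]
      push_cast; linarith
    · obtain ⟨c, rfl⟩ : ∃ c, b = c + s := ⟨b - s, by omega⟩
      have i1 := ih c (by omega) s (by omega) le_rfl (by omega)
      have d1 := hw.rdist_pre (i := c) (j := c + s) (by omega) (by omega) (by omega)
      have d2 := hw.rdist_pre (i := c) (j := c + s + e) (by omega) (by omega) (by omega)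
      have d3 := hw.rdist_pre (i := c + s) (j := c + s + e) (by omega) (by omega) (by omega)
      push_cast at d1 d2 d3
      rw [rdist_comm hX] at d3
      -- The first alternative would give `2s ≤ 4h`; the second is the claim.
      rcases H.rdist_le hX (pre X w c) (pre X w (c + s + e)) (pre X w a) (pre X w (c + s))
        with k | k
      · rw [rdist_comm hX _ (pre X w a)] at k; linarith
      · rw [rdist_comm hX _ (pre X w a)] at k; linarith

/-- The mirror image of `IsLocalGeod.rdist_add_short`, by induction on the distance `m` of the
indices `b` and `c`. -/
theorem IsLocalGeod.rdist_sub_short (c : ℕ) (hc : c ≤ w.length) (m : ℕ) : ∀ b e, b + m = c →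
    e ≤ s → e ≤ b →
    rdist X (pre X w b) (pre X w c) + e ≤ rdist X (pre X w (b - e)) (pre X w c) + 2 * h := by
  have hsr : (s : ℝ) = 4 * h + 1 := by rw [hs]; push_cast; ring
  have h0 : (0 : ℝ) ≤ h := Nat.cast_nonneg h
  induction m using Nat.strong_induction_on with
  | _ m ih =>
    intro b e hbc he heb
    rcases Nat.lt_or_ge m s with hm | hm
    · rw [hw.rdist_pre (by omega) (by omega) (by omega),
        hw.rdist_pre (by omega : b - e ≤ c) hc (by omega)]
      push_cast [heb]; linarith
    · have i1 := ih (m - s) (by omega) (b + s) s (by omega) le_rfl (by omega)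
      rw [Nat.add_sub_cancel] at i1
      have d1 := hw.rdist_pre (i := b) (j := b + s) (by omega) (by omega) (by omega)
      have d2 := hw.rdist_pre (i := b - e) (j := b + s) (by omega) (by omega) (by omega)
      have d3 := hw.rdist_pre (i := b - e) (j := b) (by omega) (by omega) (by omega)
      push_cast [heb] at d1 d2 d3
      rw [rdist_comm hX] at d1
      rcases H.rdist_le hX (pre X w (b + s)) (pre X w (b - e)) (pre X w c) (pre X w b)
        with k | k
      · rw [rdist_comm hX (pre X w c), rdist_comm hX (pre X w (b + s)) (pre X w (b - e))] at k
        linarith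
      · rw [rdist_comm hX (pre X w c), rdist_comm hX (pre X w (b + s)) (pre X w (b - e))] at k
        linarith

/-- Compare `b` with `b + s`: this step leads away from `a` and, read backwards, away from `c`. Of
the two alternatives of the four-point inequality, one would give `2s ≤ 6h`, excluded by `s = 4h +
1`. -/
theorem IsLocalGeod.rdist_add_le {a b c : ℕ} (hab : a ≤ b) (hbc : b ≤ c) (hc : c ≤ w.length) :
    rdist X (pre X w a) (pre X w b) + rdist X (pre X w b) (pre X w c) ≤
      rdist X (pre X w a) (pre X w c) + 4 * h := by
  have hsr : (s : ℝ) = 4 * h + 1 := by rw [hs]; push_cast; ring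
  have h0 : (0 : ℝ) ≤ h := Nat.cast_nonneg h
  rcases Nat.lt_or_ge (c - b) s with hm | hm
  · have i1 := hw.rdist_add_short hX H hs a b (c - b) hab (by omega) (by omega)
    rw [hw.rdist_pre hbc hc (by omega)]
    rw [Nat.add_sub_cancel' hbc, Nat.cast_sub hbc] at i1
    linarith
  · have i1 := hw.rdist_add_short hX H hs a b s hab le_rfl (by omega)
    have i2 := hw.rdist_sub_short hX H hs c hc (c - (b + s)) (b + s) s (by omega) le_rfl (by omega)
    rw [Nat.add_sub_cancel] at i2
    have d1 := hw.rdist_pre (i := b) (j := b + s) (by omega) (by omega) (by omega)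
    push_cast at d1
    rw [rdist_comm hX] at d1
    rcases H.rdist_le hX (pre X w a) (pre X w (b + s)) (pre X w c) (pre X w b) with k | k
    · rw [rdist_comm hX (pre X w c)] at k; linarith
    · rw [rdist_comm hX (pre X w c)] at k; linarith

/-- Every block of `s` letters increases the distance from the start by at least `s - 2h ≥ 1`. -/
theorem IsLocalGeod.sub_le {a b : ℕ} (hab : a ≤ b) (hb : b ≤ w.length) :
    (b : ℝ) - a ≤ s * (rdist X (pre X w a) (pre X w b) + 1) := by
  have hsr : (s : ℝ) = 4 * h + 1 := by rw [hs]; push_cast; ring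
  have h0 : (0 : ℝ) ≤ h := Nat.cast_nonneg h
  induction b using Nat.strong_induction_on with
  | _ b ih =>
    rcases Nat.lt_or_ge (b - a) s with hba | hba
    · have h1 : (b : ℝ) - a ≤ s := by rw [← Nat.cast_sub hab]; exact_mod_cast hba.le
      have h2 := rdist_nonneg (X := X) (pre X w a) (pre X w b)
      nlinarith
    · obtain ⟨c, rfl⟩ : ∃ c, b = c + s := ⟨b - s, by omega⟩
      have i1 := ih c (by omega) (by omega) (by omega)
      have i2 := hw.rdist_add_short hX H hs a c s (by omega) le_rfl hb
      push_cast
      nlinarith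

theorem IsLocalGeod.length_le (m : ℕ) (hm : wordLength X (eval X w) ≤ m) :
    w.length ≤ s * (m + 1) := by
  have := hw.sub_le hX H hs (Nat.zero_le _) le_rfl
  rw [pre_zero, pre_length] at this
  have h1 : rdist X 1 (eval X w) ≤ m := by
    rw [rdist, wordDist, inv_one, one_mul]; exact_mod_cast hm
  have h2 : (w.length : ℝ) ≤ s * (m + 1) := by
    have : (0 : ℝ) ≤ s := Nat.cast_nonneg s
    push_cast at *; nlinarith
  exact_mod_cast h2

end Estimates

/-! ### Searching for the middle of a torsion element -/

/-- Constants of the two-sided search for the middle of a word: the letters read on the left. -/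
def leftStep (h : ℕ) : ℕ := (4 * h + 1) * (12 * h + 1)

/-- The maximum number of letters read on the right. -/
def rightStep (h : ℕ) : ℕ := (4 * h + 1) * (16 * h + leftStep h + 1)

/-- The search stops when the part between the two sides is shorter than this. -/
def stopLength (h : ℕ) : ℕ :=
  (4 * h + 1) * (2 * leftStep h + 16 * h + 1) + leftStep h + rightStep h

theorem leftStep_pos (h : ℕ) : 0 < leftStep h := by unfold leftStep; positivity

/-- A discrete intermediate value theorem: a function that drops by at most one in each step skips
no value on the way down. -/
theorem exists_eq_of_succ_le {f : ℕ → ℕ} (hf : ∀ m, f m ≤ f (m + 1) + 1) {t i j : ℕ} (hij : i ≤ j)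
    (hi : t ≤ f i) (hj : f j ≤ t) : ∃ m, i ≤ m ∧ m ≤ j ∧ f m = t := by
  induction j, hij using Nat.le_induction with
  | base => exact ⟨i, le_rfl, le_rfl, le_antisymm hj hi⟩
  | succ j hij ih =>
    rcases Nat.lt_or_ge t (f j) with h | h
    · exact ⟨j + 1, by omega, le_rfl, by have := hf j; omega⟩
    · obtain ⟨m, h1, h2, h3⟩ := ih h
      exact ⟨m, h1, by omega, h3⟩

section Search

variable (hX : IsSymmGenerating X) {h : ℕ} (H : FourPoint X h) (h1 : 1 ≤ h)
  {w : Word n} (hw : IsLocalGeod X (2 * (4 * h + 1)) w)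
include hX H h1 hw

/-- Let `m` be an index between `i + R` and `j` at which the prefix of `w` is as far from `g` as `g
· pre (i + R)` is. By torsion, the quasigeodesics from `g` to `1` and from `g` to `g²` stay close up
to about half of their length, so these two points are `8h`-close, and the right side may move from
`j` to `m`. -/
theorem IsLocalGeod.exists_search_step (ht : IsOfFinOrder (eval X w)) {i j : ℕ} (hij : i ≤ j)
    (hj : j ≤ w.length) (hS : rdist X (eval X w * pre X w i) (pre X w j) ≤ 8 * h)
    (hR : stopLength h ≤ j - i) :
    ∃ r ≤ rightStep h,
      rdist X (eval X w * pre X w (i + leftStep h)) (pre X w (j - r)) ≤ 8 * h := by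
  obtain ⟨g, hg⟩ : ∃ g, g = eval X w := ⟨_, rfl⟩
  rw [← hg] at ht hS ⊢
  have e0 := pre_zero (X := X) w
  have eg := pre_length (X := X) w
  rw [← hg] at eg
  have hR1 := leftStep_pos h
  set R := leftStep h with hRdef
  have hRle : i + R ≤ j := by rw [stopLength] at hR; omega
  have h0 : (1 : ℝ) ≤ h := by exact_mod_cast h1
  obtain ⟨s, hs⟩ : ∃ s, s = 4 * h + 1 := ⟨_, rfl⟩
  have hw' : IsLocalGeod X (2 * s) w := hs ▸ hw
  have hs0 : (1 : ℝ) ≤ s := by exact_mod_cast (by omega : 1 ≤ s)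
  have H' : FourPoint X (h : ℝ) := H
  -- lower bounds for progress
  have p1 := hw'.sub_le hX H hs (a := i) (b := i + R) (by omega) (by omega)
  -- `leftStep` is chosen for this: a gain of `12h` absorbs the error `8h` of the invariant and the
  -- defect `4h` of the quasigeodesic, so the equation for `m` has a solution not beyond `j`.
  have p1' : 12 * (h : ℝ) ≤ rdist X (pre X w i) (pre X w (i + R)) := by
    have : (R : ℝ) = s * (12 * h + 1) := by rw [hRdef, leftStep, hs]; push_cast; ring
    push_cast at p1
    rw [add_sub_cancel_left, this] at p1
    have := le_of_mul_le_mul_left p1 (by linarith); linarith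
  have p2 := hw'.sub_le hX H hs (a := i) (b := j) (by omega) (by omega)
  -- `stopLength` is chosen for this: it keeps `i + R` in the first half of `w`, that is, `2 d(1,
  -- pre (i + R)) ≤ |g|`.
  have p2' : 2 * (R : ℝ) + 16 * h ≤ rdist X (pre X w i) (pre X w j) := by
    have h3 : s * (2 * R + 16 * h + 1) ≤ j - i := by
      rw [stopLength, ← hs, ← hRdef] at hR; omega
    have h4 : (s : ℝ) * (2 * R + 16 * h + 1) ≤ j - i := by
      rw [← Nat.cast_sub hij]; exact_mod_cast h3
    have := le_of_mul_le_mul_left (h4.trans p2) (by linarith); linarith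
  have q1 := hw'.rdist_add_le hX H hs (Nat.zero_le i) (by omega : i ≤ w.length) le_rfl
  have q2 := hw'.rdist_add_le hX H hs hij hj le_rfl
  have q3 := hw'.rdist_add_le hX H hs (Nat.zero_le i) (by omega : i ≤ i + R) (by omega)
  have q4 := hw'.rdist_add_le hX H hs (Nat.zero_le (i + R)) (by omega : i + R ≤ w.length) le_rfl
  have u1 := rdist_pre_le (X := X) w (by omega : i ≤ i + R)
  push_cast at u1
  rw [e0, eg] at q1 q4
  rw [eg] at q2
  rw [e0] at q3
  have gi : rdist X g (g * pre X w i) = rdist X 1 (pre X w i) := by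
    simpa using rdist_mul_left (X := X) g 1 (pre X w i)
  have gi' : rdist X g (g * pre X w (i + R)) = rdist X 1 (pre X w (i + R)) := by
    simpa using rdist_mul_left (X := X) g 1 (pre X w (i + R))
  have v1 := rdist_triangle hX g (pre X w j) (g * pre X w i)
  have v2 := rdist_triangle hX g (g * pre X w i) (pre X w j)
  rw [rdist_comm hX g (pre X w j)] at v1 v2
  rw [rdist_comm hX (pre X w j) (g * pre X w i)] at v1
  have v3 := rdist_triangle hX 1 (pre X w i) (pre X w (i + R))
  have v4 := rdist_triangle hX 1 (pre X w (i + R)) g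
  obtain ⟨m, hm1, hm2, hm3⟩ := exists_eq_of_succ_le (f := fun m => wordDist X (pre X w m) g)
    (t := wordDist X 1 (pre X w (i + R))) (i := i + R) (j := j)
    (fun m => by
      have a1 := hX.wordDist_triangle (pre X w m) (pre X w (m + 1)) g
      have a2 := rdist_pre_le (X := X) w (Nat.le_succ m)
      push_cast at a2
      rw [add_sub_cancel_left, rdist] at a2
      have a3 : wordDist X (pre X w m) (pre X w (m + 1)) ≤ 1 := by exact_mod_cast a2
      omega) hRle
    (by
      have : rdist X 1 (pre X w (i + R)) ≤ rdist X (pre X w (i + R)) g := by linarith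
      rw [rdist, rdist] at this; exact_mod_cast this)
    (by
      have : rdist X (pre X w j) g ≤ rdist X 1 (pre X w (i + R)) := by linarith
      rw [rdist, rdist] at this; exact_mod_cast this)
  have hm : rdist X (pre X w m) g = rdist X 1 (pre X w (i + R)) := by rw [rdist, hm3, rdist]
  have q5 := hw'.rdist_add_le hX H hs (Nat.zero_le m) (by omega : m ≤ w.length) le_rfl
  rw [e0, eg] at q5
  have sq := IsOfFinOrder.rdist_sq_le hX (by linarith) H ht 1
  rw [mul_one] at sq
  have g2 : rdist X g (g * g) = rdist X 1 g := by
    simpa using rdist_mul_left (X := X) g 1 g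
  have g3 : rdist X (g * pre X w (i + R)) (g * g) = rdist X (pre X w (i + R)) g :=
    rdist_mul_left g _ g
  -- The same comparison as for exact middles, with `4h` added for each local geodesic in place of a
  -- geodesic.
  have close : rdist X (g * pre X w (i + R)) (pre X w m) ≤ 8 * h := by
    have c1 := rdist_comm hX (pre X w m) g
    have c2 := rdist_comm hX (pre X w m) (g * pre X w (i + R))
    have c3 := rdist_comm hX (g * g) (g * pre X w (i + R))
    have c4 := rdist_comm hX (g * pre X w (i + R)) g
    have c5 := rdist_comm hX (g * g) g
    have c6 := rdist_comm hX (g * g) 1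
    have c7 := rdist_comm hX g 1
    have c8 := rdist_comm hX (pre X w m) 1
    have c9 := rdist_comm hX (g * pre X w (i + R)) 1
    rcases H.rdist_le hX (pre X w m) (g * pre X w (i + R)) 1 g with k | k
    · linarith
    · rcases H.rdist_le hX 1 (g * pre X w (i + R)) (g * g) g with k' | k' <;> linarith
  refine ⟨j - m, ?_, by rwa [Nat.sub_sub_self hm2]⟩
  have p3 := hw'.sub_le hX H hs hm2 hj
  have t1 := rdist_triangle hX (pre X w m) (g * pre X w (i + R)) (pre X w j)
  have t2 := rdist_triangle hX (g * pre X w (i + R)) (g * pre X w i) (pre X w j)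
  rw [rdist_mul_left, rdist_comm hX (pre X w (i + R)) (pre X w i)] at t2
  rw [rdist_comm hX (pre X w m) (g * _)] at t1
  -- Twice the error `8h` and the `R` letters read on the left; this is the source of `rightStep`.
  have t3 : rdist X (pre X w m) (pre X w j) + 1 ≤ 16 * h + R + 1 := by linarith
  have t4 : (j : ℝ) - m ≤ s * (16 * h + R + 1) :=
    p3.trans (mul_le_mul_of_nonneg_left t3 (by linarith))
  rw [← Nat.cast_sub hm2] at t4
  rw [rightStep, ← hs, ← hRdef]
  exact_mod_cast t4

/-- The invariant gives `d(1, pre i) ≈ d(pre j, g)`. As `i` and `j` are close, `pre i` is about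
equally far from `1` and `g`, and it lies near a geodesic between them. -/
theorem IsLocalGeod.rdist_isMid_le {i j : ℕ} (hij : i ≤ j)
    (hj : j ≤ w.length) (hS : rdist X (eval X w * pre X w i) (pre X w j) ≤ 8 * h)
    (hR : j - i < stopLength h) {q : G} (hq : IsMid X (eval X w) q) :
    rdist X (pre X w i) q ≤ stopLength h + 10 * h := by
  obtain ⟨g, hg⟩ : ∃ g, g = eval X w := ⟨_, rfl⟩
  rw [← hg] at hS hq
  have e0 := pre_zero (X := X) w
  have eg := pre_length (X := X) w
  rw [← hg] at eg
  have h0 : (1 : ℝ) ≤ h := by exact_mod_cast h1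
  obtain ⟨a1, a2, a3⟩ := hq
  have u1 := rdist_pre_le (X := X) w hij
  have u2 : (j : ℝ) - i + 1 ≤ stopLength h := by
    rw [← Nat.cast_sub hij]; exact_mod_cast hR
  have q1 := hw.rdist_add_le hX H rfl (Nat.zero_le i) (by omega : i ≤ w.length) le_rfl
  rw [e0, eg] at q1
  have gi : rdist X g (g * pre X w i) = rdist X 1 (pre X w i) := by
    simpa using rdist_mul_left (X := X) g 1 (pre X w i)
  have v1 := rdist_triangle hX g (pre X w j) (g * pre X w i)
  have v2 := rdist_triangle hX g (g * pre X w i) (pre X w j)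
  rw [rdist_comm hX g (pre X w j)] at v1 v2
  rw [rdist_comm hX (pre X w j) (g * pre X w i)] at v1
  have v3 := rdist_triangle hX 1 (pre X w i) g
  have v4 := rdist_triangle hX (pre X w i) (pre X w j) g
  have v5 := rdist_triangle hX (pre X w j) (pre X w i) g
  rw [rdist_comm hX (pre X w j) (pre X w i)] at v5
  rcases H.rdist_le hX (pre X w i) q g 1 with k | k <;>
    rw [rdist_comm hX g 1, rdist_comm hX q] at k
  · linarith
  · rw [rdist_comm hX (pre X w i) 1, rdist_comm hX g q] at k; linarith

end Search

end LocalGeodesics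

/-! ### While programs on stacks -/

section Programs

open Turing

variable {K : Type} {Γ : K → Type} {σ : Type}

/-- Programs acting on a state and on finitely many stacks. A basic action replaces
the top `b k` letters of each stack `k` in a way that depends on these letters and on the state;
the tests may depend on the top letters of the stacks and on the state. -/
inductive Prog {K : Type} (Γ : K → Type) (σ : Type) : Type
  | act (b : K → ℕ) (f : σ → (∀ k, List (Γ k)) → σ × ∀ k, List (Γ k))
  | seq (p q : Prog Γ σ)
  | ite (b : K → ℕ) (c : σ → (∀ k, List (Γ k)) → Bool) (p q : Prog Γ σ)
  | loop (b : K → ℕ) (c : σ → (∀ k, List (Γ k)) → Bool) (p : Prog Γ σ)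

/-- The top `b k` letters of every stack `k`. -/
def window (b : K → ℕ) (S : ∀ k, List (Γ k)) (k : K) : List (Γ k) := (S k).take (b k)

/-- `Exec p s S s' S' t`: the program `p`, started in the state `s` with stacks `S`, terminates in
the state `s'` with stacks `S'`, in time at most `t`. -/
inductive Exec : Prog Γ σ → σ → (∀ k, List (Γ k)) → σ → (∀ k, List (Γ k)) → ℕ → Prop
  | act {b f s S} :
      Exec (.act b f) s S (f s (window b S)).1
        (fun k => (f s (window b S)).2 k ++ (S k).drop (b k)) 1
  | seq {p q s S s' S' s'' S'' t t'} : Exec p s S s' S' t → Exec q s' S' s'' S'' t' →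
      Exec (.seq p q) s S s'' S'' (t + t')
  | ite_true {b c p q s S s' S' t} : c s (window b S) = true → Exec p s S s' S' t →
      Exec (.ite b c p q) s S s' S' (t + 1)
  | ite_false {b c p q s S s' S' t} : c s (window b S) = false → Exec q s S s' S' t →
      Exec (.ite b c p q) s S s' S' (t + 1)
  | loop_true {b c p s S s' S' s'' S'' t t'} : c s (window b S) = true → Exec p s S s' S' t →
      Exec (.loop b c p) s' S' s'' S'' t' → Exec (.loop b c p) s S s'' S'' (t + t' + 1)
  | loop_false {b c p s S} : c s (window b S) = false → Exec (.loop b c p) s S s S 1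
  | mono {p s S s' S' t t'} : Exec p s S s' S' t → t ≤ t' → Exec p s S s' S' t'

/-! ### Translation to stack machines -/

/-- Lists of length at most `N`. -/
abbrev BList (α : Type) (N : ℕ) : Type := {l : List α // l.length ≤ N}

instance BList.instFinite (α : Type) [Finite α] (N : ℕ) : Finite (BList α N) :=
  (List.finite_length_le α N).to_subtype

/-- Buffers for the top letters of the stacks. -/
abbrev Buffer {K : Type} (Γ : K → Type) (N : ℕ) : Type := ∀ k, BList (Γ k) N

/-- The contents of a buffer. -/
def Buffer.val {N : ℕ} (W : Buffer Γ N) (k : K) : List (Γ k) := (W k).1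

/-- The empty buffer. -/
def Buffer.empty (Γ : K → Type) (N : ℕ) : Buffer Γ N := fun _ => ⟨[], Nat.zero_le N⟩

/-- Appends a letter to a bounded list, if there is room for it. -/
def BList.push {α : Type} {N : ℕ} (l : BList α N) (o : Option α) : BList α N :=
  if h : (l.1 ++ o.toList).length ≤ N then ⟨_, h⟩ else l

/-- The labels of the translation of a program. -/
def Prog.Lab : Prog Γ σ → Type
  | .act _ _ => Unit
  | .seq p q => p.Lab ⊕ q.Lab
  | .ite _ _ p q => Option (p.Lab ⊕ q.Lab)
  | .loop _ _ p => Option p.Lab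

/-- The first label. -/
def Prog.entry : (p : Prog Γ σ) → p.Lab
  | .act _ _ => ()
  | .seq p _ => Sum.inl p.entry
  | .ite _ _ _ _ => none
  | .loop _ _ _ => none

instance Prog.finite_lab (p : Prog Γ σ) : Finite p.Lab := by
  induction p with
  | act => exact inferInstanceAs (Finite Unit)
  | seq p q _ _ => exact inferInstanceAs (Finite (p.Lab ⊕ q.Lab))
  | ite _ _ p q _ _ => exact inferInstanceAs (Finite (Option (p.Lab ⊕ q.Lab)))
  | loop _ _ p _ => exact inferInstanceAs (Finite (Option p.Lab))

/-- The bound `N` is large enough for all letters that are read or written in one action. -/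
def Prog.Fits (N : ℕ) : Prog Γ σ → Prop
  | .act b f => (∀ k, b k ≤ N) ∧ ∀ s W, (∀ k, (W k).length ≤ b k) → ∀ k, ((f s W).2 k).length ≤ N
  | .seq p q => p.Fits N ∧ q.Fits N
  | .ite b _ p q => (∀ k, b k ≤ N) ∧ p.Fits N ∧ q.Fits N
  | .loop b _ p => (∀ k, b k ≤ N) ∧ p.Fits N

theorem Prog.Fits.mono {N N' : ℕ} (h : N ≤ N') {p : Prog Γ σ} (hp : p.Fits N) : p.Fits N' := by
  induction p with
  | act b f =>
    exact ⟨fun k => (hp.1 k).trans h, fun s W hW k => (hp.2 s W hW k).trans h⟩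
  | seq p q ihp ihq => exact ⟨ihp hp.1, ihq hp.2⟩
  | ite b c p q ihp ihq => exact ⟨fun k => (hp.1 k).trans h, ihp hp.2.1, ihq hp.2.2⟩
  | loop b c p ih => exact ⟨fun k => (hp.1 k).trans h, ih hp.2⟩

variable {L : Type} {N : ℕ}

/-- Jump to a label or halt. -/
def exitStmt : Option L → TM2.Stmt Γ L (σ × Buffer Γ N)
  | some l => .goto fun _ => l
  | none => .halt

/-- An action sees one of finitely many combinations of states and top letters, so its output is
bounded. This keeps the buffers, and with them the control of the machine, finite. -/
theorem Prog.exists_fits [Finite K] [∀ k, Finite (Γ k)] [Finite σ] (p : Prog Γ σ) :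
    ∃ N, p.Fits N := by
  have bound : ∀ b : K → ℕ, ∃ N, ∀ k, b k ≤ N := fun b => by
    obtain ⟨N, hN⟩ := (Set.finite_range b).bddAbove
    exact ⟨N, fun k => hN ⟨k, rfl⟩⟩
  induction p with
  | act b f =>
    obtain ⟨N, hN⟩ := bound b
    let F : σ × (∀ k, BList (Γ k) (b k)) × K → ℕ :=
      fun x => ((f x.1 fun k => (x.2.1 k).1).2 x.2.2).length
    obtain ⟨M, hM⟩ := (Set.finite_range F).bddAbove
    refine ⟨N + M, fun k => (hN k).trans (Nat.le_add_right _ _), fun s W hW k => ?_⟩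
    have := hM ⟨(s, fun k => ⟨W k, hW k⟩, k), rfl⟩
    exact this.trans (Nat.le_add_left _ _)
  | seq p q ihp ihq =>
    obtain ⟨N, hN⟩ := ihp
    obtain ⟨M, hM⟩ := ihq
    exact ⟨N + M, hN.mono (Nat.le_add_right _ _), hM.mono (Nat.le_add_left _ _)⟩
  | ite b c p q ihp ihq =>
    obtain ⟨B, hB⟩ := bound b
    obtain ⟨N, hN⟩ := ihp
    obtain ⟨M, hM⟩ := ihq
    exact ⟨B + (N + M), fun k => (hB k).trans (by omega), hN.mono (by omega), hM.mono (by omega)⟩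
  | loop b c p ih =>
    obtain ⟨B, hB⟩ := bound b
    obtain ⟨N, hN⟩ := ih
    exact ⟨B + N, fun k => (hB k).trans (by omega), hN.mono (by omega)⟩

variable [DecidableEq K]

theorem stepAux_exitStmt (next : Option L) (v : σ × Buffer Γ N) (S : ∀ k, List (Γ k)) :
    TM2.stepAux (exitStmt next) v S = ⟨next, v, S⟩ := by
  cases next <;> rfl

/-- Identifies the initial and final stack contents, which are defined with casts along an equality
of stacks, with an updated function. -/
theorem dite_eq_update {k₀ : K} (u : List (Γ k₀)) {k : K} (f : k = k₀ → List (Γ k))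
    (hf : ∀ h, HEq (f h) u) (d : Decidable (k = k₀)) :
    @dite _ (k = k₀) d f (fun _ => []) = Function.update (fun _ => []) k₀ u k := by
  by_cases h : k = k₀
  · subst h; rw [dif_pos rfl, Function.update_self]; exact eq_of_heq (hf rfl)
  · rw [dif_neg h, Function.update_of_ne h]

/-- `M` gets from the configuration `c` to the configuration `c'` in at most `t` steps. -/
def ReachesIn (M : L → TM2.Stmt Γ L (σ × Buffer Γ N)) (c c' : TM2.Cfg Γ L (σ × Buffer Γ N))
    (t : ℕ) : Prop :=
  ∃ m ≤ t, (flip bind (TM2.step M))^[m] (some c) = some c'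

theorem ReachesIn.refl (M : L → TM2.Stmt Γ L (σ × Buffer Γ N))
    (c : TM2.Cfg Γ L (σ × Buffer Γ N)) : ReachesIn M c c 0 := ⟨0, le_rfl, rfl⟩

theorem ReachesIn.trans {M : L → TM2.Stmt Γ L (σ × Buffer Γ N)}
    {c c' c'' : TM2.Cfg Γ L (σ × Buffer Γ N)} {t t' : ℕ} (h : ReachesIn M c c' t)
    (h' : ReachesIn M c' c'' t') : ReachesIn M c c'' (t + t') := by
  obtain ⟨m, hm, e⟩ := h
  obtain ⟨m', hm', e'⟩ := h'
  exact ⟨m' + m, by omega, by rw [Function.iterate_add_apply, e, e']⟩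

theorem ReachesIn.single {M : L → TM2.Stmt Γ L (σ × Buffer Γ N)} {l : L} {v : σ × Buffer Γ N}
    {S : ∀ k, List (Γ k)} {c' : TM2.Cfg Γ L (σ × Buffer Γ N)} (h : TM2.stepAux (M l) v S = c') :
    ReachesIn M ⟨some l, v, S⟩ c' 1 := ⟨1, le_rfl, by rw [← h]; rfl⟩

/-- Moves the top `m` letters of the stack `k` to the buffer. -/
def readOne (k : K) : ℕ → TM2.Stmt Γ L (σ × Buffer Γ N) → TM2.Stmt Γ L (σ × Buffer Γ N)
  | 0, q => q
  | m + 1, q => .pop k (fun v o => (v.1, Function.update v.2 k ((v.2 k).push o))) (readOne k m q)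

/-- Moves the top letters of all stacks in a list to the buffer. -/
def readAll (b : K → ℕ) : List K → TM2.Stmt Γ L (σ × Buffer Γ N) → TM2.Stmt Γ L (σ × Buffer Γ N)
  | [], q => q
  | k :: ks, q => readOne k (b k) (readAll b ks q)

/-- Pushes the first `m` letters of `out v` on the stack `k`. -/
def writeOne (k : K) [Inhabited (Γ k)] (out : σ × Buffer Γ N → List (Γ k)) :
    ℕ → TM2.Stmt Γ L (σ × Buffer Γ N) → TM2.Stmt Γ L (σ × Buffer Γ N)
  | 0, q => q
  -- The letter with index `m` is pushed before those with smaller indices, so that the first letter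
  -- ends on top. The branch keeps the default value from being pushed.
  | m + 1, q => .branch (fun v => m < (out v).length)
      (.push k (fun v => (out v)[m]?.getD default) (writeOne k out m q)) (writeOne k out m q)

/-- Pushes the first `m` letters of `out v k` on every stack `k` in a list. -/
def writeAll [∀ k, Inhabited (Γ k)] (out : σ × Buffer Γ N → ∀ k, List (Γ k)) (m : ℕ) :
    List K → TM2.Stmt Γ L (σ × Buffer Γ N) → TM2.Stmt Γ L (σ × Buffer Γ N)
  | [], q => q
  | k :: ks, q => writeOne k (fun v => out v k) m (writeAll out m ks q)

theorem stepAux_readOne (k : K) (m : ℕ) (q : TM2.Stmt Γ L (σ × Buffer Γ N)) (s : σ)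
    (W W' : Buffer Γ N) (S : ∀ k, List (Γ k))
    (h : (W k).1.length + m ≤ N) (hW : ∀ j, j ≠ k → W' j = W j)
    (hk : (W' k).1 = (W k).1 ++ (S k).take m) :
    TM2.stepAux (readOne k m q) (s, W) S =
      TM2.stepAux q (s, W') (Function.update S k ((S k).drop m)) := by
  induction m generalizing W S with
  | zero =>
    have : W' = W := by
      funext j; by_cases e : j = k
      · subst e; exact Subtype.ext (by simpa using hk)
      · exact hW j e
    simp [readOne, this]
  | succ m ih =>
    rw [readOne, TM2.stepAux]
    have hlen : ((W k).1 ++ (S k).head?.toList).length ≤ N := by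
      rw [List.length_append]
      have : ((S k).head?.toList).length ≤ 1 := by cases (S k).head? <;> simp
      omega
    have e1 : (((W k).push (S k).head?)).1 = (W k).1 ++ (S k).head?.toList := by
      rw [BList.push, dif_pos hlen]
    rw [ih]
    · simp
    · simp only [Function.update_self, e1, List.length_append]
      have : ((S k).head?.toList).length ≤ 1 := by cases (S k).head? <;> simp
      omega
    · intro j hj; simp [hj, hW j hj]
    · simp only [Function.update_self, e1, hk]
      cases S k <;> simp

theorem stepAux_readAll (b : K → ℕ) (hb : ∀ k, b k ≤ N) (q : TM2.Stmt Γ L (σ × Buffer Γ N))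
    (s : σ) (ks : List K) (hks : ks.Nodup) (W : Buffer Γ N) (S : ∀ k, List (Γ k))
    (hW : ∀ k ∈ ks, (W k).1 = []) :
    TM2.stepAux (readAll b ks q) (s, W) S =
      TM2.stepAux q (s, fun k => if k ∈ ks then ⟨(S k).take (b k), by simp [hb]⟩ else W k)
        (fun k => if k ∈ ks then (S k).drop (b k) else S k) := by
  induction ks generalizing W S with
  | nil => simp [readAll]
  | cons k ks ih =>
    obtain ⟨hk, hks⟩ := List.nodup_cons.1 hks
    rw [readAll, stepAux_readOne k (b k) _ s W
      (Function.update W k ⟨(S k).take (b k), by simp [hb]⟩) S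
      (by simp [hW k (by simp), hb]) (fun j hj => by simp [hj])
      (by simp [hW k (by simp)]), ih hks]
    · congr 2
      · funext j
        by_cases h1 : j = k
        · subst h1; simp [hk]
        · by_cases h2 : j ∈ ks <;> simp [h1, h2]
      · funext j
        by_cases h1 : j = k
        · subst h1; simp [hk]
        · by_cases h2 : j ∈ ks <;> simp [h1, h2]
    · intro j hj
      have : j ≠ k := by rintro rfl; exact hk hj
      rw [Function.update_of_ne this, hW j (by simp [hj])]

theorem stepAux_writeOne (k : K) [Inhabited (Γ k)] (out : σ × Buffer Γ N → List (Γ k)) (m : ℕ)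
    (q : TM2.Stmt Γ L (σ × Buffer Γ N)) (v : σ × Buffer Γ N) (S : ∀ k, List (Γ k)) :
    TM2.stepAux (writeOne k out m q) v S =
      TM2.stepAux q v (Function.update S k ((out v).take m ++ S k)) := by
  induction m generalizing S with
  | zero => simp [writeOne]
  | succ m ih =>
    rw [writeOne, TM2.stepAux]
    by_cases h : m < (out v).length
    · simp only [h, decide_true, cond_true, TM2.stepAux, ih]
      rw [← List.take_append_getElem h, List.append_assoc]
      simp [h]
    · simp only [h, decide_false, cond_false, ih]
      rw [List.take_of_length_le (by omega), List.take_of_length_le (by omega)]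

theorem stepAux_writeAll [∀ k, Inhabited (Γ k)] (out : σ × Buffer Γ N → ∀ k, List (Γ k)) (m : ℕ)
    (q : TM2.Stmt Γ L (σ × Buffer Γ N)) (v : σ × Buffer Γ N) (ks : List K) (hks : ks.Nodup)
    (S : ∀ k, List (Γ k)) :
    TM2.stepAux (writeAll out m ks q) v S =
      TM2.stepAux q v (fun k => if k ∈ ks then (out v k).take m ++ S k else S k) := by
  induction ks generalizing S with
  | nil => simp [writeAll]
  | cons k ks ih =>
    obtain ⟨hk, hks⟩ := List.nodup_cons.1 hks
    rw [writeAll, stepAux_writeOne, ih hks]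
    congr 1
    funext j
    by_cases h1 : j = k
    · subst h1; simp [hk]
    · by_cases h2 : j ∈ ks <;> simp [h1, h2]

variable [Fintype K] [∀ k, Inhabited (Γ k)]

/-- A test: the top letters of the stacks are read, and put back. -/
noncomputable def testStmt (b : K → ℕ) (c : σ → (∀ k, List (Γ k)) → Bool) (yes no : Option L) :
    TM2.Stmt Γ L (σ × Buffer Γ N) :=
  readAll b Finset.univ.toList (writeAll (fun v => v.2.val) N Finset.univ.toList
    (.branch (fun v => c v.1 v.2.val)
      (.load (fun v => (v.1, Buffer.empty Γ N)) (exitStmt yes))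
      (.load (fun v => (v.1, Buffer.empty Γ N)) (exitStmt no))))

/-- A basic action. -/
noncomputable def actStmt (b : K → ℕ) (f : σ → (∀ k, List (Γ k)) → σ × ∀ k, List (Γ k))
    (next : Option L) : TM2.Stmt Γ L (σ × Buffer Γ N) :=
  readAll b Finset.univ.toList (writeAll (fun v => (f v.1 v.2.val).2) N Finset.univ.toList
    (.load (fun v => ((f v.1 v.2.val).1, Buffer.empty Γ N)) (exitStmt next)))

/-- The statements of the translation of a program, which passes control to `next` at the end. -/
noncomputable def Prog.code (N : ℕ) : (p : Prog Γ σ) → {L : Type} → (p.Lab → L) → Option L → p.Lab →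
    TM2.Stmt Γ L (σ × Buffer Γ N)
  | .act b f, _, _, next, _ => actStmt b f next
  | .seq p q, _, emb, _, Sum.inl l =>
      p.code N (fun l => emb (Sum.inl l)) (some (emb (Sum.inr q.entry))) l
  | .seq _ q, _, emb, next, Sum.inr l => q.code N (fun l => emb (Sum.inr l)) next l
  | .ite b c p q, _, emb, _, none =>
      testStmt b c (some (emb (some (Sum.inl p.entry)))) (some (emb (some (Sum.inr q.entry))))
  | .ite _ _ p _, _, emb, next, some (Sum.inl l) =>
      p.code N (fun l => emb (some (Sum.inl l))) next l
  | .ite _ _ _ q, _, emb, next, some (Sum.inr l) =>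
      q.code N (fun l => emb (some (Sum.inr l))) next l
  | .loop b c p, _, emb, next, none => testStmt b c (some (emb (some p.entry))) next
  | .loop _ _ p, _, emb, _, some l => p.code N (fun l => emb (some l)) (some (emb none)) l

theorem stepAux_testStmt {b : K → ℕ} (hb : ∀ k, b k ≤ N) (c : σ → (∀ k, List (Γ k)) → Bool)
    (yes no : Option L) (s : σ) (S : ∀ k, List (Γ k)) :
    TM2.stepAux (testStmt b c yes no) (s, Buffer.empty Γ N) S =
      ⟨if c s (window b S) then yes else no, (s, Buffer.empty Γ N), S⟩ := by
  rw [testStmt, stepAux_readAll b hb _ _ _ (Finset.nodup_toList _) _ _ (fun _ _ => rfl),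
    stepAux_writeAll _ _ _ _ _ (Finset.nodup_toList _)]
  simp only [Finset.mem_toList, Finset.mem_univ, if_true, TM2.stepAux, stepAux_exitStmt]
  have e : Buffer.val (Γ := Γ) (N := N) (fun k => ⟨(S k).take (b k), by simp [hb]⟩) =
      window b S := rfl
  have e2 : (fun k => (Buffer.val (Γ := Γ) (N := N)
      (fun k => ⟨(S k).take (b k), by simp [hb]⟩) k).take N ++ (S k).drop (b k)) = S := by
    funext k
    rw [e, window, List.take_take, min_eq_right (hb k), List.take_append_drop]
  rw [e2, e]
  cases c s (window b S) <;> rfl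

theorem stepAux_actStmt {b : K → ℕ} (hb : ∀ k, b k ≤ N)
    (f : σ → (∀ k, List (Γ k)) → σ × ∀ k, List (Γ k))
    (hf : ∀ s W, (∀ k, (W k).length ≤ b k) → ∀ k, ((f s W).2 k).length ≤ N)
    (next : Option L) (s : σ) (S : ∀ k, List (Γ k)) :
    TM2.stepAux (actStmt b f next) (s, Buffer.empty Γ N) S =
      ⟨next, ((f s (window b S)).1, Buffer.empty Γ N),
        fun k => (f s (window b S)).2 k ++ (S k).drop (b k)⟩ := by
  rw [actStmt, stepAux_readAll b hb _ _ _ (Finset.nodup_toList _) _ _ (fun _ _ => rfl),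
    stepAux_writeAll _ _ _ _ _ (Finset.nodup_toList _)]
  simp only [Finset.mem_toList, Finset.mem_univ, if_true, TM2.stepAux, stepAux_exitStmt]
  have e : Buffer.val (Γ := Γ) (N := N) (fun k => ⟨(S k).take (b k), by simp [hb]⟩) =
      window b S := rfl
  rw [e]
  congr 1
  funext k
  rw [List.take_of_length_le (hf s _ (fun k => by simp [window]) k)]

/-- Each action and each test is one statement of the machine, hence one step; composition and loops
only link labels. Between statements the buffers are empty. -/
theorem Exec.reachesIn {p : Prog Γ σ} {s s' : σ} {S S' : ∀ k, List (Γ k)} {t : ℕ}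
    (h : Exec p s S s' S' t) : ∀ {L : Type} (M : L → TM2.Stmt Γ L (σ × Buffer Γ N))
    (emb : p.Lab → L) (next : Option L), p.Fits N → (∀ l, M (emb l) = p.code N emb next l) →
    ReachesIn M ⟨some (emb p.entry), (s, Buffer.empty Γ N), S⟩
      ⟨next, (s', Buffer.empty Γ N), S'⟩ t := by
  induction h with
  | act =>
    intro L M emb next hp hM
    apply ReachesIn.single
    rw [hM]
    exact stepAux_actStmt hp.1 _ hp.2 _ _ _
  | @seq p q _ _ _ _ _ _ _ _ _ _ ih1 ih2 =>
    intro L M emb next hp hM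
    exact (ih1 M (fun l => emb (Sum.inl l)) (some (emb (Sum.inr q.entry))) hp.1
      (fun l => hM (Sum.inl l))).trans (ih2 M (fun l => emb (Sum.inr l)) next hp.2
      (fun l => hM (Sum.inr l)))
  | @ite_true b c p q _ _ _ _ _ hc _ ih =>
    intro L M emb next hp hM
    rw [add_comm]
    refine ReachesIn.trans (ReachesIn.single ?_) (ih M (fun l => emb (some (Sum.inl l))) next hp.2.1
      (fun l => hM (some (Sum.inl l))))
    refine (congrArg (fun q => TM2.stepAux q _ _) (hM none)).trans ?_
    exact (stepAux_testStmt hp.1 _ _ _ _ _).trans (by rw [hc]; rfl)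
  | @ite_false b c p q _ _ _ _ _ hc _ ih =>
    intro L M emb next hp hM
    rw [add_comm]
    refine ReachesIn.trans (ReachesIn.single ?_) (ih M (fun l => emb (some (Sum.inr l))) next hp.2.2
      (fun l => hM (some (Sum.inr l))))
    refine (congrArg (fun q => TM2.stepAux q _ _) (hM none)).trans ?_
    exact (stepAux_testStmt hp.1 _ _ _ _ _).trans (by rw [hc]; rfl)
  | @loop_true b c p _ _ _ _ _ _ _ _ hc _ _ ih1 ih2 =>
    intro L M emb next hp hM
    rw [add_comm]
    refine ReachesIn.trans (ReachesIn.single ?_) ((ih1 M (fun l => emb (some l)) (some (emb none))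
      hp.2 (fun l => hM (some l))).trans (ih2 M emb next hp hM))
    refine (congrArg (fun q => TM2.stepAux q _ _) (hM none)).trans ?_
    exact (stepAux_testStmt hp.1 _ _ _ _ _).trans (by rw [hc]; rfl)
  | @loop_false b c p _ _ hc =>
    intro L M emb next hp hM
    refine ReachesIn.single ?_
    refine (congrArg (fun q => TM2.stepAux q _ _) (hM none)).trans ?_
    exact (stepAux_testStmt hp.1 _ _ _ _ _).trans (by rw [hc]; rfl)
  | mono _ hle ih =>
    intro L M emb next hp hM
    obtain ⟨m, hm, e⟩ := ih M emb next hp hM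
    exact ⟨m, hm.trans hle, e⟩

/-- The stack machine that carries out a program. -/
noncomputable def Prog.toFinTM2 [∀ k, Finite (Γ k)] [Finite σ] (p : Prog Γ σ) (s₀ : σ)
    (k₀ k₁ : K) : FinTM2 :=
  letI N := p.exists_fits.choose
  letI := Fintype.ofFinite p.Lab
  letI := Fintype.ofFinite (σ × Buffer Γ N)
  letI := Fintype.ofFinite (Γ k₀)
  { K := K
    k₀ := k₀
    k₁ := k₁
    Γ := Γ
    Λ := p.Lab
    main := p.entry
    σ := σ × Buffer Γ N
    initialState := (s₀, Buffer.empty Γ N)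
    m := p.code N id none }

/-- A halting configuration must have the initial state and empty stacks apart from the output. This
is why the programs clean up after themselves. -/
theorem Exec.outputsInTime [∀ k, Finite (Γ k)] [Finite σ] {p : Prog Γ σ} {s₀ : σ} {k₀ k₁ : K}
    {u : List (Γ k₀)} {v : List (Γ k₁)} {t : ℕ}
    (h : Exec p s₀ (Function.update (fun _ => []) k₀ u) s₀ (Function.update (fun _ => []) k₁ v) t) :
    Nonempty (TM2OutputsInTime (p.toFinTM2 s₀ k₀ k₁) u (some v) t) := by
  obtain ⟨m, hm, e⟩ := h.reachesIn (N := p.exists_fits.choose) (p.code _ id none) id none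
    p.exists_fits.choose_spec (fun l => rfl)
  refine ⟨⟨⟨m, ?_⟩, hm⟩⟩
  have e1 : initList (p.toFinTM2 s₀ k₀ k₁) u =
      TM2.Cfg.mk (some p.entry) (s₀, Buffer.empty Γ _) (Function.update (fun _ => []) k₀ u) :=
    congrArg (TM2.Cfg.mk (some p.entry) (s₀, Buffer.empty Γ _))
      (funext fun k => dite_eq_update u _ (fun _ => cast_heq _ _) _)
  have e2 : haltList (p.toFinTM2 s₀ k₀ k₁) v =
      TM2.Cfg.mk none (s₀, Buffer.empty Γ _) (Function.update (fun _ => []) k₁ v) :=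
    congrArg (TM2.Cfg.mk none (s₀, Buffer.empty Γ _))
      (funext fun k => dite_eq_update v _ (fun _ => cast_heq _ _) _)
  exact (congrArg (fun c => (flip bind (p.toFinTM2 s₀ k₀ k₁).step)^[m] (some c)) e1).trans
    (e.trans (congrArg some e2).symm)

end Programs

/-! ### The stacks of the machine -/

section Machine

/-- The work stacks. -/
inductive WorkStack : Type
  -- `left`, `seg` and `inp` hold consecutive parts of the input, `left` with its last word on top.
  -- `con` holds a conjugator, last letter on top, and `cands` the candidates. Rewriting goes from
  -- `src` to `red`; `fwd`, `bwd` and `cnt` serve the search, the length of `cnt` being that of the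
  -- part not yet read.
  | inp | left | seg | con | cands | src | red | fwd | bwd | cnt | tmp
  deriving DecidableEq

instance : Fintype WorkStack :=
  ⟨{.inp, .left, .seg, .con, .cands, .src, .red, .fwd, .bwd, .cnt, .tmp},
    by intro x; cases x <;> simp⟩

/-- The letters on the stacks; `none` is the output stack. -/
abbrev Alph (n : ℕ) : Option WorkStack → Type
  | none => Fin n ⊕ Bool
  | some _ => Option (Fin n)

instance Alph.instInhabited (n : ℕ) : ∀ k, Inhabited (Alph n k)
  | none => ⟨Sum.inr false⟩
  | some _ => ⟨none⟩

instance Alph.instFinite (n : ℕ) : ∀ k, Finite (Alph n k)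
  | none => inferInstanceAs (Finite (Fin n ⊕ Bool))
  | some _ => inferInstanceAs (Finite (Option (Fin n)))

/-- The contents of the stacks. -/
@[ext] structure Mem (n : ℕ) where
  inp : List (Option (Fin n)) := []
  left : List (Option (Fin n)) := []
  seg : List (Option (Fin n)) := []
  con : List (Option (Fin n)) := []
  cands : List (Option (Fin n)) := []
  src : List (Option (Fin n)) := []
  red : List (Option (Fin n)) := []
  fwd : List (Option (Fin n)) := []
  bwd : List (Option (Fin n)) := []
  cnt : List (Option (Fin n)) := []
  tmp : List (Option (Fin n)) := []
  out : List (Fin n ⊕ Bool) := []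

/-- The contents of the stacks as a function. -/
def Mem.stk {n : ℕ} (m : Mem n) : ∀ k, List (Alph n k)
  | none => m.out
  | some .inp => m.inp
  | some .left => m.left
  | some .seg => m.seg
  | some .con => m.con
  | some .cands => m.cands
  | some .src => m.src
  | some .red => m.red
  | some .fwd => m.fwd
  | some .bwd => m.bwd
  | some .cnt => m.cnt
  | some .tmp => m.tmp

variable {n : ℕ} {σ : Type}

/-- Execution of programs with the stacks given as a record. -/
def Run (p : Prog (Alph n) σ) (s : σ) (m : Mem n) (s' : σ) (m' : Mem n) (t : ℕ) : Prop :=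
  Exec p s m.stk s' m'.stk t

theorem Run.mono {p : Prog (Alph n) σ} {s s' : σ} {m m' : Mem n} {t t' : ℕ}
    (h : Run p s m s' m' t) (ht : t ≤ t') : Run p s m s' m' t' := Exec.mono h ht

theorem Run.seq {p q : Prog (Alph n) σ} {s s' s'' : σ} {m m' m'' : Mem n} {t t' : ℕ}
    (h : Run p s m s' m' t) (h' : Run q s' m' s'' m'' t') : Run (.seq p q) s m s'' m'' (t + t') :=
  Exec.seq h h'

theorem Run.act {b : Option WorkStack → ℕ}
    {f : σ → (∀ k, List (Alph n k)) → σ × ∀ k, List (Alph n k)} {s s' : σ} {m m' : Mem n}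
    (h1 : (f s (window b m.stk)).1 = s')
    (h2 : ∀ k, (f s (window b m.stk)).2 k ++ (m.stk k).drop (b k) = m'.stk k) :
    Run (.act b f) s m s' m' 1 := by
  have := Exec.act (b := b) (f := f) (s := s) (S := m.stk)
  rw [h1, funext h2] at this
  exact this

/-- Reads one letter from the stack `k`. -/
def single (k : WorkStack) : Option WorkStack → ℕ := fun j => if j = some k then 1 else 0

/-- While the top letter `x` of the stack `k` satisfies `P`, it is popped, and the lists `f x` are
pushed on the stacks. -/
def move (k : WorkStack) (P : Option (Fin n) → Bool) (f : Option (Fin n) → Mem n) :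
    Prog (Alph n) σ :=
  .loop (single k) (fun _ W => (W (some k)).head?.any P)
    (.act (single k) fun s W => (s, fun j => (W (some k)).flatMap fun x => (f x).stk j))

/-- Letters are pushed in the order in which they are popped, whence the reversal. Each costs one
test and one action, and one more test ends the loop. -/
theorem exec_move (k : WorkStack) (P : Option (Fin n) → Bool) (f : Option (Fin n) → Mem n)
    (hf : ∀ x, (f x).stk (some k) = []) (s : σ) (u v : List (Option (Fin n)))
    (hu : ∀ x ∈ u, P x = true) (hv : v.head?.any P = false) (S : ∀ k, List (Alph n k))
    (hS : S (some k) = u ++ v) :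
    Exec (move k P f) s S s (Function.update
      (fun j => u.reverse.flatMap (fun x => (f x).stk j) ++ S j) (some k) v)
      (2 * u.length + 1) := by
  induction u generalizing S with
  | nil =>
    have e : Function.update (fun j => ([] : List (Option (Fin n))).reverse.flatMap
        (fun x => (f x).stk j) ++ S j) (some k) v = S := by
      funext j
      by_cases hj : j = some k
      · subst hj; simp [hS]
      · simp [hj]
    rw [e]
    refine Exec.loop_false ?_
    cases v with
    | nil => simp [window, single, hS]
    | cons x v => simpa [window, single, hS] using hv
  | cons x u ih =>
    have h1 := Exec.act (b := single k) (s := s) (S := S)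
      (f := fun s W => (s, fun j => (W (some k)).flatMap fun x => (f x).stk j))
    obtain ⟨S₁, hS₁⟩ : ∃ S₁, S₁ = fun j => ((window (single k) S (some k)).flatMap fun x =>
      (f x).stk j) ++ (S j).drop (single k j) := ⟨_, rfl⟩
    have e1 : S₁ (some k) = u ++ v := by
      rw [hS₁]; simp [window, single, hS, hf]
    have e2 : ∀ j, j ≠ some k → S₁ j = (f x).stk j ++ S j := by
      intro j hj
      rw [hS₁]; simp [window, single, hS, hj]
    have h2 := ih (fun y hy => hu y (by simp [hy])) S₁ e1
    have e3 : Function.update (fun j => u.reverse.flatMap (fun x => (f x).stk j) ++ S₁ j)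
        (some k) v = Function.update (fun j => (x :: u).reverse.flatMap (fun x => (f x).stk j) ++
        S j) (some k) v := by
      funext j
      by_cases hj : j = some k
      · subst hj; simp
      · simp [hj, e2 j hj]
    rw [e3] at h2
    rw [← hS₁] at h1
    refine Exec.mono (Exec.loop_true ?_ h1 h2) (by simp; omega)
    simp [window, single, hS, hu x (by simp)]

theorem run_move (k : WorkStack) (P : Option (Fin n) → Bool) (f : Option (Fin n) → Mem n)
    (hf : ∀ x, (f x).stk (some k) = []) (s : σ) (u v : List (Option (Fin n)))
    (hu : ∀ x ∈ u, P x = true) (hv : v.head?.any P = false) (m m' : Mem n)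
    (hS : m.stk (some k) = u ++ v) (hk : m'.stk (some k) = v)
    (hm : ∀ j, j ≠ some k → u.reverse.flatMap (fun x => (f x).stk j) ++ m.stk j = m'.stk j)
    {t : ℕ} (ht : 2 * u.length + 1 ≤ t) :
    Run (move k P f) s m s m' t := by
  have := exec_move k P f hf s u v hu hv m.stk hS
  refine Exec.mono ?_ ht
  convert this using 1
  funext j
  by_cases hj : j = some k
  · subst hj; simp [hk]
  · simp [hj, hm j hj]

/-- Moves the whole stack `k`. -/
theorem run_move_all (k : WorkStack) (f : Option (Fin n) → Mem n)
    (hf : ∀ x, (f x).stk (some k) = []) (s : σ) (m m' : Mem n) (hk : m'.stk (some k) = [])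
    (hm : ∀ j, j ≠ some k → (m.stk (some k)).reverse.flatMap (fun x => (f x).stk j) ++ m.stk j =
      m'.stk j) {t : ℕ} (ht : 2 * (m.stk (some k)).length + 1 ≤ t) :
    Run (move k (fun _ => true) f) s m s m' t :=
  run_move k _ f hf s (m.stk (some k)) [] (by simp) rfl m m' (by simp) hk hm ht

/-- Empties the stack `k`. -/
def clear (k : WorkStack) : Prog (Alph n) σ := move k (fun _ => true) fun _ => {}

theorem stk_empty (j : Option WorkStack) : ({} : Mem n).stk j = [] := by
  rcases j with _ | j
  · rfl
  · cases j <;> rfl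

theorem run_clear (k : WorkStack) (s : σ) (m m' : Mem n) (hk : m'.stk (some k) = [])
    (hm : ∀ j, j ≠ some k → m.stk j = m'.stk j) {t : ℕ}
    (ht : 2 * (m.stk (some k)).length + 1 ≤ t) : Run (clear k) s m s m' t :=
  run_move_all k _ (fun _ => stk_empty _) s m m' hk (fun j hj => by
    have : (fun _ : Option (Fin n) => ({} : Mem n).stk j) = fun _ => [] := by
      funext; exact stk_empty j
    rw [this, ← hm j hj]
    simp) ht

end Machine

/-! ### Reduction to locally geodesic words -/

section Dehn

variable {G : Type*} [Group G] {n : ℕ}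

/-- The internal states of the machine. -/
structure St (n a d : ℕ) where
  /-- Has the search for a segment of infinite order, or for a conjugator, been successful? -/
  flag : Bool := false
  /-- Is the search for the middle of a word going on? -/
  go : Bool := false
  /-- The word that joins the two sides in the search for the middle. -/
  link : BList (Fin n) a := ⟨[], Nat.zero_le _⟩
  /-- The words that have passed all tests. -/
  alive : Set (BList (Fin n) d) := ∅

instance St.instFinite (n a d : ℕ) : Finite (St n a d) := by
  refine Finite.of_injective (β := Bool × Bool × BList (Fin n) a × Set (BList (Fin n) d))
    (fun s => (s.flag, s.go, s.link, s.alive)) ?_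
  rintro ⟨⟩ ⟨⟩ h
  simpa using h

open Classical in
/-- A geodesic word for an element. -/
noncomputable def geo (X : Fin n → G) (g : G) : Word n :=
  if h : ∃ w : Word n, w.length = wordLength X g ∧ eval X w = g then h.choose else []

theorem IsSymmGenerating.length_geo {X : Fin n → G} (hX : IsSymmGenerating X) (g : G) :
    (geo X g).length = wordLength X g := by
  rw [geo, dif_pos (hX.exists_geodesic g)]; exact (hX.exists_geodesic g).choose_spec.1

theorem IsSymmGenerating.eval_geo {X : Fin n → G} (hX : IsSymmGenerating X) (g : G) :
    eval X (geo X g) = g := by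
  rw [geo, dif_pos (hX.exists_geodesic g)]; exact (hX.exists_geodesic g).choose_spec.2

theorem IsLocalGeod.nil (X : Fin n → G) (k : ℕ) : IsLocalGeod X k [] := by
  intro v hv _
  rw [List.infix_nil] at hv
  simp [hv, IsGeod]

theorem IsLocalGeod.of_infix {X : Fin n → G} {k : ℕ} {u w : Word n} (hw : IsLocalGeod X k w)
    (h : u <:+: w) : IsLocalGeod X k u := fun v hv hk => hw v (hv.trans h) hk

/-- A new short subword ends with the new letter, so it is a suffix of the last `k + 1` letters. As
the reduced word is stored in reverse, these are `x` and the top `k` letters of `B`. -/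
theorem IsLocalGeod.concat {X : Fin n → G} (hX : IsSymmGenerating X) {k : ℕ} {x : Fin n}
    {B : Word n} (hB : IsLocalGeod X (k + 1) B.reverse)
    (hx : IsGeod X ((B.take k).reverse ++ [x])) : IsLocalGeod X (k + 1) (x :: B).reverse := by
  intro v hv hk
  rw [List.reverse_cons, List.infix_concat_iff] at hv
  rcases hv with hv | hv
  · have h1 : (B.take k).reverse ++ [x] <:+ B.reverse ++ [x] := by
      refine ⟨(B.drop k).reverse, ?_⟩
      rw [← List.append_assoc, ← List.reverse_append, List.take_append_drop]
    have h2 : v <:+ (B.take k).reverse ++ [x] := by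
      refine List.suffix_of_suffix_length_le hv h1 ?_
      have h3 := hv.length_le
      simp at h3 ⊢
      omega
    obtain ⟨u, hu⟩ := h2
    refine IsGeod.of_append hX (u := u) (w := []) ?_
    rwa [List.append_nil, hu]
  · exact hB v hv hk

variable (X : Fin n → G) (a d k : ℕ)

open Classical in
/-- One step of the reduction: a letter is added to the reduced word if the subword of length
`k + 1` at its end is still geodesic; otherwise this subword is replaced by a shorter one. -/
noncomputable def reduceStep : Prog (Alph n) (St n a d) :=
  .act (fun j => if j = some .src then 1 else if j = some .red then k else 0) fun s W =>
    let x := (W (some .src)).reduceOption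
    let y := (W (some .red)).reduceOption
    if IsGeod X (y.reverse ++ x) then (s, Mem.stk { red := (x ++ y).map some })
    -- The replacement returns to `src` because it must be checked again against what remains on
    -- `red`.
    else (s, Mem.stk { src := (geo X (eval X (y.reverse ++ x))).map some })

/-- Replaces the word on the stack `src` by a locally geodesic one on the stack `red`. -/
noncomputable def reduce : Prog (Alph n) (St n a d) :=
  .loop (single .src) (fun _ W => (W (some .src)).head?.isSome) (reduceStep X a d k)

theorem reduceOption_map_some {α : Type*} (l : List α) : (l.map some).reduceOption = l := by
  simp [List.reduceOption]

variable {X a d k} in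
theorem run_reduceStep (s : St n a d) (m : Mem n) (x : Fin n) (A B : Word n)
    (hA : m.src = (x :: A).map some) (hB : m.red = B.map some) :
    (IsGeod X ((B.take k).reverse ++ [x]) ∧
      Run (reduceStep X a d k) s m s { m with src := A.map some, red := (x :: B).map some } 1) ∨
    (¬ IsGeod X ((B.take k).reverse ++ [x]) ∧ Run (reduceStep X a d k) s m s
      { m with
        src := (geo X (eval X ((B.take k).reverse ++ [x])) ++ A).map some
        red := (B.drop k).map some } 1) := by
  have e1 : (window (fun j => if j = some .src then 1 else if j = some .red then k else 0) m.stk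
      (some .src)).reduceOption = [x] := by
    simp [window, Mem.stk, hA, List.reduceOption]
  have e2 : (window (fun j => if j = some .src then 1 else if j = some .red then k else 0) m.stk
      (some .red)).reduceOption = B.take k := by
    simp [window, Mem.stk, hB, ← List.map_take, reduceOption_map_some]
  by_cases h : IsGeod X ((B.take k).reverse ++ [x])
  · refine Or.inl ⟨h, Run.act ?_ ?_⟩
    · simp only [e1, e2, h, if_true]
    · simp only [e1, e2, h, if_true]
      rintro (_ | j)
      · rfl
      · cases j <;> simp [Mem.stk, hA, hB]
  · refine Or.inr ⟨h, Run.act ?_ ?_⟩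
    · simp only [e1, e2, h, if_false]
    · simp only [e1, e2, h, if_false]
      rintro (_ | j)
      · rfl
      · cases j <;> simp [Mem.stk, hA, hB]

-- The potential `(k + 2)(|A| + |B|) + |A|` decreases in every step. Accepting a letter lowers `|A|`
-- and keeps the total length. A replacement lowers the total length by at least one and adds fewer
-- than `k` letters to the source, so the time is linear.
variable {X a d k} in
theorem run_reduce_aux (hX : IsSymmGenerating X) (s : St n a d) (φ : ℕ) :
    ∀ (m : Mem n) (A B : Word n), m.src = A.map some → m.red = B.map some →
      IsLocalGeod X (k + 1) B.reverse → (k + 2) * (A.length + B.length) + A.length ≤ φ →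
      ∃ v : Word n, IsLocalGeod X (k + 1) v ∧ eval X v = eval X B.reverse * eval X A ∧
        v.length ≤ A.length + B.length ∧
        Run (reduce X a d k) s m s { m with src := [], red := v.reverse.map some }
          (2 * φ + 1) := by
  induction φ with
  | zero =>
    intro m A B hA hB hl hφ
    obtain rfl : A = [] := List.length_eq_zero_iff.1 (by omega)
    refine ⟨B.reverse, hl, by simp, by simp, ?_⟩
    have : m = { m with src := [], red := B.reverse.reverse.map some } := by
      ext1 <;> simp [hA, hB]
    rw [← this]
    exact Exec.loop_false (by simp [window, single, Mem.stk, hA])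
  | succ φ ih =>
    intro m A B hA hB hl hφ
    cases A with
    | nil =>
      refine ⟨B.reverse, hl, by simp, by simp, ?_⟩
      have : m = { m with src := [], red := B.reverse.reverse.map some } := by
        ext1 <;> simp [hA, hB]
      rw [← this]
      exact (Exec.loop_false (by simp [window, single, Mem.stk, hA])).mono (by omega)
    | cons x A =>
      have hc : (window (single .src) m.stk (some .src)).head?.isSome = true := by
        simp [window, single, Mem.stk, hA]
      simp only [List.length_cons] at hφ
      rcases run_reduceStep (X := X) (k := k) s m x A B hA hB with ⟨hg, hr⟩ | ⟨hg, hr⟩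
      · obtain ⟨v, h1, h2, h3, h4⟩ := ih { m with src := A.map some, red := (x :: B).map some }
          A (x :: B) rfl rfl (hl.concat hX hg)
          (by simp only [List.length_cons]; nlinarith)
        refine ⟨v, h1, ?_, ?_, (Exec.loop_true hc hr h4).mono (by omega)⟩
        · rw [h2]; simp [mul_assoc]
        · simp at h3 ⊢; omega
      · have hlen : (geo X (eval X ((B.take k).reverse ++ [x]))).length ≤ (B.take k).length := by
          have h1 := wordLength_eval_le X ((B.take k).reverse ++ [x])
          have h2 : ¬ wordLength X (eval X ((B.take k).reverse ++ [x])) =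
            ((B.take k).reverse ++ [x]).length := hg
          rw [hX.length_geo]
          simp only [List.length_append, List.length_reverse, List.length_singleton] at h1 h2
          omega
        have hBl : (B.take k).length + (B.drop k).length = B.length := by
          rw [← List.length_append, List.take_append_drop]
        have hk := List.length_take_le k B
        obtain ⟨v, h1, h2, h3, h4⟩ := ih { m with
          src := (geo X (eval X ((B.take k).reverse ++ [x])) ++ A).map some
          red := (B.drop k).map some } _ (B.drop k) rfl rfl
          (hl.of_infix (List.reverse_infix.2 (List.drop_suffix k B).isInfix))
          (by simp only [List.length_append]; nlinarith)
        refine ⟨v, h1, ?_, ?_, (Exec.loop_true hc hr h4).mono (by omega)⟩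
        · rw [h2]
          simp only [eval_append, hX.eval_geo, eval_cons, eval_nil, mul_one]
          rw [← mul_assoc, ← mul_assoc, ← eval_append, ← List.reverse_append,
            List.take_append_drop, mul_assoc]
        · simp only [List.length_append, List.length_cons] at h3 ⊢; omega

variable {X a d k} in
theorem run_reduce (hX : IsSymmGenerating X) (s : St n a d) (m : Mem n) (A : Word n)
    (hA : m.src = A.map some) (hB : m.red = []) :
    ∃ v : Word n, IsLocalGeod X (k + 1) v ∧ eval X v = eval X A ∧ v.length ≤ A.length ∧
      Run (reduce X a d k) s m s { m with src := [], red := v.reverse.map some }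
        (2 * (k + 3) * A.length + 1) := by
  obtain ⟨v, h1, h2, h3, h4⟩ := run_reduce_aux (k := k) hX s ((k + 3) * A.length) m A [] hA
    (by simp [hB]) (IsLocalGeod.nil X _) (by simp; nlinarith)
  exact ⟨v, h1, by simpa using h2, by simpa using h3, h4.mono (by rw [mul_assoc])⟩

end Dehn

/-! ### Conjugation and reduction -/

section Conjugation

variable {G : Type*} [Group G] {n : ℕ}

open Classical in
/-- A letter that represents the inverse of a letter. -/
noncomputable def invLetter (X : Fin n → G) (i : Fin n) : Fin n :=
  if h : ∃ j, X j = (X i)⁻¹ then h.choose else i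

theorem IsSymmGenerating.eval_invLetter {X : Fin n → G} (hX : IsSymmGenerating X) (w : Word n) :
    eval X (w.reverse.map (invLetter X)) = (eval X w)⁻¹ := by
  have key : ∀ i, X (invLetter X i) = (X i)⁻¹ := fun i => by
    rw [invLetter, dif_pos (hX.exists_inv i)]; exact (hX.exists_inv i).choose_spec
  induction w with
  | nil => simp
  | cons a w ih =>
    rw [List.map_reverse] at ih
    simp [ih, key]

theorem reduceOption_encodeInput (A : List (Word n)) : (encodeInput A).reduceOption = A.flatten := by
  induction A with
  | nil => rfl
  | cons w A ih =>
    have : encodeInput (w :: A) = w.map some ++ (none :: encodeInput A) := by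
      simp [encodeInput]
    rw [this, List.reduceOption_append, reduceOption_map_some]
    simp [ih]

theorem eval_flatten (X : Fin n → G) (A : List (Word n)) :
    eval X A.flatten = (A.map (eval X)).prod := by
  induction A with
  | nil => rfl
  | cons w A ih => simp [ih]

theorem flatMap_toList_map_some {α : Type*} (l : List (Option α)) :
    l.flatMap (fun x => x.toList.map some) = l.reduceOption.map some := by
  induction l with
  | nil => rfl
  | cons x l ih => cases x <;> simp [ih]

variable (X : Fin n → G) (a d k : ℕ)

/-- Reduces the conjugate of the word on the stack `seg` by the word on the stack `con`. -/
noncomputable def conjReduce : Prog (Alph n) (St n a d) :=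
  .seq (move .con (fun _ => true) fun x => { tmp := [x], src := [x] })
  (.seq (move .seg (fun _ => true) fun x => { bwd := [x] })
  (.seq (move .bwd (fun _ => true) fun x => { seg := [x], src := x.toList.map some })
  (.seq (move .tmp (fun _ => true) fun x => { con := [x], src := [x.map (invLetter X)] })
  (reduce X a d k))))

-- The source is built from its right end: first `c`, then the segment without separators, then the
-- inverse of `c`. The stacks `con` and `seg` are restored on the way.
variable {X a d k} in
theorem run_conjReduce (hX : IsSymmGenerating X) (s : St n a d) (m : Mem n) (c : Word n)
    (Sg : List (Word n)) (hc : m.con = c.reverse.map some) (hseg : m.seg = encodeInput Sg)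
    (hsrc : m.src = []) (hred : m.red = []) (hbwd : m.bwd = []) (htmp : m.tmp = []) :
    ∃ v : Word n, IsLocalGeod X (k + 1) v ∧
      eval X v = (eval X c)⁻¹ * (Sg.map (eval X)).prod * eval X c ∧
      v.length ≤ 2 * c.length + m.seg.length ∧
      Run (conjReduce X a d k) s m s { m with red := v.reverse.map some }
        ((4 * k + 20) * (c.length + m.seg.length + 1)) := by
  have r1 : Run (σ := St n a d) (move .con (fun _ => true) fun x => { tmp := [x], src := [x] }) s m
      s { m with con := [], tmp := c.map some, src := c.map some } (2 * c.length + 1) := by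
    apply run_move_all
    · intro x; rfl
    · rfl
    · rintro (_ | j) hj
      · simp [Mem.stk]
      · cases j <;> simp_all [Mem.stk]
    · simp [Mem.stk, hc]
  have r2 : Run (σ := St n a d) (move .seg (fun _ => true) fun x => { bwd := [x] }) s
      { m with con := [], tmp := c.map some, src := c.map some } s
      { m with
        con := [], tmp := c.map some, src := c.map some, seg := [], bwd := m.seg.reverse }
      (2 * m.seg.length + 1) := by
    apply run_move_all
    · intro x; rfl
    · rfl
    · rintro (_ | j) hj
      · simp [Mem.stk]
      · cases j <;> simp_all [Mem.stk]
    · simp [Mem.stk]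
  have r3 : Run (σ := St n a d) (move .bwd (fun _ => true)
        fun x => { seg := [x], src := x.toList.map some }) s
      { m with
        con := [], tmp := c.map some, src := c.map some, seg := [], bwd := m.seg.reverse } s
      { m with con := [], tmp := c.map some, src := (Sg.flatten ++ c).map some }
      (2 * m.seg.length + 1) := by
    apply run_move_all
    · intro x; rfl
    · simpa [Mem.stk]
    · rintro (_ | j) hj
      · simp [Mem.stk]
      · cases j <;> simp_all [Mem.stk, flatMap_toList_map_some, reduceOption_encodeInput]
    · simp [Mem.stk]
  have r4 : Run (σ := St n a d) (move .tmp (fun _ => true)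
        fun x => { con := [x], src := [x.map (invLetter X)] }) s
      { m with con := [], tmp := c.map some, src := (Sg.flatten ++ c).map some } s
      { m with src := (c.reverse.map (invLetter X) ++ (Sg.flatten ++ c)).map some }
      (2 * c.length + 1) := by
    apply run_move_all
    · intro x; rfl
    · simpa [Mem.stk]
    · rintro (_ | j) hj
      · simp [Mem.stk]
      · cases j <;> simp_all [Mem.stk]
        rw [← List.map_reverse, List.flatMap_map, ← List.map_reverse]
        simp [← List.map_eq_flatMap]
    · simp [Mem.stk]
  obtain ⟨v, h1, h2, h3, h4⟩ := run_reduce (k := k) hX s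
    { m with src := (c.reverse.map (invLetter X) ++ (Sg.flatten ++ c)).map some } _ rfl hred
  have hlen : (c.reverse.map (invLetter X) ++ (Sg.flatten ++ c)).length ≤
      2 * c.length + m.seg.length := by
    have : Sg.flatten.length ≤ m.seg.length := by
      rw [hseg, ← reduceOption_encodeInput]; exact List.reduceOption_length_le _
    simp only [List.length_append, List.length_map, List.length_reverse]; omega
  refine ⟨v, h1, ?_, h3.trans hlen, ?_⟩
  · rw [h2, eval_append, eval_append, hX.eval_invLetter, eval_flatten, mul_assoc]
  · have e : ({ m with src := [], red := v.reverse.map some } : Mem n) =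
        { m with red := v.reverse.map some } := by rw [← hsrc]
    have r5 := h4
    simp only [e] at r5
    refine (r1.seq (r2.seq (r3.seq (r4.seq r5)))).mono ?_
    nlinarith [Nat.mul_le_mul_left (2 * (k + 3)) hlen]

end Conjugation

/-! ### The search for the middle -/

section SearchProgram

variable {G : Type*} [Group G] {n : ℕ}

/-- A list as a bounded list, if it is short enough. -/
def BList.ofList {α : Type} {N : ℕ} (l : List α) : BList α N :=
  if h : l.length ≤ N then ⟨l, h⟩ else ⟨[], Nat.zero_le N⟩

variable (X : Fin n → G) (h d : ℕ)

/-- The condition for the two sides of the search to advance: `r` letters are read on the right. -/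
def CanAdvance (link p q : Word n) (c r : ℕ) : Prop :=
  stopLength h ≤ c ∧ r ≤ rightStep h ∧
    wordLength X (eval X (q.take r).reverse * eval X link * eval X p) ≤ 8 * h

open Classical in
/-- The number of letters that are read on the right in one step of the search, if it goes on. -/
noncomputable def advance (link p q : Word n) (c : ℕ) : Option ℕ :=
  if H : ∃ r, CanAdvance X h link p q c r then some H.choose else none

/-- The numbers of letters that are read in one step of the search. -/
def searchWindow (j : Option WorkStack) : ℕ :=
  if j = some .fwd then leftStep h else if j = some .bwd then rightStep h
  else if j = some .cnt then stopLength h else 0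

/-- One step of the search for the middle of a word. -/
noncomputable def searchStep : Prog (Alph n) (St n (8 * h) d) :=
  .act (searchWindow h) fun s W =>
    let p := (W (some .fwd)).reduceOption
    let q := (W (some .bwd)).reduceOption
    match advance X h s.link.1 p q (W (some .cnt)).length with
    | some r => ({ s with link := BList.ofList (geo X
          (eval X (q.take r).reverse * eval X s.link.1 * eval X p)) },
        Mem.stk { con := p.reverse.map some, bwd := (q.drop r).map some,
                  cnt := (W (some .cnt)).drop (leftStep h + r) })
    | none => ({ s with go := false }, Mem.stk {})

/-- The two-sided search. -/
noncomputable def searchLoop : Prog (Alph n) (St n (8 * h) d) :=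
  .loop (fun _ => 0) (fun s _ => s.go) (searchStep X h d)

/-- Finds a prefix of the word on the stack `red` that is close to its middle,
if the word represents a torsion element. -/
noncomputable def search : Prog (Alph n) (St n (8 * h) d) :=
  .seq (move .red (fun _ => true) fun x => { fwd := [x], tmp := [x] })
  (.seq (move .tmp (fun _ => true) fun x => { bwd := [x], cnt := [x] })
  (.seq (.act (fun _ => 0) fun s _ => ({ s with go := true }, fun _ => []))
  (.seq (searchLoop X h d)
  (.seq (clear .fwd) (.seq (clear .bwd) (.seq (clear .cnt)
  (.act (fun _ => 0) fun s _ => ({ flag := s.flag, alive := s.alive }, fun _ => []))))))))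

/-- The word `c` is close to the middle of `g`, if `g` is a torsion element. -/
def IsNearMid (X : Fin n → G) (D : ℕ) (g : G) (c : Word n) : Prop :=
  IsOfFinOrder g → ∀ q, IsMid X g q → rdist X (eval X c) q ≤ D

variable {X h d}

theorem exists_advance_eq {link p q : Word n} {c : ℕ} (H : ∃ r, CanAdvance X h link p q c r) :
    ∃ r, advance X h link p q c = some r ∧ CanAdvance X h link p q c r :=
  ⟨H.choose, by rw [advance, dif_pos H], H.choose_spec⟩

/-- The element that joins the two sides changes only by the letters just read, so its short
geodesic word can be updated in the finite control. A window of bounded size on `cnt` tells whether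
`j - i` has reached `stopLength`. -/
theorem run_searchStep (hX : IsSymmGenerating X) (s : St n (8 * h) d) (m : Mem n)
    (w : Word n) {i j : ℕ} (hij : i ≤ j) (hj : j ≤ w.length)
    (hf : m.fwd = (w.drop i).map some) (hb : m.bwd = (w.take j).reverse.map some)
    (hc : m.con = (w.take i).reverse.map some) (hcnt : m.cnt.length = j - i)
    (hlink : eval X s.link.1 = (pre X w j)⁻¹ * eval X w * pre X w i) :
    (∃ l r Cn, i + leftStep h ≤ j - r ∧ Cn.length = j - r - (i + leftStep h) ∧
      eval X l.1 = (pre X w (j - r))⁻¹ * eval X w * pre X w (i + leftStep h) ∧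
      rdist X (eval X w * pre X w (i + leftStep h)) (pre X w (j - r)) ≤ 8 * h ∧
      Run (searchStep X h d) s m { s with link := l }
        { m with
          fwd := (w.drop (i + leftStep h)).map some
          bwd := (w.take (j - r)).reverse.map some
          con := (w.take (i + leftStep h)).reverse.map some
          cnt := Cn } 1) ∨
    (¬ (stopLength h ≤ j - i ∧ ∃ r ≤ rightStep h,
        rdist X (eval X w * pre X w (i + leftStep h)) (pre X w (j - r)) ≤ 8 * h) ∧
      Run (searchStep X h d) s m { s with go := false }
        { m with
          fwd := m.fwd.drop (leftStep h)
          bwd := m.bwd.drop (rightStep h)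
          cnt := m.cnt.drop (stopLength h) } 1) := by
  have hlr : leftStep h + rightStep h ≤ stopLength h := by unfold stopLength; omega
  obtain ⟨p, hp⟩ : ∃ p, p = (w.drop i).take (leftStep h) := ⟨_, rfl⟩
  obtain ⟨q, hq⟩ : ∃ q, q = (w.take j).reverse.take (rightStep h) := ⟨_, rfl⟩
  have ep : (window (searchWindow h) m.stk (some .fwd)).reduceOption = p := by
    have : window (searchWindow h) m.stk (some .fwd) = p.map some := by
      simp only [window, Mem.stk, hf, searchWindow, hp]
      simp
    rw [this, reduceOption_map_some]
  have eq : (window (searchWindow h) m.stk (some .bwd)).reduceOption = q := by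
    have : window (searchWindow h) m.stk (some .bwd) = q.map some := by
      simp only [window, Mem.stk, hb, searchWindow, hq]
      simp
    rw [this, reduceOption_map_some]
  have ec : (window (searchWindow h) m.stk (some .cnt)).length = min (stopLength h) (j - i) := by
    simp [window, Mem.stk, searchWindow, hcnt]
  have key : ∀ r, r ≤ rightStep h → eval X (q.take r).reverse * eval X s.link.1 * eval X p =
      (pre X w (j - r))⁻¹ * eval X w * pre X w (i + leftStep h) := by
    intro r hr
    have e1 : pre X w (i + leftStep h) = pre X w i * eval X p := by
      rw [pre, pre, ← eval_append, hp, List.take_add]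
    have e2 : pre X w j = pre X w (j - r) * eval X (q.take r).reverse := by
      have : (q.take r).reverse = (w.take j).drop (j - r) := by
        rw [hq, List.take_take, min_eq_left hr, List.take_reverse, List.reverse_reverse,
          List.length_take, min_eq_left hj]
      rw [this, pre, pre, ← eval_append]
      conv_lhs => rw [← List.take_append_drop (j - r) (w.take j), List.take_take,
        min_eq_left (Nat.sub_le _ _)]
    rw [hlink, e1, e2]
    group
  have key2 : ∀ r, r ≤ rightStep h → (rdist X (eval X w * pre X w (i + leftStep h))
      (pre X w (j - r)) ≤ 8 * h ↔
      wordLength X (eval X (q.take r).reverse * eval X s.link.1 * eval X p) ≤ 8 * h) := by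
    intro r hr
    rw [key r hr, rdist_comm hX, rdist, wordDist, mul_assoc]
    exact_mod_cast Iff.rfl
  by_cases H : ∃ r, CanAdvance X h s.link.1 p q (min (stopLength h) (j - i)) r
  · left
    obtain ⟨r, hr, hr'⟩ := exists_advance_eq H
    have hrle := hr'.2.1
    have hR : stopLength h ≤ j - i := by have := hr'.1; omega
    have hl : (geo X (eval X (q.take r).reverse * eval X s.link.1 * eval X p)).length ≤ 8 * h := by
      rw [hX.length_geo]; exact hr'.2.2
    refine ⟨BList.ofList (geo X (eval X (q.take r).reverse * eval X s.link.1 * eval X p)), r,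
      m.cnt.drop (leftStep h + r), ?_, ?_, ?_, (key2 r hr'.2.1).2 hr'.2.2, Run.act ?_ ?_⟩
    · omega
    · rw [List.length_drop, hcnt]; omega
    · rw [BList.ofList, dif_pos hl, hX.eval_geo, key r hr'.2.1]
    · simp only [ep, eq, ec, hr]
    · simp only [ep, eq, ec, hr]
      rintro (_ | k)
      · rfl
      · cases k
        case con =>
          simp only [Mem.stk, hc, searchWindow]
          simp only [reduceCtorEq, Option.some.injEq, if_false, List.drop_zero]
          rw [← List.map_append, ← List.reverse_append, hp, ← List.take_add]
        case fwd => simp [Mem.stk, hf, searchWindow, ← List.map_drop]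
        case bwd =>
          simp only [Mem.stk, hb, searchWindow]
          simp only [reduceCtorEq, Option.some.injEq, if_false, if_true]
          have hql : q.length = min (rightStep h) j := by
            rw [hq, List.length_take, List.length_reverse, List.length_take, min_eq_left hj]
          rw [← List.map_drop, ← List.map_append, ← List.drop_append_of_le_length (by omega), hq,
            List.take_append_drop, List.drop_reverse, List.length_take, min_eq_left hj,
            List.take_take, min_eq_left (Nat.sub_le _ _)]
        case cnt =>
          simp only [Mem.stk, searchWindow, window]
          simp only [reduceCtorEq, Option.some.injEq, if_false, if_true]
          rw [← List.drop_append_of_le_length, List.take_append_drop]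
          rw [List.length_take]; omega
        all_goals simp [Mem.stk, searchWindow]
  · right
    have hr : advance X h s.link.1 p q (min (stopLength h) (j - i)) = none := by
      rw [advance, dif_neg H]
    refine ⟨?_, Run.act ?_ ?_⟩
    · rintro ⟨hR, r, hr, hle⟩
      exact H ⟨r, by omega, hr, (key2 r hr).1 hle⟩
    · simp only [ep, eq, ec, hr]
    · simp only [ep, eq, ec, hr]
      rintro (_ | k)
      · rfl
      · cases k <;> simp [Mem.stk, searchWindow]

/-- A successful step reads at least one letter on the left, so the number of steps is linear. If
`g` is torsion, the search cannot fail while `j - i` is large, hence it stops near the middle;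
otherwise nothing is claimed about the prefix. -/
theorem run_searchLoop (hX : IsSymmGenerating X) (H : FourPoint X h) (h1 : 1 ≤ h) (w : Word n)
    (hw : IsLocalGeod X (2 * (4 * h + 1)) w) (N : ℕ) : ∀ (s : St n (8 * h) d) (m : Mem n) (i j : ℕ),
    s.go = true → i ≤ j → j ≤ w.length → j - i ≤ N →
    m.fwd = (w.drop i).map some → m.bwd = (w.take j).reverse.map some →
    m.con = (w.take i).reverse.map some → m.cnt.length = j - i →
    eval X s.link.1 = (pre X w j)⁻¹ * eval X w * pre X w i →
    rdist X (eval X w * pre X w i) (pre X w j) ≤ 8 * h →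
    ∃ l c F B Cn, c.length ≤ w.length ∧ F.length ≤ w.length ∧ B.length ≤ w.length ∧
      Cn.length ≤ w.length ∧ IsNearMid X (stopLength h + 10 * h) (eval X w) c ∧
      Run (searchLoop X h d) s m { s with link := l, go := false }
        { m with con := c.reverse.map some, fwd := F, bwd := B, cnt := Cn } (2 * N + 3) := by
  induction N using Nat.strong_induction_on with
  | _ N ih =>
    intro s m i j hgo hij hj hN hf hb hc hcnt hlink hS
    rcases run_searchStep hX s m w hij hj hf hb hc hcnt hlink with
      ⟨l, r, Cn, e1, e2, e3, e4, e5⟩ | ⟨e1, e2⟩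
    · have hpos := leftStep_pos h
      obtain ⟨l', c, F, B, Cn', f1, f2, f3, f4, f5, f6⟩ := ih (N - 1) (by omega)
        { s with link := l }
        { m with
          fwd := (w.drop (i + leftStep h)).map some
          bwd := (w.take (j - r)).reverse.map some
          con := (w.take (i + leftStep h)).reverse.map some
          cnt := Cn }
        (i + leftStep h) (j - r) hgo e1 (by omega) (by omega) rfl rfl rfl
        e2 e3 e4
      exact ⟨l', c, F, B, Cn', f1, f2, f3, f4, f5,
        (Exec.loop_true hgo e5 f6).mono (by omega)⟩
    · refine ⟨s.link, w.take i, m.fwd.drop (leftStep h), m.bwd.drop (rightStep h),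
        m.cnt.drop (stopLength h), ?_, ?_, ?_, ?_, ?_,
        Run.mono (t := 1 + 1 + 1) (Exec.loop_true (s' := { s with go := false }) hgo ?_
          (Exec.loop_false rfl)) (by omega)⟩
      rotate_left 5
      · rw [← hc]
        exact e2
      · simp
      · simp [hf]
      · simp [hb]
      · simp only [List.length_drop]; omega
      · intro ht q hq
        have hR : j - i < stopLength h := by
          by_contra hcon
          push Not at hcon
          exact e1 ⟨hcon, hw.exists_search_step hX H h1 ht hij hj hS hcon⟩
        have := hw.rdist_isMid_le hX H h1 hij hj hS hR hq
        push_cast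
        exact this

theorem run_search (hX : IsSymmGenerating X) (H : FourPoint X h) (h1 : 1 ≤ h) (w : Word n)
    (hw : IsLocalGeod X (2 * (4 * h + 1)) w) (f : Bool) (U : Set (BList (Fin n) d)) (m : Mem n)
    (hred : m.red = w.reverse.map some) (hcon : m.con = []) (hfwd : m.fwd = [])
    (hbwd : m.bwd = []) (hcnt : m.cnt = []) (htmp : m.tmp = []) :
    ∃ c : Word n, c.length ≤ w.length ∧ IsNearMid X (stopLength h + 10 * h) (eval X w) c ∧
      Run (search X h d) { flag := f, alive := U } m { flag := f, alive := U }
        { m with con := c.reverse.map some, red := [] } (20 * (w.length + 1)) := by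
  have r1 : Run (σ := St n (8 * h) d)
      (move .red (fun _ => true) fun x => { fwd := [x], tmp := [x] })
      { flag := f, alive := U } m { flag := f, alive := U }
      { m with red := [], fwd := w.map some, tmp := w.map some } (2 * w.length + 1) := by
    apply run_move_all
    · intro x; rfl
    · rfl
    · rintro (_ | j) hj
      · simp [Mem.stk]
      · cases j <;> simp_all [Mem.stk]
    · simp [Mem.stk, hred]
  have r2 : Run (σ := St n (8 * h) d)
      (move .tmp (fun _ => true) fun x => { bwd := [x], cnt := [x] })
      { flag := f, alive := U } { m with red := [], fwd := w.map some, tmp := w.map some }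
      { flag := f, alive := U }
      { m with
        red := [], fwd := w.map some, bwd := w.reverse.map some, cnt := w.reverse.map some }
      (2 * w.length + 1) := by
    apply run_move_all
    · intro x; rfl
    · simpa [Mem.stk]
    · rintro (_ | j) hj
      · simp [Mem.stk]
      · cases j <;> simp_all [Mem.stk]
    · simp [Mem.stk]
  have r3 : Run (σ := St n (8 * h) d) (.act (fun _ => 0) fun s _ => ({ s with go := true }, fun _ => []))
      { flag := f, alive := U }
      { m with
        red := [], fwd := w.map some, bwd := w.reverse.map some, cnt := w.reverse.map some }
      { flag := f, alive := U, go := true }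
      { m with
        red := [], fwd := w.map some, bwd := w.reverse.map some, cnt := w.reverse.map some } 1 :=
    Run.act rfl (fun _ => rfl)
  -- At the start `i = 0` and `j` is the full length: both sides are at `g`, so the joining word is
  -- empty.
  obtain ⟨l, c, F, B, Cn, f1, f2, f3, f4, f5, f6⟩ := run_searchLoop hX H h1 w hw w.length
    { flag := f, alive := U, go := true }
    { m with
      red := [], fwd := w.map some, bwd := w.reverse.map some, cnt := w.reverse.map some }
    0 w.length rfl (Nat.zero_le _) le_rfl le_rfl (by simp) (by simp) (by simp [hcon]) (by simp)
    (by simp [pre_zero, pre_length]) (by simp [pre_zero, pre_length, rdist_self])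
  refine ⟨c, f1, f5, ?_⟩
  have r4 : Run (σ := St n (8 * h) d) (clear .fwd) { flag := f, alive := U, link := l }
      { m with red := [], con := c.reverse.map some, fwd := F, bwd := B, cnt := Cn }
      { flag := f, alive := U, link := l }
      { m with red := [], con := c.reverse.map some, bwd := B, cnt := Cn } (2 * w.length + 1) := by
    apply run_clear
    · simpa [Mem.stk]
    · rintro (_ | j) hj
      · rfl
      · cases j <;> simp_all [Mem.stk]
    · simpa [Mem.stk] using f2
  have r5 : Run (σ := St n (8 * h) d) (clear .bwd) { flag := f, alive := U, link := l }
      { m with red := [], con := c.reverse.map some, bwd := B, cnt := Cn }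
      { flag := f, alive := U, link := l }
      { m with red := [], con := c.reverse.map some, cnt := Cn } (2 * w.length + 1) := by
    apply run_clear
    · simpa [Mem.stk]
    · rintro (_ | j) hj
      · rfl
      · cases j <;> simp_all [Mem.stk]
    · simpa [Mem.stk] using f3
  have r6 : Run (σ := St n (8 * h) d) (clear .cnt) { flag := f, alive := U, link := l }
      { m with red := [], con := c.reverse.map some, cnt := Cn }
      { flag := f, alive := U, link := l }
      { m with red := [], con := c.reverse.map some } (2 * w.length + 1) := by
    apply run_clear
    · simpa [Mem.stk]
    · rintro (_ | j) hj
      · rfl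
      · cases j <;> simp_all [Mem.stk]
    · simpa [Mem.stk] using f4
  have r7 : Run (σ := St n (8 * h) d)
      (.act (fun _ => 0) fun s _ => ({ flag := s.flag, alive := s.alive }, fun _ => []))
      { flag := f, alive := U, link := l } { m with red := [], con := c.reverse.map some }
      { flag := f, alive := U } { m with red := [], con := c.reverse.map some } 1 :=
    Run.act rfl (fun _ => rfl)
  exact (r1.seq (r2.seq (r3.seq (f6.seq (r4.seq (r5.seq (r6.seq r7))))))).mono (by omega)

end SearchProgram

/-! ### Testing the segments of the input -/

section Segments

variable {G : Type*} [Group G] {n : ℕ}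

theorem encodeInput_append (A B : List (Word n)) :
    encodeInput (A ++ B) = encodeInput A ++ encodeInput B := List.flatMap_append

theorem encodeInput_cons (w : Word n) (A : List (Word n)) :
    encodeInput (w :: A) = w.map some ++ none :: encodeInput A := by simp [encodeInput]

theorem encodeInput_nil : encodeInput ([] : List (Word n)) = [] := rfl

theorem encodeInput_eq_nil {A : List (Word n)} : encodeInput A = [] ↔ A = [] := by
  cases A <;> simp [encodeInput_nil, encodeInput_cons]

/-- Moving a word letter by letter stops at the separator that ends the preceding word. -/
theorem head_reverse_encodeInput (A : List (Word n)) :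
    (encodeInput A).reverse.head?.any Option.isSome = false := by
  induction A using List.reverseRecOn with
  | nil => rfl
  | append_singleton A w _ => simp [encodeInput_append, encodeInput_cons, encodeInput_nil]

theorem reverse_encodeInput_concat (A : List (Word n)) (w : Word n) :
    (encodeInput (A ++ [w])).reverse = none :: (w.reverse.map some ++ (encodeInput A).reverse) := by
  simp [encodeInput_append, encodeInput_cons, encodeInput_nil]

/-- The product of a list of words. -/
def wprod (X : Fin n → G) (A : List (Word n)) : G := (A.map (eval X)).prod

/-- The bound on the distance between a candidate and the middle. -/
def nearBound (h : ℕ) : ℕ := stopLength h + 10 * h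

/-- The bound on the lengths of the reduced conjugates of torsion elements. -/
def conjBound (h : ℕ) : ℕ := (4 * h + 1) * (2 * nearBound h + 40 * h + 1)

/-- The middle moves by at most `6h`, and `c` is within `D` of it before and after the translation.
-/
theorem IsNearMid.wordLength_le {X : Fin n → G} (hX : IsSymmGenerating X) {h : ℕ} (h1 : 1 ≤ h)
    (H : FourPoint X h) {D : ℕ} {g : G} {c : Word n} (hc : IsNearMid X D g c)
    (hg : IsOfFinOrder g) : wordLength X ((eval X c)⁻¹ * g * eval X c) ≤ 2 * D + 6 * h := by
  obtain ⟨q, hq⟩ := exists_isMid hX g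
  have h2 := hc hg q hq
  have h3 := IsMid.rdist_mul_le hX (h := (h : ℝ)) (by exact_mod_cast h1) H hg hq
  have h4 := rdist_triangle hX (eval X c) q (g * eval X c)
  have h5 := rdist_triangle hX q (g * q) (g * eval X c)
  rw [rdist_mul_left, rdist_comm hX q (eval X c)] at h5
  have h6 : (wordLength X ((eval X c)⁻¹ * g * eval X c) : ℝ) = rdist X (eval X c) (g * eval X c) := by
    rw [rdist, wordDist, mul_assoc]
  have : (wordLength X ((eval X c)⁻¹ * g * eval X c) : ℝ) ≤ 2 * D + 6 * h := by
    rw [h6]; linarith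
  exact_mod_cast this

variable (X : Fin n → G) (h d : ℕ)

/-- Moves one word from the stack `left`. -/
def moveWord {σ : Type} (f : Option (Fin n) → Mem n) : Prog (Alph n) σ :=
  .seq (.act (single .left) fun s W => (s, fun j => (W (some .left)).flatMap fun x => (f x).stk j))
    (move .left Option.isSome f)

/-- The program that does nothing. -/
def skip {σ : Type} : Prog (Alph n) σ := .act (fun _ => 0) fun s _ => (s, fun _ => [])

open Classical in
/-- Tests if the short word on the stack `red` represents a torsion element. -/
noncomputable def check : Prog (Alph n) (St n (8 * h) d) :=
  .act (fun j => if j = some .red then conjBound h + 1 else 0) fun s W =>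
    let v := (W (some .red)).reduceOption.reverse
    ({ s with flag := decide ¬ (v.length ≤ conjBound h ∧ IsOfFinOrder (eval X v)) }, W)

/-- Puts the word on the stack `con` on the list of candidates. -/
def saveCand : Prog (Alph n) (St n (8 * h) d) :=
  .ite (single .inp) (fun _ W => (W (some .inp)).isEmpty)
    (.seq (.act (fun _ => 0) fun s _ => (s, Mem.stk { cands := [none] }))
      (move .con (fun _ => true) fun x => { cands := [x] })) skip

/-- Tests if the segment on the stack `seg` represents a torsion element. -/
noncomputable def testSegment : Prog (Alph n) (St n (8 * h) d) :=
  .seq (clear .con)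
  (.seq (conjReduce X (8 * h) d (8 * h + 1))
  (.seq (search X h d)
  (.seq (conjReduce X (8 * h) d (8 * h + 1))
  (.seq (check X h d)
  (.seq (clear .red) (saveCand h d))))))

/-- Tests the segments that end with the last word on the stack `left`. -/
noncomputable def testSuffixes : Prog (Alph n) (St n (8 * h) d) :=
  .loop (single .left) (fun s W => !s.flag && !(W (some .left)).isEmpty)
    (.seq (moveWord fun x => { seg := [x] }) (testSegment X h d))

/-- Tests all segments. -/
noncomputable def testAll : Prog (Alph n) (St n (8 * h) d) :=
  .loop (single .left) (fun s W => !s.flag && !(W (some .left)).isEmpty)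
    (.seq (testSuffixes X h d)
      (.ite (fun _ => 0) (fun s _ => s.flag) skip
        (.seq (move .seg (fun _ => true) fun x => { left := [x] })
          (moveWord fun x => { inp := [x] }))))

variable {X h d}

theorem run_moveWord_seg {σ : Type} (s : σ) (m : Mem n) (A : List (Word n)) (w : Word n)
    (hm : m.left = (encodeInput (A ++ [w])).reverse) :
    Run (moveWord fun x => { seg := [x] }) s m s
      { m with left := (encodeInput A).reverse, seg := w.map some ++ none :: m.seg }
      (2 * w.length + 2) := by
  rw [reverse_encodeInput_concat] at hm
  have r1 : Run (.act (single .left) fun s W => (s, fun j =>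
      (W (some .left)).flatMap fun x => Mem.stk { seg := [x] } j)) s m s
      { m with left := w.reverse.map some ++ (encodeInput A).reverse, seg := none :: m.seg } 1 := by
    refine Run.act rfl ?_
    rintro (_ | j)
    · simp [window, single, Mem.stk, hm]
    · cases j <;> simp [window, single, Mem.stk, hm]
  refine (r1.seq (run_move _ _ _ (fun _ => rfl) s (w.reverse.map some) (encodeInput A).reverse ?_
    (head_reverse_encodeInput A) _ _ rfl rfl ?_ (t := 2 * w.length + 1) (by simp))).mono (by omega)
  · simp
  · rintro (_ | j) hj
    · simp [Mem.stk]
    · cases j <;> simp_all [Mem.stk]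

theorem run_moveWord_inp {σ : Type} (s : σ) (m : Mem n) (A : List (Word n)) (w : Word n)
    (hm : m.left = (encodeInput (A ++ [w])).reverse) :
    Run (moveWord fun x => { inp := [x] }) s m s
      { m with left := (encodeInput A).reverse, inp := w.map some ++ none :: m.inp }
      (2 * w.length + 2) := by
  rw [reverse_encodeInput_concat] at hm
  have r1 : Run (.act (single .left) fun s W => (s, fun j =>
      (W (some .left)).flatMap fun x => Mem.stk { inp := [x] } j)) s m s
      { m with left := w.reverse.map some ++ (encodeInput A).reverse, inp := none :: m.inp } 1 := by
    refine Run.act rfl ?_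
    rintro (_ | j)
    · simp [window, single, Mem.stk, hm]
    · cases j <;> simp [window, single, Mem.stk, hm]
  refine (r1.seq (run_move _ _ _ (fun _ => rfl) s (w.reverse.map some) (encodeInput A).reverse ?_
    (head_reverse_encodeInput A) _ _ rfl rfl ?_ (t := 2 * w.length + 1) (by simp))).mono (by omega)
  · simp
  · rintro (_ | j) hj
    · simp [Mem.stk]
    · cases j <;> simp_all [Mem.stk]

theorem run_skip {σ : Type} (s : σ) (m : Mem n) : Run skip s m s m 1 := Run.act rfl fun _ => rfl

-- A window of `conjBound h + 1` letters tells whether the word is too long. If not, the whole word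
-- is visible, and its order is looked up in a finite table.
open Classical in
theorem run_check (s : St n (8 * h) d) (m : Mem n) (v : Word n)
    (hm : m.red = v.reverse.map some) : Run (check X h d) s m
      { s with flag := decide ¬ (v.length ≤ conjBound h ∧ IsOfFinOrder (eval X v)) } m 1 := by
  refine Run.act ?_ ?_
  · have e : (window (fun j => if j = some .red then conjBound h + 1 else 0) m.stk
        (some .red)).reduceOption.reverse = (v.reverse.take (conjBound h + 1)).reverse := by
      simp [window, Mem.stk, hm, ← List.map_take, reduceOption_map_some, -List.map_reverse]
    simp only [e]
    congr 3
    by_cases hv : v.length ≤ conjBound h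
    · rw [List.take_of_length_le (by simp; omega), List.reverse_reverse]
    · have : ¬ (v.reverse.take (conjBound h + 1)).reverse.length ≤ conjBound h := by
        simp; omega
      simp only [hv, this, false_and]
  · intro j
    exact List.take_append_drop _ _

/-- The stack `inp` is empty exactly when the segment ends with the last word of the input; only
final segments contribute candidates. -/
theorem run_saveCand (s : St n (8 * h) d) (m : Mem n) (c : Word n)
    (hm : m.con = c.reverse.map some) : ∃ C Cs, (m.inp = [] → Cs = [c]) ∧
      (m.inp ≠ [] → Cs = []) ∧ C.length ≤ c.length ∧
      Run (saveCand h d) s m s { m with con := C, cands := encodeInput Cs ++ m.cands }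
        (2 * c.length + 3) := by
  by_cases hi : m.inp = []
  · refine ⟨[], [c], fun _ => rfl, fun hh => absurd hi hh, Nat.zero_le _, ?_⟩
    have r1 : Run (σ := St n (8 * h) d)
        (.act (fun _ => 0) fun s _ => (s, Mem.stk { cands := [none] })) s m s
        { m with cands := none :: m.cands } 1 := by
      refine Run.act rfl ?_
      rintro (_ | j)
      · rfl
      · cases j <;> simp [Mem.stk]
    have r2 : Run (σ := St n (8 * h) d) (move .con (fun _ => true) fun x => { cands := [x] }) s
        { m with cands := none :: m.cands } s
        { m with con := [], cands := encodeInput [c] ++ m.cands } (2 * c.length + 1) := by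
      apply run_move_all
      · intro x; rfl
      · rfl
      · rintro (_ | j) hj
        · simp [Mem.stk]
        · cases j <;> simp_all [Mem.stk, encodeInput_cons, encodeInput_nil]
      · simp [Mem.stk, hm]
    exact (Exec.ite_true (by simp [window, single, Mem.stk, hi]) (r1.seq r2)).mono (by omega)
  · refine ⟨m.con, [], fun hh => absurd hh hi, fun _ => rfl, by simp [hm], ?_⟩
    refine (Exec.ite_false ?_ (run_skip s m)).mono (by omega)
    obtain ⟨x, l, hx⟩ := List.exists_cons_of_ne_nil hi
    simp [window, single, Mem.stk, hx]

-- The conjugate has the same order as the segment, so a positive answer is always right.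
-- Conversely, for a torsion element the conjugate has bounded length in `G`, and its local geodesic
-- word is then bounded too, so the table covers it.
open Classical in
theorem run_testSegment (hX : IsSymmGenerating X) (H : FourPoint X h) (h1 : 1 ≤ h)
    (U : Set (BList (Fin n) d)) (m : Mem n) (Sg : List (Word n)) {N : ℕ}
    (hseg : m.seg = encodeInput Sg) (hN : m.seg.length ≤ N) (hcN : m.con.length ≤ N)
    (hsrc : m.src = []) (hred : m.red = []) (hfwd : m.fwd = []) (hbwd : m.bwd = [])
    (hcnt : m.cnt = []) (htmp : m.tmp = []) (f : Bool) :
    ∃ (C : List (Option (Fin n))) (c : Word n) (Cs : List (Word n)), c.length ≤ N ∧ C.length ≤ N ∧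
      IsNearMid X (nearBound h) (wprod X Sg) c ∧
      (m.inp = [] → Cs = [c]) ∧ (m.inp ≠ [] → Cs = []) ∧
      Run (testSegment X h d) { flag := f, alive := U } m
        { flag := decide ¬ IsOfFinOrder (wprod X Sg), alive := U }
        { m with con := C, cands := encodeInput Cs ++ m.cands } ((96 * h + 140) * (N + 1)) := by
  have r1 : Run (σ := St n (8 * h) d) (clear .con) { flag := f, alive := U } m
      { flag := f, alive := U } { m with con := [] } (2 * N + 1) := by
    apply run_clear
    · rfl
    · rintro (_ | j) hj
      · rfl
      · cases j <;> simp_all [Mem.stk]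
    · simpa [Mem.stk] using hcN
  obtain ⟨v, hv1, hv2, hv3, r2⟩ := run_conjReduce (k := 8 * h + 1) hX
    ({ flag := f, alive := U } : St n (8 * h) d) { m with con := [] } [] Sg rfl hseg hsrc hred
    hbwd htmp
  have hk : 8 * h + 1 + 1 = 2 * (4 * h + 1) := by ring
  rw [hk] at hv1
  have hvg : eval X v = wprod X Sg := by rw [hv2]; simp [wprod]
  have hvN : v.length ≤ N := by
    simp only [List.length_nil] at hv3; omega
  obtain ⟨c, hc1, hc2, r3⟩ := run_search (d := d) hX H h1 v hv1 f U
    { m with con := [], red := v.reverse.map some } rfl rfl hfwd hbwd hcnt htmp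
  rw [hvg] at hc2
  obtain ⟨v', hw1, hw2, hw3, r4⟩ := run_conjReduce (k := 8 * h + 1) hX
    ({ flag := f, alive := U } : St n (8 * h) d) { m with con := c.reverse.map some, red := [] } c
    Sg rfl hseg hsrc rfl hbwd htmp
  rw [hk] at hw1
  have r5 := run_check (X := X) ({ flag := f, alive := U } : St n (8 * h) d)
    { m with con := c.reverse.map some, red := v'.reverse.map some } v' rfl
  have key : (v'.length ≤ conjBound h ∧ IsOfFinOrder (eval X v')) ↔
      IsOfFinOrder (wprod X Sg) := by
    have e : IsOfFinOrder (eval X v') ↔ IsOfFinOrder (wprod X Sg) := by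
      rw [hw2]
      have : IsConj _ _ := (isConj_iff (a := wprod X Sg) (b := (eval X c)⁻¹ * wprod X Sg * eval X c)).2
        ⟨(eval X c)⁻¹, by simp⟩
      exact ⟨this.symm.isOfFinOrder, this.isOfFinOrder⟩
    rw [e]
    refine ⟨fun hh => hh.2, fun hh => ⟨?_, hh⟩⟩
    have h2 := IsNearMid.wordLength_le hX h1 H hc2 hh
    refine hw1.length_le hX H rfl (2 * nearBound h + 40 * h) ?_
    rw [hw2]
    -- Only `6h` is needed here; `conjBound` allows `40h` because the test of the candidates uses
    -- the same bound.
    exact h2.trans (by unfold nearBound; omega)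
  simp only [key] at r5
  have r6 : Run (σ := St n (8 * h) d) (clear .red)
      { flag := decide ¬ IsOfFinOrder (wprod X Sg), alive := U }
      { m with con := c.reverse.map some, red := v'.reverse.map some }
      { flag := decide ¬ IsOfFinOrder (wprod X Sg), alive := U }
      { m with con := c.reverse.map some } (2 * v'.length + 1) := by
    apply run_clear
    · simpa [Mem.stk]
    · rintro (_ | j) hj
      · rfl
      · cases j <;> simp_all [Mem.stk]
    · simp [Mem.stk]
  obtain ⟨C, Cs, e1, e2, e3, r7⟩ := run_saveCand (h := h) (d := d)
    { flag := decide ¬ IsOfFinOrder (wprod X Sg), alive := U } { m with con := c.reverse.map some }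
    c rfl
  refine ⟨C, c, Cs, by omega, by omega, hc2, e1, e2, ?_⟩
  refine (r1.seq (r2.seq (r3.seq (r4.seq (r5.seq (r6.seq r7)))))).mono ?_
  have hs2 : c.length + m.seg.length + 1 ≤ 2 * (N + 1) := by omega
  have hs1 : List.length ([] : Word n) + m.seg.length + 1 ≤ N + 1 := by simp; omega
  have t1 := Nat.mul_le_mul_left (4 * (8 * h + 1) + 20) hs1
  have t2 := Nat.mul_le_mul_left (4 * (8 * h + 1) + 20) hs2
  dsimp only at t1 t2 hw3 ⊢
  nlinarith

end Segments

/-! ### The loops over all segments. -/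

section Loops

variable {G : Type*} [Group G] {n : ℕ} {X : Fin n → G} {h d : ℕ}

/-- The auxiliary stacks are empty. -/
structure Mem.Idle (m : Mem n) : Prop where
  src : m.src = []
  red : m.red = []
  fwd : m.fwd = []
  bwd : m.bwd = []
  cnt : m.cnt = []
  tmp : m.tmp = []

/-- The words in the list have length at most `N`. -/
def AllShort (N : ℕ) (Cs : List (Word n)) : Prop := ∀ c ∈ Cs, c.length ≤ N

/-- The segment grows to the left, one word at a time. On failure of the test the loop stops with
the position intact, so that the indices can be read from the stacks. -/
theorem run_testSuffixes (hX : IsSymmGenerating X) (H : FourPoint X h) (h1 : 1 ≤ h) {N : ℕ}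
    (U : Set (BList (Fin n) d)) (A : List (Word n)) : ∀ (m : Mem n) (Sg : List (Word n)),
    m.Idle → m.left = (encodeInput A).reverse → m.seg = encodeInput Sg → m.con.length ≤ N →
    (encodeInput (A ++ Sg)).length ≤ N →
    ∃ (F : Bool) (A' T Cs : List (Word n)) (C : List (Option (Fin n))), A = A' ++ T ∧
      C.length ≤ N ∧ Cs.length ≤ A.length ∧ AllShort N Cs ∧ (m.inp ≠ [] → Cs = []) ∧
      (F = true → T ≠ [] ∧ ¬ IsOfFinOrder (wprod X (T ++ Sg))) ∧
      (F = false → A' = [] ∧ ∀ T', T' <:+ A → T' ≠ [] → IsOfFinOrder (wprod X (T' ++ Sg)) ∧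
        (m.inp = [] → ∃ c ∈ Cs, IsNearMid X (nearBound h) (wprod X (T' ++ Sg)) c)) ∧
      Run (testSuffixes X h d) { flag := false, alive := U } m { flag := F, alive := U }
        { m with
          left := (encodeInput A').reverse
          seg := encodeInput (T ++ Sg)
          con := C
          cands := encodeInput Cs ++ m.cands } (A.length * ((96 * h + 150) * (N + 1)) + 1) := by
  classical
  induction A using List.reverseRecOn with
  | nil =>
    intro m Sg hi hl hs hc hN
    refine ⟨false, [], [], [], m.con, rfl, hc, le_rfl, by simp [AllShort], fun _ => rfl, by simp,
      fun _ => ⟨rfl, fun T' hT hT' => absurd (List.suffix_nil.1 hT) hT'⟩, ?_⟩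
    have : ({ m with
          left := (encodeInput ([] : List (Word n))).reverse
          seg := encodeInput ([] ++ Sg)
          con := m.con
          cands := encodeInput [] ++ m.cands } : Mem n) = m := by
      ext1 <;> simp [hl, hs, encodeInput_nil]
    rw [this]
    exact (Exec.loop_false (by simp [window, single, Mem.stk, hl, encodeInput_nil])).mono (by omega)
  | append_singleton A w ih =>
    intro m Sg hi hl hs hc hN
    have hcond : (fun (s : St n (8 * h) d) (W : ∀ k, List (Alph n k)) =>
        !s.flag && !(W (some .left)).isEmpty) { flag := false, alive := U }
        (window (single .left) m.stk) = true := by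
      simp [window, single, Mem.stk, hl, reverse_encodeInput_concat]
    have r1 := run_moveWord_seg ({ flag := false, alive := U } : St n (8 * h) d) m A w hl
    have hseg : w.map some ++ none :: m.seg = encodeInput (w :: Sg) := by
      rw [hs, encodeInput_cons]
    rw [hseg] at r1
    have hlen : (encodeInput (A ++ w :: Sg)).length ≤ N := by simpa using hN
    have hlen' : (encodeInput (w :: Sg)).length ≤ N := by
      rw [encodeInput_append, List.length_append] at hlen; omega
    have hw : w.length + 1 ≤ N := by
      rw [encodeInput_cons] at hlen'; simp at hlen'; omega
    obtain ⟨C, c, Cs, hc1, hC, hc2, hc3, hc4, r2⟩ := run_testSegment (d := d) hX H h1 U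
      { m with left := (encodeInput A).reverse, seg := encodeInput (w :: Sg) } (w :: Sg) rfl hlen'
      hc hi.src hi.red hi.fwd hi.bwd hi.cnt hi.tmp false
    have hCs : AllShort N Cs ∧ Cs.length ≤ 1 := by
      by_cases hinp : m.inp = []
      · rw [hc3 hinp]; simpa [AllShort] using hc1
      · rw [hc4 hinp]; simp [AllShort]
    have hr := r1.seq r2
    by_cases ht : IsOfFinOrder (wprod X (w :: Sg))
    · obtain ⟨F, A', T, Cs', C', e1, e2, e3, e4, e5, e6, e7, r3⟩ := ih
        { m with
          left := (encodeInput A).reverse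
          seg := encodeInput (w :: Sg)
          con := C
          cands := encodeInput Cs ++ m.cands } (w :: Sg)
        ⟨hi.src, hi.red, hi.fwd, hi.bwd, hi.cnt, hi.tmp⟩ rfl rfl hC hlen
      refine ⟨F, A', T ++ [w], Cs' ++ Cs, C', by simp [e1], e2, ?_, ?_, ?_, ?_, ?_, ?_⟩
      · simp; omega
      · intro x hx
        rcases List.mem_append.1 hx with hx | hx
        · exact e4 x hx
        · exact hCs.1 x hx
      · intro hinp; rw [e5 hinp, hc4 hinp]; rfl
      · intro hF; exact ⟨by simp, by simpa using (e6 hF).2⟩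
      · intro hF
        refine ⟨(e7 hF).1, fun T' hT hT' => ?_⟩
        rcases List.suffix_concat_iff.1 hT with rfl | ⟨T₁, rfl, hT₁⟩
        · exact absurd rfl hT'
        rw [List.append_assoc]
        by_cases hne : T₁ = []
        · subst hne
          exact ⟨ht, fun hinp => ⟨c, by simp [hc3 hinp], hc2⟩⟩
        · obtain ⟨f1, f2⟩ := (e7 hF).2 T₁ hT₁ hne
          refine ⟨f1, fun hinp => ?_⟩
          obtain ⟨x, hx, hx'⟩ := f2 hinp
          exact ⟨x, by simp [hx], hx'⟩
      · have hfl : decide (¬ IsOfFinOrder (wprod X (w :: Sg))) = false := by simpa using ht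
        rw [hfl] at hr
        have e : T ++ [w] ++ Sg = T ++ w :: Sg := by simp
        rw [e, encodeInput_append Cs' Cs, List.append_assoc (encodeInput Cs')]
        refine (Exec.loop_true hcond hr r3).mono ?_
        rw [List.length_append, List.length_singleton, add_mul]
        nlinarith
    · refine ⟨true, A, [w], Cs, C, rfl, hC, by simp; omega, hCs.1, hc4, fun _ => ⟨by simp, ht⟩,
        by simp, ?_⟩
      have hfl : decide (¬ IsOfFinOrder (wprod X (w :: Sg))) = true := by simpa using ht
      rw [hfl] at hr
      refine (Exec.loop_true hcond hr (Exec.loop_false (by simp))).mono ?_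
      rw [List.length_append, List.length_singleton, add_mul]
      nlinarith [Nat.zero_le (A.length * ((96 * h + 150) * (N + 1)))]

theorem run_moveBack {σ : Type} (s : σ) (m m' : Mem n) (hl : m.left = [])
    (hm' : m' = { m with left := m.seg.reverse, seg := m'.seg }) (hs : m'.seg = []) :
    Run (move .seg (fun _ => true) fun x => { left := [x] }) s m s m' (2 * m.seg.length + 1) := by
  rw [hs] at hm'
  subst hm'
  apply run_move_all
  · intro x; rfl
  · rfl
  · rintro (_ | j) hj
    · simp [Mem.stk]
    · cases j <;> simp_all [Mem.stk]
  · rfl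

/-- The last word of `left` is dropped after each round: a segment either ends with this word or
lies in the rest. Candidates arise only in the round with `R = []`. -/
theorem run_testAll (hX : IsSymmGenerating X) (H : FourPoint X h) (h1 : 1 ≤ h) {N M : ℕ}
    (U : Set (BList (Fin n) d)) (A : List (Word n)) : ∀ (m : Mem n) (R : List (Word n)),
    m.Idle → m.left = (encodeInput A).reverse → m.seg = [] → m.inp = encodeInput R →
    m.con.length ≤ N → (encodeInput A).length ≤ N → A.length ≤ M →
    ∃ (F : Bool) (A' T R' Cs : List (Word n)) (C : List (Option (Fin n))),
      A ++ R = A' ++ T ++ R' ∧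
      C.length ≤ N ∧ Cs.length ≤ A.length ∧ AllShort N Cs ∧ (R ≠ [] → Cs = []) ∧
      (F = true → T ≠ [] ∧ ¬ IsOfFinOrder (wprod X T)) ∧
      (F = false → A' = [] ∧ T = [] ∧ (∀ T', T' <:+: A → T' ≠ [] → IsOfFinOrder (wprod X T')) ∧
        (R = [] → ∀ T', T' <:+ A → T' ≠ [] →
          ∃ c ∈ Cs, IsNearMid X (nearBound h) (wprod X T') c)) ∧
      Run (testAll X h d) { flag := false, alive := U } m { flag := F, alive := U }
        { m with
          inp := encodeInput R'
          left := (encodeInput A').reverse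
          seg := encodeInput T
          con := C
          cands := encodeInput Cs ++ m.cands }
        (A.length * ((M + 1) * ((96 * h + 160) * (N + 1))) + 1) := by
  induction A using List.reverseRecOn with
  | nil =>
    intro m R hi hl hs hinp hc hN hM
    refine ⟨false, [], [], R, [], m.con, rfl, hc, le_rfl, by simp [AllShort], fun _ => rfl, by simp,
      fun _ => ⟨rfl, rfl, fun T' hT hT' => absurd (List.infix_nil.1 hT) hT',
        fun _ T' hT hT' => absurd (List.suffix_nil.1 hT) hT'⟩, ?_⟩
    have : ({ m with
          inp := encodeInput R
          left := (encodeInput ([] : List (Word n))).reverse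
          seg := encodeInput []
          con := m.con
          cands := encodeInput [] ++ m.cands } : Mem n) = m := by
      ext1 <;> simp [hl, hs, hinp, encodeInput_nil]
    rw [this]
    exact (Exec.loop_false (by simp [window, single, Mem.stk, hl, encodeInput_nil])).mono (by omega)
  | append_singleton A w ih =>
    intro m R hi hl hs hinp hc hN hM
    have hcond : (fun (s : St n (8 * h) d) (W : ∀ k, List (Alph n k)) =>
        !s.flag && !(W (some .left)).isEmpty) { flag := false, alive := U }
        (window (single .left) m.stk) = true := by
      simp [window, single, Mem.stk, hl, reverse_encodeInput_concat]
    obtain ⟨F, A', T, Cs, C, e1, e2, e3, e4, e5, e6, e7, r1⟩ := run_testSuffixes (d := d) hX H h1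
      U (A ++ [w]) m [] hi hl hs hc (by simpa using hN)
    simp only [List.append_nil] at r1 e6 e7
    have hR : R ≠ [] → Cs = [] := fun hR => e5 (by rw [hinp, Ne, encodeInput_eq_nil]; exact hR)
    have hwN : w.length + 1 ≤ N := by
      rw [encodeInput_append, encodeInput_cons] at hN; simp at hN; omega
    have hAN : (encodeInput A).length ≤ N := by
      rw [encodeInput_append, List.length_append] at hN; omega
    have hT1 : (A ++ [w]).length * ((96 * h + 150) * (N + 1)) ≤
        M * ((96 * h + 150) * (N + 1)) := Nat.mul_le_mul_right _ hM
    rw [List.length_append, List.length_singleton] at hT1 hM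
    rcases F with _ | _
    · obtain ⟨rfl, f2⟩ := e7 rfl
      obtain rfl : A ++ [w] = T := e1
      have r2 : Run (σ := St n (8 * h) d) (move .seg (fun _ => true) fun x => { left := [x] })
          { flag := false, alive := U }
          { m with
            left := []
            seg := encodeInput (A ++ [w])
            con := C
            cands := encodeInput Cs ++ m.cands } { flag := false, alive := U }
          { m with
            left := (encodeInput (A ++ [w])).reverse
            con := C
            cands := encodeInput Cs ++ m.cands } (2 * N + 1) := 
        Run.mono (run_moveBack _ _ _ rfl rfl hs) (by dsimp only; omega)
      have r3 := run_moveWord_inp ({ flag := false, alive := U } : St n (8 * h) d)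
        { m with
          left := (encodeInput (A ++ [w])).reverse
          con := C
          cands := encodeInput Cs ++ m.cands } A w rfl
      obtain ⟨F', A₁, T₁, R₁, Cs', C', g1, g2, g3, g4, g5, g6, g7, r4⟩ := ih
        { m with
          left := (encodeInput A).reverse
          inp := w.map some ++ none :: m.inp
          con := C
          cands := encodeInput Cs ++ m.cands } (w :: R)
        ⟨hi.src, hi.red, hi.fwd, hi.bwd, hi.cnt, hi.tmp⟩ rfl hs
        (by rw [encodeInput_cons, hinp]) e2 hAN (by omega)
      -- From the second round on `inp` is not empty, so no further candidates are saved.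
      have hCs' : Cs' = [] := g5 (by simp)
      subst hCs'
      refine ⟨F', A₁, T₁, R₁, Cs, C', by rw [← g1]; simp, g2, e3, e4, hR, g6, ?_, ?_⟩
      · intro hF
        obtain ⟨i1, i2, i3, -⟩ := g7 hF
        refine ⟨i1, i2, fun T' hT hT' => ?_, fun hR T' hT hT' => ?_⟩
        · rcases List.infix_concat_iff.1 hT with hT | hT
          · exact (f2 T' hT hT').1
          · exact i3 T' hT hT'
        · exact (f2 T' hT hT').2 (by rw [hinp, hR]; rfl)
      · refine (Exec.loop_true hcond (r1.seq (Exec.ite_false rfl (r2.seq r3))) r4).mono ?_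
        rw [List.length_append, List.length_singleton, add_mul A.length]
        nlinarith
    · obtain ⟨f1, f2⟩ := e6 rfl
      refine ⟨true, A', T, R, Cs, C, by rw [e1], e2, e3, e4, hR, fun _ => ⟨f1, f2⟩, by simp, ?_⟩
      rw [← hinp]
      refine (Exec.loop_true hcond (r1.seq (Exec.ite_true rfl (run_skip _ _)))
        (Exec.loop_false (by simp))).mono ?_
      rw [List.length_append, List.length_singleton, add_mul A.length]
      nlinarith [Nat.zero_le (A.length * ((M + 1) * ((96 * h + 160) * (N + 1))))]

end Loops

/-! ### Testing the candidates -/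

section Candidates

variable {G : Type*} [Group G] {n : ℕ}

/-- The conjugates of `g` by `c` and by `c u` are short. -/
def ConjShort (X : Fin n → G) (h B : ℕ) (c u : Word n) (g : G) : Prop :=
  wordLength X ((eval X c)⁻¹ * g * eval X c) ≤ 2 * nearBound h + 40 * h ∧
    wordLength X ((eval X u)⁻¹ * ((eval X c)⁻¹ * g * eval X c) * eval X u) ≤ B

/-- Let `g` be the longest final segment, `q` its middle, `c` a candidate near `q` and `u` a
geodesic word for `c⁻¹q`. Every final segment moves `q` by at most `40η`, which bounds its conjugate
by `c u`; the distance of `c` from `q` bounds its conjugate by `c`. -/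
theorem exists_conjShort {X : Fin n → G} (hX : IsSymmGenerating X) {h B : ℕ} {η : ℝ} (h1 : 1 ≤ η)
    (hη : η ≤ h) (H : FourPoint X η) (hB : ∀ k : ℕ, (k : ℝ) ≤ 40 * η → k ≤ B)
    (A Cs : List (Word n)) (hA : A ≠ [])
    (htors : ∀ T, T <:+: A → T ≠ [] → IsOfFinOrder (wprod X T))
    (hnear : ∀ T, T <:+ A → T ≠ [] → ∃ c ∈ Cs, IsNearMid X (nearBound h) (wprod X T) c) :
    ∃ c ∈ Cs, ∃ u : Word n, u.length ≤ nearBound h ∧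
      ∀ T, T <:+ A → T ≠ [] → ConjShort X h B c u (wprod X T) := by
  obtain ⟨i, hi, hmax⟩ := (Finset.range A.length).exists_max_image
    (fun i => wordLength X (wprod X (A.drop i)))
    ⟨0, Finset.mem_range.2 (List.length_pos_iff.2 hA)⟩
  have hT : A.drop i ≠ [] := by
    rw [Ne, List.drop_eq_nil_iff]; have := Finset.mem_range.1 hi; omega
  obtain ⟨c, hc, hcn⟩ := hnear _ (List.drop_suffix i A) hT
  have hfin := htors _ (List.drop_suffix i A).isInfix hT
  obtain ⟨q, hq⟩ := exists_isMid hX (wprod X (A.drop i))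
  have hcq := hcn hfin q hq
  have hu : (geo X ((eval X c)⁻¹ * q)).length ≤ nearBound h := by
    rw [hX.length_geo]
    have := hcq
    rw [rdist, wordDist] at this
    exact_mod_cast this
  refine ⟨c, hc, _, hu, fun T hTs hTn => ?_⟩
  have hwT : ∀ S : List (Word n), S <:+: A → IsOfFinOrder (wprod X S) := fun S hS => by
    by_cases hS' : S = []
    · subst hS'; exact IsOfFinOrder.one
    · exact htors S hS hS'
  -- Of two final segments one is a suffix of the other, so the quotient is a segment or the inverse
  -- of one, possibly empty.
  have hk : IsOfFinOrder (wprod X (A.drop i) * (wprod X T)⁻¹) := by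
    rcases List.suffix_or_suffix_of_suffix hTs (List.drop_suffix i A) with ⟨S, hS⟩ | ⟨S, hS⟩
    · have : wprod X (A.drop i) = wprod X S * wprod X T := by rw [← hS]; simp [wprod]
      rw [this, mul_inv_cancel_right]
      exact hwT S (List.IsInfix.trans (List.prefix_append S T).isInfix
        (hS ▸ (List.drop_suffix i A).isInfix))
    · have : wprod X T = wprod X S * wprod X (A.drop i) := by rw [← hS]; simp [wprod]
      rw [this, mul_inv_rev, mul_inv_cancel_left]
      exact (hwT S (List.IsInfix.trans (List.prefix_append S _).isInfix
        (hS ▸ hTs.isInfix))).inv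
  have hle : rdist X 1 (wprod X T) ≤ rdist X 1 (wprod X (A.drop i)) := by
    have hTd : T = A.drop (A.length - T.length) := List.suffix_iff_eq_drop.1 hTs
    have hpos := List.length_pos_iff.2 hTn
    have hposA := List.length_pos_iff.2 hA
    have := hmax (A.length - T.length) (Finset.mem_range.2 (by omega))
    rw [← hTd] at this
    simpa [rdist, wordDist] using this
  have key := IsMid.rdist_mul_le_of_isOfFinOrder hX h1 H hfin (hwT T hTs.isInfix) hk hq hle
  constructor
  · have h4 := rdist_triangle hX (eval X c) q (wprod X T * eval X c)
    have h5 := rdist_triangle hX q (wprod X T * q) (wprod X T * eval X c)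
    rw [rdist_mul_left, rdist_comm hX q (eval X c)] at h5
    have h6 : (wordLength X ((eval X c)⁻¹ * wprod X T * eval X c) : ℝ) =
        rdist X (eval X c) (wprod X T * eval X c) := by
      rw [rdist, wordDist, mul_assoc]
    have : (wordLength X ((eval X c)⁻¹ * wprod X T * eval X c) : ℝ) ≤
        2 * nearBound h + 40 * h := by
      rw [h6]; linarith
    exact_mod_cast this
  · refine hB _ (le_trans (le_of_eq ?_) key)
    rw [hX.eval_geo, rdist, wordDist]
    congr 2
    group

variable (X : Fin n → G) (h d B : ℕ)

/-- Discards the words that do not conjugate the word on the stack `red` to a short one. -/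
noncomputable def filterAlive : Prog (Alph n) (St n (8 * h) d) :=
  .act (fun j => if j = some .red then conjBound h + 1 else 0) fun s W =>
    let v := (W (some .red)).reduceOption.reverse
    ({ s with alive := {u | u ∈ s.alive ∧ v.length ≤ conjBound h ∧
        wordLength X ((eval X u.1)⁻¹ * eval X v * eval X u.1) ≤ B} }, W)

/-- Tests the candidate on the stack `con` with all final segments. -/
noncomputable def filterSuffixes : Prog (Alph n) (St n (8 * h) d) :=
  .loop (single .left) (fun _ W => !(W (some .left)).isEmpty)
    (.seq (moveWord fun x => { seg := [x] })
      (.seq (conjReduce X (8 * h) d (8 * h + 1)) (.seq (filterAlive X h d B) (clear .red))))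

open Classical in
/-- Tests the first candidate on the list. -/
noncomputable def testCand : Prog (Alph n) (St n (8 * h) d) :=
  .seq (move .cands Option.isSome fun x => { con := [x] })
  (.seq (.act (single .cands) fun s _ => ({ s with alive := Set.univ }, fun _ => []))
  (.seq (filterSuffixes X h d B)
  (.seq (move .seg (fun _ => true) fun x => { left := [x] })
  (.ite (fun _ => 0) (fun s _ => decide s.alive.Nonempty)
    (.act (fun _ => 0) fun s _ => ({ s with flag := true }, fun _ => [])) (clear .con)))))

/-- Tests all candidates. -/
noncomputable def testCands : Prog (Alph n) (St n (8 * h) d) :=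
  .loop (single .cands) (fun s W => !s.flag && !(W (some .cands)).isEmpty) (testCand X h d B)

variable {X h d B}

theorem run_filterAlive (s : St n (8 * h) d) (m : Mem n) (v : Word n)
    (hm : m.red = v.reverse.map some) : Run (filterAlive X h d B) s m
      { s with alive := {u | u ∈ s.alive ∧ v.length ≤ conjBound h ∧
        wordLength X ((eval X u.1)⁻¹ * eval X v * eval X u.1) ≤ B} } m 1 := by
  refine Run.act ?_ ?_
  · have e : (window (fun j => if j = some .red then conjBound h + 1 else 0) m.stk
        (some .red)).reduceOption.reverse = (v.reverse.take (conjBound h + 1)).reverse := by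
      simp [window, Mem.stk, hm, ← List.map_take, reduceOption_map_some, -List.map_reverse]
    simp only [e]
    by_cases hv : v.length ≤ conjBound h
    · rw [List.take_of_length_le (by simp; omega), List.reverse_reverse]
    · have : ¬ (v.reverse.take (conjBound h + 1)).reverse.length ≤ conjBound h := by
        simp; omega
      simp only [hv, this, false_and, and_false]
  · intro j
    exact List.take_append_drop _ _

/-- Two inclusions replace an exact description of the survivors: every survivor has short
conjugates, and every `u` that satisfies `ConjShort` throughout survives. A reduced word that is too
long removes all `u`, but `ConjShort` excludes this case. -/
theorem run_filterSuffixes (hX : IsSymmGenerating X) (H : FourPoint X h) {N : ℕ} (f : Bool)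
    (c : Word n) (hcN : c.length ≤ N) (A : List (Word n)) : ∀ (U : Set (BList (Fin n) d))
    (m : Mem n) (Sg : List (Word n)),
    m.Idle → m.left = (encodeInput A).reverse → m.seg = encodeInput Sg →
    m.con = c.reverse.map some → (encodeInput (A ++ Sg)).length ≤ N →
    ∃ U' : Set (BList (Fin n) d),
      (∀ u ∈ U', u ∈ U ∧ ∀ T, T <:+ A → T ≠ [] → wordLength X ((eval X u.1)⁻¹ *
        ((eval X c)⁻¹ * wprod X (T ++ Sg) * eval X c) * eval X u.1) ≤ B) ∧
      (∀ u ∈ U, (∀ T, T <:+ A → T ≠ [] → ConjShort X h B c u.1 (wprod X (T ++ Sg))) → u ∈ U') ∧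
      Run (filterSuffixes X h d B) { flag := f, alive := U } m { flag := f, alive := U' }
        { m with left := [], seg := encodeInput (A ++ Sg) }
        (A.length * ((64 * h + 80) * (N + 1)) + 1) := by
  induction A using List.reverseRecOn with
  | nil =>
    intro U m Sg hi hl hs hc hN
    refine ⟨U, fun u hu => ⟨hu, fun T hT hT' => absurd (List.suffix_nil.1 hT) hT'⟩,
      fun u hu _ => hu, ?_⟩
    have : ({ m with left := [], seg := encodeInput ([] ++ Sg) } : Mem n) = m := by
      ext1 <;> simp [hl, hs, encodeInput_nil]
    rw [this]
    exact (Exec.loop_false (by simp [window, single, Mem.stk, hl, encodeInput_nil])).mono (by omega)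
  | append_singleton A w ih =>
    intro U m Sg hi hl hs hc hN
    have hcond : (fun (_ : St n (8 * h) d) (W : ∀ k, List (Alph n k)) =>
        !(W (some .left)).isEmpty) { flag := f, alive := U } (window (single .left) m.stk) =
          true := by
      simp [window, single, Mem.stk, hl, reverse_encodeInput_concat]
    have r1 := run_moveWord_seg ({ flag := f, alive := U } : St n (8 * h) d) m A w hl
    have hseg : w.map some ++ none :: m.seg = encodeInput (w :: Sg) := by
      rw [hs, encodeInput_cons]
    rw [hseg] at r1
    have hlen : (encodeInput (A ++ w :: Sg)).length ≤ N := by simpa using hN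
    have hlen' : (encodeInput (w :: Sg)).length ≤ N := by
      rw [encodeInput_append, List.length_append] at hlen; omega
    have hw : w.length + 1 ≤ N := by
      rw [encodeInput_cons] at hlen'; simp at hlen'; omega
    obtain ⟨v, hv1, hv2, hv3, r2⟩ := run_conjReduce (k := 8 * h + 1) hX
      ({ flag := f, alive := U } : St n (8 * h) d)
      { m with left := (encodeInput A).reverse, seg := encodeInput (w :: Sg) } c (w :: Sg) hc rfl
      hi.src hi.red hi.bwd hi.tmp
    have hk : 8 * h + 1 + 1 = 2 * (4 * h + 1) := by ring
    rw [hk] at hv1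
    have r3 := run_filterAlive (X := X) (B := B) ({ flag := f, alive := U } : St n (8 * h) d)
      { m with
        left := (encodeInput A).reverse, seg := encodeInput (w :: Sg), red := v.reverse.map some }
      v rfl
    rw [hv2] at r3
    dsimp only at r3
    obtain ⟨U₁, hU₁⟩ : ∃ U₁ : Set (BList (Fin n) d), U₁ = {u | u ∈ U ∧ v.length ≤ conjBound h ∧
        wordLength X ((eval X u.1)⁻¹ * ((eval X c)⁻¹ * wprod X (w :: Sg) * eval X c) *
          eval X u.1) ≤ B} := ⟨_, rfl⟩
    have r4 : Run (σ := St n (8 * h) d) (clear .red) { flag := f, alive := U₁ }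
        { m with
          left := (encodeInput A).reverse, seg := encodeInput (w :: Sg), red := v.reverse.map some }
        { flag := f, alive := U₁ }
        { m with left := (encodeInput A).reverse, seg := encodeInput (w :: Sg) }
        (2 * v.length + 1) := by
      apply run_clear
      · exact hi.red
      · rintro (_ | j) hj
        · rfl
        · cases j <;> first | rfl | exact absurd rfl hj
      · simp [Mem.stk]
    obtain ⟨U', g1, g2, r5⟩ := ih U₁
      { m with left := (encodeInput A).reverse, seg := encodeInput (w :: Sg) } (w :: Sg)
      ⟨hi.src, hi.red, hi.fwd, hi.bwd, hi.cnt, hi.tmp⟩ rfl rfl hc hlen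
    have happ : ∀ T : List (Word n), T ++ [w] ++ Sg = T ++ w :: Sg := fun T => by simp
    refine ⟨U', fun u hu => ?_, fun u hu hg => ?_, ?_⟩
    · obtain ⟨i1, i2⟩ := g1 u hu
      rw [hU₁] at i1
      refine ⟨i1.1, fun T hT hT' => ?_⟩
      rcases List.suffix_concat_iff.1 hT with rfl | ⟨T₁, rfl, hT₁⟩
      · exact absurd rfl hT'
      rw [happ]
      by_cases hne : T₁ = []
      · subst hne; exact i1.2.2
      · exact i2 T₁ hT₁ hne
    · refine g2 u ?_ fun T hT hT' => ?_
      · have := hg [w] (List.suffix_append A [w]) (by simp)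
        rw [hU₁]
        refine ⟨hu, ?_, this.2⟩
        refine hv1.length_le hX H rfl (2 * nearBound h + 40 * h) ?_
        rw [hv2]
        exact this.1
      · rw [← happ]
        exact hg (T ++ [w]) (List.suffix_concat_iff.2 (Or.inr ⟨T, rfl, hT⟩)) (by simp)
    · rw [happ]
      rw [show ((w :: Sg).map (eval X)).prod = wprod X (w :: Sg) from rfl, ← hU₁] at r3
      refine (Exec.loop_true hcond (r1.seq (r2.seq (r3.seq r4))) r5).mono ?_
      have hs2 : c.length + (encodeInput (w :: Sg)).length + 1 ≤ 2 * (N + 1) := by omega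
      have t2 := Nat.mul_le_mul_left (4 * (8 * h + 1) + 20) hs2
      rw [List.length_append, List.length_singleton, add_mul]
      dsimp only at t2 hv3 ⊢
      nlinarith

end Candidates

/-! ### The loop over the candidates. -/

section Candidates

variable {G : Type*} [Group G] {n : ℕ} {X : Fin n → G} {h d B : ℕ}

theorem run_testCand (hX : IsSymmGenerating X) (H : FourPoint X h) {N : ℕ}
    (c : Word n) (hcN : c.length ≤ N) (A Cs : List (Word n)) (U : Set (BList (Fin n) d))
    (m : Mem n) (hi : m.Idle) (hl : m.left = (encodeInput A).reverse) (hs : m.seg = [])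
    (hc : m.con = []) (hcs : m.cands = encodeInput (c :: Cs)) (hN : (encodeInput A).length ≤ N) :
    ∃ (U' : Set (BList (Fin n) d)) (F : Bool) (c' : Word n),
      (∀ u ∈ U', ∀ T, T <:+ A → T ≠ [] → wordLength X ((eval X u.1)⁻¹ *
        ((eval X c)⁻¹ * wprod X T * eval X c) * eval X u.1) ≤ B) ∧
      (F = true → U'.Nonempty ∧ c' = c) ∧
      (F = false → c' = [] ∧ ∀ u : Word n, u.length ≤ d →
        ¬ ∀ T, T <:+ A → T ≠ [] → ConjShort X h B c u (wprod X T)) ∧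
      Run (testCand X h d B) { flag := false, alive := U } m { flag := F, alive := U' }
        { m with con := c'.reverse.map some, cands := encodeInput Cs }
        ((A.length + 1) * ((64 * h + 100) * (N + 1))) := by
  rw [encodeInput_cons] at hcs
  have r1 : Run (σ := St n (8 * h) d) (move .cands Option.isSome fun x => { con := [x] })
      { flag := false, alive := U } m { flag := false, alive := U }
      { m with con := c.reverse.map some, cands := none :: encodeInput Cs }
      (2 * c.length + 1) := by
    apply run_move .cands Option.isSome _ (fun _ => rfl) _ (c.map some) (none :: encodeInput Cs)
    · simp
    · rfl
    · exact hcs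
    · rfl
    · rintro (_ | j) hj
      · simp [Mem.stk]
      · cases j <;> simp_all [Mem.stk]
    · simp
  have r2 : Run (σ := St n (8 * h) d)
      (.act (single .cands) fun s _ => ({ s with alive := Set.univ }, fun _ => []))
      { flag := false, alive := U }
      { m with con := c.reverse.map some, cands := none :: encodeInput Cs }
      { flag := false, alive := Set.univ }
      { m with con := c.reverse.map some, cands := encodeInput Cs } 1 := by
    refine Run.act rfl ?_
    rintro (_ | j)
    · simp [single, Mem.stk]
    · cases j <;> simp [single, Mem.stk]
  obtain ⟨U', g1, g2, r3⟩ := run_filterSuffixes (B := B) hX H false c hcN A Set.univ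
    { m with con := c.reverse.map some, cands := encodeInput Cs } []
    ⟨hi.src, hi.red, hi.fwd, hi.bwd, hi.cnt, hi.tmp⟩ hl hs rfl (by simpa using hN)
  simp only [List.append_nil] at g1 g2 r3
  have r4 : Run (σ := St n (8 * h) d) (move .seg (fun _ => true) fun x => { left := [x] })
      { flag := false, alive := U' }
      { m with
        left := [], seg := encodeInput A, con := c.reverse.map some, cands := encodeInput Cs }
      { flag := false, alive := U' }
      { m with con := c.reverse.map some, cands := encodeInput Cs }
      (2 * N + 1) := by
    refine Run.mono (run_moveBack _ _ _ rfl ?_ hs) (by dsimp only; omega)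
    ext1 <;> simp [hl]
  classical
  by_cases hU : U'.Nonempty
  · have r5 : Run (σ := St n (8 * h) d)
        (.act (fun _ => 0) fun s _ => ({ s with flag := true }, fun _ => []))
        { flag := false, alive := U' } { m with con := c.reverse.map some, cands := encodeInput Cs }
        { flag := true, alive := U' } { m with con := c.reverse.map some, cands := encodeInput Cs }
        1 := Run.act rfl fun _ => rfl
    refine ⟨U', true, c, fun u hu => (g1 u hu).2, fun _ => ⟨hU, rfl⟩, by simp,
      (r1.seq (r2.seq (r3.seq (r4.seq (Exec.ite_true (by simpa using hU) r5))))).mono ?_⟩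
    nlinarith
  · have r5 : Run (σ := St n (8 * h) d) (clear .con)
        { flag := false, alive := U' } { m with con := c.reverse.map some, cands := encodeInput Cs }
        { flag := false, alive := U' }
        { m with con := ([] : Word n).reverse.map some, cands := encodeInput Cs }
        (2 * N + 1) := by
      apply run_clear
      · rfl
      · rintro (_ | j) hj
        · rfl
        · cases j <;> first | rfl | exact absurd rfl hj
      · simpa [Mem.stk] using hcN
    refine ⟨U', false, [], fun u hu => (g1 u hu).2, by simp, fun _ => ⟨rfl, fun u hu hg => ?_⟩,
      (r1.seq (r2.seq (r3.seq (r4.seq (Exec.ite_false (by simpa using hU) r5))))).mono ?_⟩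
    · exact hU ⟨⟨u, hu⟩, g2 ⟨u, hu⟩ trivial hg⟩
    · nlinarith

theorem run_testCands (hX : IsSymmGenerating X) (H : FourPoint X h) {N : ℕ}
    (A : List (Word n)) (hN : (encodeInput A).length ≤ N) (Cs : List (Word n)) :
    ∀ (U : Set (BList (Fin n) d)) (m : Mem n), AllShort N Cs →
    m.Idle → m.left = (encodeInput A).reverse → m.seg = [] → m.con = [] →
    m.cands = encodeInput Cs →
    ∃ (U' : Set (BList (Fin n) d)) (F : Bool) (c : Word n) (Cs' : List (Word n)),
      Cs' <:+ Cs ∧ c.length ≤ N ∧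
      (F = true → U'.Nonempty ∧ ∀ u ∈ U', ∀ T, T <:+ A → T ≠ [] → wordLength X ((eval X u.1)⁻¹ *
        ((eval X c)⁻¹ * wprod X T * eval X c) * eval X u.1) ≤ B) ∧
      (F = false → ∀ c ∈ Cs, ∀ u : Word n, u.length ≤ d →
        ¬ ∀ T, T <:+ A → T ≠ [] → ConjShort X h B c u (wprod X T)) ∧
      Run (testCands X h d B) { flag := false, alive := U } m { flag := F, alive := U' }
        { m with con := c.reverse.map some, cands := encodeInput Cs' }
        (Cs.length * ((A.length + 1) * ((64 * h + 101) * (N + 1))) + 1) := by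
  induction Cs with
  | nil =>
    intro U m hsh hi hl hs hc hcs
    refine ⟨U, false, [], [], List.suffix_rfl, Nat.zero_le _, by simp, by simp, ?_⟩
    have : ({ m with con := ([] : Word n).reverse.map some, cands := encodeInput [] } : Mem n) =
        m := by
      ext1 <;> simp [hc, hcs, encodeInput_nil]
    rw [this]
    exact (Exec.loop_false (by simp [window, single, Mem.stk, hcs, encodeInput_nil])).mono
      (by omega)
  | cons c Cs ih =>
    intro U m hsh hi hl hs hc hcs
    have hcond : (fun (s : St n (8 * h) d) (W : ∀ k, List (Alph n k)) =>
        !s.flag && !(W (some .cands)).isEmpty) { flag := false, alive := U }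
        (window (single .cands) m.stk) = true := by
      cases c <;> simp [window, single, Mem.stk, hcs, encodeInput_cons]
    have hcN : c.length ≤ N := hsh c (by simp)
    obtain ⟨U₁, F, c', g1, g2, g3, r1⟩ := run_testCand (B := B) hX H c hcN A Cs U m hi hl hs hc hcs
      hN
    rcases F with _ | _
    · obtain ⟨rfl, g4⟩ := g3 rfl
      obtain ⟨U', F, c₂, Cs', i1, i2, i3, i4, r2⟩ := ih U₁
        { m with con := ([] : Word n).reverse.map some, cands := encodeInput Cs }
        (fun x hx => hsh x (by simp [hx])) ⟨hi.src, hi.red, hi.fwd, hi.bwd, hi.cnt, hi.tmp⟩ hl hs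
        rfl rfl
      refine ⟨U', F, c₂, Cs', i1.trans (List.suffix_cons c Cs), i2, i3, fun hF x hx => ?_,
        (Exec.loop_true hcond r1 r2).mono ?_⟩
      · rcases List.mem_cons.1 hx with rfl | hx
        · exact g4
        · exact i4 hF x hx
      · rw [List.length_cons, add_mul Cs.length]
        nlinarith
    · obtain ⟨hne, rfl⟩ := g2 rfl
      refine ⟨U₁, true, c', Cs, List.suffix_cons c' Cs, hcN, fun _ => ⟨hne, g1⟩, by simp,
        (Exec.loop_true hcond r1 (Exec.loop_false (by simp))).mono ?_⟩
      rw [List.length_cons, add_mul Cs.length]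
      nlinarith [Nat.zero_le (Cs.length * ((A.length + 1) * ((64 * h + 101) * (N + 1))))]

end Candidates

/-! ### The output -/

section Outputs

variable {n : ℕ}

/-- Writes a digit for each separator. -/
def tally (b : Bool) (x : Option (Fin n)) : List (Fin n ⊕ Bool) :=
  if x.isNone then [Sum.inr b] else []

theorem flatMap_tally_map_some (b : Bool) (w : Word n) : (w.map some).flatMap (tally b) = [] := by
  induction w with
  | nil => rfl
  | cons x w ih => simp [tally]

/-- Every word has one separator, so separators count words. -/
theorem flatMap_tally (b : Bool) (A : List (Word n)) :
    (encodeInput A).flatMap (tally b) = List.replicate A.length (Sum.inr b) := by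
  induction A with
  | nil => rfl
  | cons w A ih =>
    rw [encodeInput_cons, List.flatMap_append, flatMap_tally_map_some, List.flatMap_cons, ih]
    rfl

theorem flatMap_tally_reverse (b : Bool) (A : List (Word n)) :
    (encodeInput A).reverse.flatMap (tally b) = List.replicate A.length (Sum.inr b) := by
  induction A using List.reverseRecOn with
  | nil => rfl
  | append_singleton A w ih =>
    rw [reverse_encodeInput_concat, List.flatMap_cons, List.flatMap_append,
      flatMap_tally_map_some, ih, List.length_append, List.length_singleton, List.replicate_succ]
    rfl

theorem length_encodeInput_le {N : ℕ} (A : List (Word n)) (hA : AllShort N A) :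
    (encodeInput A).length ≤ A.length * (N + 1) := by
  induction A with
  | nil => simp [encodeInput_nil]
  | cons w A ih =>
    have h1 := ih fun x hx => hA x (by simp [hx])
    have h2 := hA w (by simp)
    rw [encodeInput_cons]
    simp only [List.length_append, List.length_map, List.length_cons]
    nlinarith

variable (h d : ℕ)

/-- Returns to the initial state. -/
def reset : Prog (Alph n) (St n (8 * h) d) := .act (fun _ => 0) fun _ _ => ({}, fun _ => [])

/-- Writes the indices of the segment on the stack `seg`. -/
def writeIndices : Prog (Alph n) (St n (8 * h) d) :=
  .seq (move .seg (fun _ => true) fun x => { out := tally true x })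
  (.seq (move .left (fun _ => true) fun x => { tmp := [x], out := tally true x })
  (.seq (move .tmp (fun _ => true) fun x => { out := tally false x })
  -- The tag, followed by one more digit of the first index: the segment begins one place after the
  -- words on `left`. The words on `left` count for both indices, hence their copy on `tmp`.
  (.seq (.act (fun _ => 0) fun s _ => (s, Mem.stk { out := [Sum.inr true, Sum.inr false] }))
  (.seq (clear .inp) (.seq (clear .cands) (reset h d))))))

open Classical in
/-- An element of a set of words. -/
noncomputable def pick (U : Set (BList (Fin n) d)) : Word n :=
  if hU : U.Nonempty then hU.choose.1 else []

theorem exists_pick {U : Set (BList (Fin n) d)} (hU : U.Nonempty) : ∃ u ∈ U, pick d U = u.1 :=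
  ⟨hU.choose, hU.choose_spec, by rw [pick, dif_pos hU]⟩

/-- Writes the product of the word on the stack `con` and a word that has passed all tests. -/
noncomputable def writeWord : Prog (Alph n) (St n (8 * h) d) :=
  .seq (.act (fun _ => 0) fun s _ => (s, Mem.stk { out := (pick d s.alive).map Sum.inl }))
  (.seq (move .con (fun _ => true) fun x => { out := x.toList.map Sum.inl })
  (.seq (.act (fun _ => 0) fun s _ => (s, Mem.stk { out := [Sum.inr false] }))
  (.seq (clear .left) (.seq (clear .cands) (reset h d)))))

variable {h d}

theorem run_writeIndices (s : St n (8 * h) d) (A T R Cs : List (Word n)) {t N : ℕ}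
    (hN : (encodeInput (A ++ T ++ R)).length ≤ N) (hCs : AllShort N Cs) (ht : Cs.length ≤ t) :
    Run (writeIndices h d) s
      { inp := encodeInput R, left := (encodeInput A).reverse, seg := encodeInput T,
        cands := encodeInput Cs } {}
      { out := encodeOutput (.indices (A.length + 1) (A.length + T.length)) }
      ((t + 1) * (12 * (N + 1))) := by
  rw [encodeInput_append, encodeInput_append, List.length_append, List.length_append] at hN
  have r1 : Run (σ := St n (8 * h) d) (move .seg (fun _ => true) fun x => { out := tally true x }) s
      { inp := encodeInput R, left := (encodeInput A).reverse, seg := encodeInput T,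
        cands := encodeInput Cs } s
      { inp := encodeInput R, left := (encodeInput A).reverse, cands := encodeInput Cs,
        out := List.replicate T.length (Sum.inr true) } (2 * N + 1) := by
    apply run_move_all
    · intro x; rfl
    · rfl
    · rintro (_ | j) hj
      · simp [Mem.stk, flatMap_tally_reverse]
      · cases j <;> simp_all [Mem.stk]
    · simp only [Mem.stk]; omega
  have r2 : Run (σ := St n (8 * h) d)
      (move .left (fun _ => true) fun x => { tmp := [x], out := tally true x }) s
      { inp := encodeInput R, left := (encodeInput A).reverse, cands := encodeInput Cs,
        out := List.replicate T.length (Sum.inr true) } s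
      { inp := encodeInput R, tmp := encodeInput A, cands := encodeInput Cs,
        out := List.replicate (A.length + T.length) (Sum.inr true) } (2 * N + 1) := by
    apply run_move_all
    · intro x; rfl
    · rfl
    · rintro (_ | j) hj
      · simp [Mem.stk, flatMap_tally]
      · cases j <;> simp_all [Mem.stk]
    · simp only [Mem.stk, List.length_reverse]; omega
  have r3 : Run (σ := St n (8 * h) d)
      (move .tmp (fun _ => true) fun x => { out := tally false x }) s
      { inp := encodeInput R, tmp := encodeInput A, cands := encodeInput Cs,
        out := List.replicate (A.length + T.length) (Sum.inr true) } s
      { inp := encodeInput R, cands := encodeInput Cs,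
        out := List.replicate A.length (Sum.inr false) ++
          List.replicate (A.length + T.length) (Sum.inr true) } (2 * N + 1) := by
    apply run_move_all
    · intro x; rfl
    · rfl
    · rintro (_ | j) hj
      · simp [Mem.stk, flatMap_tally_reverse]
      · cases j <;> simp_all [Mem.stk]
    · simp only [Mem.stk]; omega
  have r4 : Run (σ := St n (8 * h) d)
      (.act (fun _ => 0) fun s _ => (s, Mem.stk { out := [Sum.inr true, Sum.inr false] })) s
      { inp := encodeInput R, cands := encodeInput Cs,
        out := List.replicate A.length (Sum.inr false) ++
          List.replicate (A.length + T.length) (Sum.inr true) } s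
      { inp := encodeInput R, cands := encodeInput Cs,
        out := encodeOutput (.indices (A.length + 1) (A.length + T.length)) } 1 := by
    refine Run.act rfl ?_
    rintro (_ | j)
    · simp [Mem.stk, encodeOutput, List.replicate_succ]
    · cases j <;> simp [Mem.stk]
  have r5 : Run (σ := St n (8 * h) d) (clear .inp) s
      { inp := encodeInput R, cands := encodeInput Cs,
        out := encodeOutput (.indices (A.length + 1) (A.length + T.length)) } s
      { cands := encodeInput Cs,
        out := encodeOutput (.indices (A.length + 1) (A.length + T.length)) } (2 * N + 1) := by
    apply run_clear
    · rfl
    · rintro (_ | j) hj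
      · rfl
      · cases j <;> first | rfl | exact absurd rfl hj
    · simp only [Mem.stk]; omega
  have r6 : Run (σ := St n (8 * h) d) (clear .cands) s
      { cands := encodeInput Cs,
        out := encodeOutput (.indices (A.length + 1) (A.length + T.length)) } s
      { out := encodeOutput (.indices (A.length + 1) (A.length + T.length)) }
      (2 * (t * (N + 1)) + 1) := by
    apply run_clear
    · rfl
    · rintro (_ | j) hj
      · rfl
      · cases j <;> first | rfl | exact absurd rfl hj
    · have h1 := length_encodeInput_le Cs hCs
      have h2 := Nat.mul_le_mul_right (N + 1) ht
      simp only [Mem.stk]; omega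
  have r7 : Run (reset h d) s
      { out := encodeOutput (.indices (A.length + 1) (A.length + T.length)) } {}
      { out := encodeOutput (.indices (A.length + 1) (A.length + T.length)) } 1 :=
    Run.act rfl fun _ => rfl
  refine (r1.seq (r2.seq (r3.seq (r4.seq (r5.seq (r6.seq r7)))))).mono ?_
  nlinarith [Nat.zero_le (t * (N + 1))]

theorem run_writeWord (s : St n (8 * h) d) (c : Word n) (Cs : List (Word n))
    (l : List (Option (Fin n))) {t N : ℕ} (hl : l.length ≤ N) (hc : c.length ≤ N)
    (hCs : AllShort N Cs) (ht : Cs.length ≤ t) :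
    Run (writeWord h d) s { left := l, con := c.reverse.map some, cands := encodeInput Cs } {}
      { out := encodeOutput (.conjugator (c ++ pick d s.alive)) } ((t + 1) * (8 * (N + 1))) := by
  have r1 : Run (σ := St n (8 * h) d)
      (.act (fun _ => 0) fun s _ => (s, Mem.stk { out := (pick d s.alive).map Sum.inl })) s
      { left := l, con := c.reverse.map some, cands := encodeInput Cs } s
      { left := l, con := c.reverse.map some, cands := encodeInput Cs,
        out := (pick d s.alive).map Sum.inl } 1 := by
    refine Run.act rfl ?_
    rintro (_ | j)
    · simp [Mem.stk]
    · cases j <;> simp [Mem.stk]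
  have r2 : Run (σ := St n (8 * h) d)
      (move .con (fun _ => true) fun x => { out := x.toList.map Sum.inl }) s
      { left := l, con := c.reverse.map some, cands := encodeInput Cs,
        out := (pick d s.alive).map Sum.inl } s
      { left := l, cands := encodeInput Cs,
        out := (c ++ pick d s.alive).map Sum.inl } (2 * c.length + 1) := by
    apply run_move_all
    · intro x; rfl
    · rfl
    · rintro (_ | j) hj
      · simp [Mem.stk, ← List.map_reverse, List.flatMap_map, ← List.map_eq_flatMap]
      · cases j <;> simp_all [Mem.stk]
    · simp [Mem.stk]
  have r3 : Run (σ := St n (8 * h) d)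
      (.act (fun _ => 0) fun s _ => (s, Mem.stk { out := [Sum.inr false] })) s
      { left := l, cands := encodeInput Cs, out := (c ++ pick d s.alive).map Sum.inl } s
      { left := l, cands := encodeInput Cs,
        out := encodeOutput (.conjugator (c ++ pick d s.alive)) } 1 := by
    refine Run.act rfl ?_
    rintro (_ | j)
    · simp [Mem.stk, encodeOutput]
    · cases j <;> simp [Mem.stk]
  have r4 : Run (σ := St n (8 * h) d) (clear .left) s
      { left := l, cands := encodeInput Cs,
        out := encodeOutput (.conjugator (c ++ pick d s.alive)) } s
      { cands := encodeInput Cs, out := encodeOutput (.conjugator (c ++ pick d s.alive)) }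
      (2 * N + 1) := by
    apply run_clear
    · rfl
    · rintro (_ | j) hj
      · rfl
      · cases j <;> first | rfl | exact absurd rfl hj
    · simpa [Mem.stk] using hl
  have r5 : Run (σ := St n (8 * h) d) (clear .cands) s
      { cands := encodeInput Cs, out := encodeOutput (.conjugator (c ++ pick d s.alive)) } s
      { out := encodeOutput (.conjugator (c ++ pick d s.alive)) } (2 * (t * (N + 1)) + 1) := by
    apply run_clear
    · rfl
    · rintro (_ | j) hj
      · rfl
      · cases j <;> first | rfl | exact absurd rfl hj
    · have h1 := length_encodeInput_le Cs hCs
      have h2 := Nat.mul_le_mul_right (N + 1) ht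
      simp only [Mem.stk]; omega
  have r6 : Run (reset h d) s { out := encodeOutput (.conjugator (c ++ pick d s.alive)) } {}
      { out := encodeOutput (.conjugator (c ++ pick d s.alive)) } 1 := Run.act rfl fun _ => rfl
  refine (r1.seq (r2.seq (r3.seq (r4.seq (r5.seq r6))))).mono ?_
  nlinarith [Nat.zero_le (t * (N + 1))]

end Outputs

/-! ### The algorithm -/

section Main

variable {G : Type*} [Group G] {n : ℕ} (X : Fin n → G) (h B : ℕ)

/-- The program that shortens a list of words. -/
noncomputable def shortenWords : Prog (Alph n) (St n (8 * h) (nearBound h)) :=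
  .seq (move .inp (fun _ => true) fun x => { left := [x] })
  (.seq (testAll X h (nearBound h))
  (.seq (clear .con)
  (.ite (fun _ => 0) (fun s _ => s.flag) (writeIndices h (nearBound h))
    (.seq (move .inp (fun _ => true) fun x => { left := [x] })
    (.seq (testCands X h (nearBound h) B) (writeWord h (nearBound h)))))))

variable {X h B}

theorem run_inp_left {σ : Type} (s : σ) (m : Mem n) (hl : m.left = []) :
    Run (move .inp (fun _ => true) fun x => { left := [x] }) s m s
      { m with inp := [], left := m.inp.reverse } (2 * m.inp.length + 1) := by
  apply run_move_all
  · intro x; rfl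
  · rfl
  · rintro (_ | j) hj
    · simp [Mem.stk]
    · cases j <;> simp_all [Mem.stk]
  · rfl

/-- Both phases treat `O(m²)` pairs in time linear in the length of the input, which explains the
shape of the bound. -/
theorem run_shortenWords (hX : IsSymmGenerating X) (h1 : 1 ≤ h) {η : ℝ} (hη1 : 1 ≤ η)
    (hη : η ≤ h) (H : FourPoint X η) (hB : ∀ k : ℕ, (k : ℝ) ≤ 40 * η → k ≤ B)
    (A : List (Word n)) : ∃ out : Output n,
      ((∃ c : Word n, out = .conjugator c ∧ ∀ T, T <:+ A → T ≠ [] →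
          wordLength X ((eval X c)⁻¹ * wprod X T * eval X c) ≤ B) ∨
        ∃ A' T R, A = A' ++ T ++ R ∧ T ≠ [] ∧ ¬ IsOfFinOrder (wprod X T) ∧
          out = .indices (A'.length + 1) (A'.length + T.length)) ∧
      Run (shortenWords X h B) {} { inp := encodeInput A } {} { out := encodeOutput out }
        ((A.length + 1) * ((A.length + 1) * ((200 * h + 400) * ((encodeInput A).length + 1)))) := by
  have Hh : FourPoint X h := H.mono hη
  obtain ⟨N, hN⟩ : ∃ N, N = (encodeInput A).length := ⟨_, rfl⟩
  have r1 := run_inp_left ({} : St n (8 * h) (nearBound h)) { inp := encodeInput A } rfl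
  obtain ⟨F, A', T, R, Cs, C, e1, e2, e3, e4, -, e6, e7, r2⟩ := run_testAll (N := N)
    (d := nearBound h) hX Hh h1 ∅ A { left := (encodeInput A).reverse } []
    ⟨rfl, rfl, rfl, rfl, rfl, rfl⟩ rfl rfl rfl (Nat.zero_le _) hN.ge le_rfl
  rw [List.append_nil] at e1
  have r3 : Run (σ := St n (8 * h) (nearBound h)) (clear .con) { flag := F }
      { inp := encodeInput R, left := (encodeInput A').reverse, seg := encodeInput T, con := C,
        cands := encodeInput Cs ++ [] } { flag := F }
      { inp := encodeInput R, left := (encodeInput A').reverse, seg := encodeInput T,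
        cands := encodeInput Cs } (2 * N + 1) := by
    apply run_clear
    · rfl
    · rintro (_ | j) hj
      · rfl
      · cases j <;> first | rfl | exact absurd rfl hj | simp [Mem.stk]
    · simpa [Mem.stk] using e2
  rw [← hN]
  rcases F with _ | _
  · obtain ⟨rfl, rfl, f3, f4⟩ := e7 rfl
    obtain rfl : A = R := e1
    have r4 := run_inp_left ({} : St n (8 * h) (nearBound h))
      { inp := encodeInput A, cands := encodeInput Cs } rfl
    obtain ⟨U, F, c, Cs', g1, g2, g3, g4, r5⟩ := run_testCands (d := nearBound h) (B := B) hX Hh A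
      hN.ge Cs ∅ { left := (encodeInput A).reverse, cands := encodeInput Cs } e4
      ⟨rfl, rfl, rfl, rfl, rfl, rfl⟩ rfl rfl rfl rfl
    have r6 := run_writeWord (h := h) (d := nearBound h) { flag := F, alive := U } c Cs'
      (encodeInput A).reverse (t := A.length) (N := N) (by simp [hN]) g2
      (fun x hx => e4 x (g1.subset hx)) (g1.length_le.trans e3)
    refine ⟨_, Or.inl ⟨_, rfl, fun T hT hT' => ?_⟩,
      (r1.seq (r2.seq (r3.seq (Exec.ite_false rfl (r4.seq (r5.seq r6)))))).mono ?_⟩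
    · rcases F with _ | _
      -- No candidate survived. For a nonempty list this contradicts the existence of a good pair;
      -- for the empty list there is nothing to prove.
      · obtain ⟨x, hx, u, hu, hg⟩ := exists_conjShort hX hη1 hη H hB A Cs
          (by rintro rfl; exact hT' (List.suffix_nil.1 hT)) f3 (f4 rfl)
        exact absurd hg (g4 rfl x hx u hu)
      · obtain ⟨u, hu, hu'⟩ := exists_pick (nearBound h) (g3 rfl).1
        have := (g3 rfl).2 u hu T hT hT'
        rw [hu', eval_append]
        convert this using 2
        group
    · have t1 := Nat.mul_le_mul_right ((A.length + 1) * ((64 * h + 101) * (N + 1))) e3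
      dsimp only
      rw [← hN]
      nlinarith [Nat.zero_le (A.length * N), Nat.zero_le (A.length * A.length),
        Nat.zero_le (A.length * A.length * N), Nat.zero_le (A.length * A.length * N * h),
        Nat.zero_le (A.length * N * h), Nat.zero_le (N * h), Nat.zero_le (A.length * h),
        Nat.zero_le (A.length * A.length * h)]
  · obtain ⟨f1, f2⟩ := e6 rfl
    have r4 := run_writeIndices (h := h) (d := nearBound h) { flag := true } A' T R Cs
      (t := A.length) (N := N) (by rw [← e1, hN]) e4 e3
    refine ⟨_, Or.inr ⟨A', T, R, e1, f1, f2, rfl⟩,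
      (r1.seq (r2.seq (r3.seq (Exec.ite_true rfl r4)))).mono ?_⟩
    dsimp only
    rw [← hN]
    nlinarith [Nat.zero_le (A.length * N), Nat.zero_le (A.length * A.length),
        Nat.zero_le (A.length * A.length * N), Nat.zero_le (A.length * A.length * N * h),
        Nat.zero_le (A.length * N * h), Nat.zero_le (N * h), Nat.zero_le (A.length * h),
        Nat.zero_le (A.length * A.length * h)]

theorem length_le_maxLength {A : List (Word n)} {w : Word n} (hw : w ∈ A) :
    w.length ≤ maxLength A := by
  induction A with
  | nil => simp at hw
  | cons a A ih =>
    have e : maxLength (a :: A) = max a.length (maxLength A) := rfl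
    rw [e]
    rcases List.mem_cons.1 hw with rfl | hw
    · exact le_max_left _ _
    · exact (ih hw).trans (le_max_right _ _)

/-- For `m ≥ 1` the input has length at most `m(μ + 1)`, so `N + 1 ≤ 3mμ` and `m + 1 ≤ 2m`, which
gives the factor `12`. The added `1` on the right covers the empty list. -/
theorem time_bound (κ : ℕ) (A : List (Word n)) :
    (A.length + 1) * ((A.length + 1) * (κ * ((encodeInput A).length + 1))) ≤
      12 * κ * (A.length ^ 3 * max (maxLength A) 1 + 1) := by
  have h1 := length_encodeInput_le (N := max (maxLength A) 1) A
    fun w hw => (length_le_maxLength hw).trans (le_max_left _ _)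
  have hμ : 1 ≤ max (maxLength A) 1 := le_max_right _ _
  generalize max (maxLength A) 1 = μ at h1 hμ ⊢
  generalize (encodeInput A).length = N at h1 ⊢
  generalize A.length = m at h1 ⊢
  rcases Nat.eq_zero_or_pos m with rfl | hm
  · have : N = 0 := by simpa using h1
    subst this
    simp; omega
  · have h2 : N + 1 ≤ 3 * (m * μ) := by nlinarith
    have h3 : m + 1 ≤ 2 * m := by omega
    calc (m + 1) * ((m + 1) * (κ * (N + 1)))
        ≤ (2 * m) * ((2 * m) * (κ * (3 * (m * μ)))) := by gcongr
      _ = 12 * κ * (m ^ 3 * μ) := by ring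
      _ ≤ _ := by gcongr; omega

theorem runsInTime_of_run (p : Prog (Alph n) (St n (8 * h) (nearBound h))) (A : List (Word n))
    (out : Output n) {t T : ℕ}
    (hr : Run p {} { inp := encodeInput A } {} { out := encodeOutput out } t) (ht : t ≤ T) :
    RunsInTime { tm := p.toFinTM2 {} (some WorkStack.inp) none
                 inputAlphabet := Equiv.refl _
                 outputAlphabet := Equiv.refl _ } A out T := by
  have e1 : ({ inp := encodeInput A } : Mem n).stk =
      Function.update (β := fun k => List (Alph n k)) (fun _ => []) (some WorkStack.inp) (encodeInput A) := by
    funext k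
    rcases k with _ | k
    · rfl
    · cases k <;> rfl
  have e2 : ({ out := encodeOutput out } : Mem n).stk =
      Function.update (β := fun k => List (Alph n k)) (fun _ => []) none (encodeOutput out) := by
    funext k
    rcases k with _ | k
    · rfl
    · cases k <;> rfl
  have hr' : Exec p {} ({ inp := encodeInput A } : Mem n).stk {}
      ({ out := encodeOutput out } : Mem n).stk T := Run.mono hr ht
  rw [e1, e2] at hr'
  have e3 : (encodeInput A).map (Equiv.refl (Option (Fin n))).symm = encodeInput A := by simp
  have e4 : (encodeOutput out).map (Equiv.refl (Fin n ⊕ Bool)).symm = encodeOutput out := by simp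
  have key := hr'.outputsInTime
  rw [← e3, ← e4] at key
  exact key

theorem segmentProd_eq_wprod (A : List (Word n)) (i : ℕ) :
    segmentProd X A i A.length = wprod X (A.drop (i - 1)) := by
  rw [segmentProd, List.take_length]; rfl

end Main

end WordHyp

theorem mainTheorem3 {G : Type*} [Group G] {n : ℕ} (X : Fin n → G)
    (hgen : Subgroup.closure (Set.range X) = ⊤)
    (hinv : ∀ i : Fin n, ∃ j : Fin n, X j = (X i)⁻¹) :
    ∃ K : ℕ, ∀ δ : ℝ, 1 ≤ δ → WordHyp.IsHyperbolic X δ →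
      ∃ M : Turing.TM2ComputableAux (Option (Fin n)) (Fin n ⊕ Bool),
        ∀ A : List (WordHyp.Word n), ∃ out : WordHyp.Output n,
          WordHyp.IsCorrectOutput X δ A out ∧
          WordHyp.RunsInTime M A out
            (K * (A.length ^ 3 * max (WordHyp.maxLength A) 1 + 1)) := by
  open WordHyp in
  by_cases hex : ∃ δ : ℝ, 1 ≤ δ ∧ IsHyperbolic X δ
  swap
  -- If no admissible `δ` exists, any constant will do.
  · exact ⟨0, fun δ h1 h2 => absurd ⟨δ, h1, h2⟩ hex⟩
  obtain ⟨δ', h1', hδ'⟩ := hex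
  obtain ⟨δ₀, h1, hδ₀, hmin⟩ := exists_min_isHyperbolic h1' hδ'
  have hX := isSymmGenerating_of_closure hgen hinv
  have H := IsHyperbolic.fourPoint hX hδ₀
  -- The constants of the machine are natural numbers, so `δ₀ + 1/2` is rounded up.
  obtain ⟨h, hh⟩ : ∃ h : ℕ, h = ⌈δ₀ + 1 / 2⌉₊ := ⟨_, rfl⟩
  have hη : δ₀ + 1 / 2 ≤ h := hh ▸ Nat.le_ceil _
  have hh1 : 1 ≤ h := by
    have : (1 : ℝ) ≤ h := by linarith
    exact_mod_cast this
  refine ⟨12 * (200 * h + 400), fun δ hδ1 hδ => ⟨{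
    tm := (shortenWords X h ⌊40 * (δ₀ + 1 / 2)⌋₊).toFinTM2 {} (some WorkStack.inp) none
    inputAlphabet := Equiv.refl _
    outputAlphabet := Equiv.refl _ }, fun A => ?_⟩⟩
  obtain ⟨out, ho, hr⟩ := run_shortenWords (B := ⌊40 * (δ₀ + 1 / 2)⌋₊) hX hh1 (by linarith) hη H
    (fun k hk => Nat.le_floor hk) A
  refine ⟨out, ?_, runsInTime_of_run _ A out hr (time_bound _ A)⟩
  rcases ho with ⟨c, rfl, hc⟩ | ⟨A', T, R, rfl, hT, hinf, rfl⟩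
  · intro i hi hiA
    have h2 := hc (A.drop (i - 1)) (List.drop_suffix _ _)
      (by rw [Ne, List.drop_eq_nil_iff]; omega)
    rw [segmentProd_eq_wprod]
    have h3 : (wordLength X ((eval X c)⁻¹ * wprod X (A.drop (i - 1)) * eval X c) : ℝ) ≤
        40 * (δ₀ + 1 / 2) :=
      (Nat.cast_le.2 h2).trans (Nat.floor_le (by linarith))
    have h4 := hmin δ hδ1 hδ
    have h5 : (1 : ℝ) ≤ 3 ^ (A.length - i) := one_le_pow₀ (by norm_num)
    -- `40δ₀ + 20 ≤ 239δ + 29/2` because `δ₀ ≤ δ` and `1 ≤ δ`.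
    have h6 : (40 : ℝ) * (δ₀ + 1 / 2) ≤ 7 * constL δ + δ + 1 / 2 := by
      unfold constL; linarith
    have h7 : (0 : ℝ) ≤ 7 * constL δ + δ + 1 / 2 := by linarith
    nlinarith
  · have hTl := List.length_pos_iff.2 hT
    refine ⟨by omega, by omega, by simp, ?_⟩
    have : segmentProd X (A' ++ T ++ R) (A'.length + 1) (A'.length + T.length) = wprod X T := by
      rw [segmentProd, ← List.length_append, List.take_left, Nat.add_sub_cancel, List.drop_left]
      rfl
    rwa [this]
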